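/- **Setting.** A $k$-action partial monitoring game ($k\ge 1$) consists of a nonempty latent space $\mathcal Z$, a signal set $\Sigma$, a loss function $\mathcal L:[k]\times\mathcal Z\to[0,1]$ and a signal function $\mathcal S:[k]\times\mathcal Z\to\Sigma$. Let $\mathscr P(A)$ be the set of finitely supported probability distributions on a set $A$ and $\mathscr P_m(A)$ those supported on at most $m$ points; put $\mathcal K=\mathscr P(\mathcal Z)$, and let $\Delta_k$ be the probability simplex in $\mathbb R^k$. For $x\in\mathcal K$ and $\pi\in\Delta_k$ let $\mathcal L(a,x)=\sum_z x(z)\mathcal L(a,z)$ and $\mathcal L(\pi,x)=\sum_a\pi(a)\mathcal L(a,x)$, and let $\mathcal S(a,x)$ be the law of $\mathcal S(a,z)$ for $z\sim x$. Consider either of two settings: * *Standard setting*: $\mathcal Z$ is finite or infinite, $\mathcal V(\pi,x)=\mathcal L(\pi,x)$ and $\mathcal V_\star(x)=\min_{a\in[k]}\mathcal L(a,x)$. * *Rustichini setting*: $\mathcal Z$ is finite, $\mathcal V(\pi,x)=\sup\{\mathcal L(\pi,y): y\in\mathcal K,\ \mathcal S(a,y)=\mathcal S(a,x)\ \text{for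 all } a\in[k]\}$ and $\mathcal V_\star(x)=\min_{\pi\in\Delta_k}\mathcal V(\pi,x)$. A learner $\mathscr L$ chooses in round $t$ a distribution $\pi_t\in\Delta_k$ as a function of $a_1,\sigma_1,\dots,a_{t-1},\sigma_{t-1}$ and samples $a_t\sim\pi_t$; the adversary fixes $x_1,\dots,x_n\in\mathcal K$ in advance, $z_t\sim x_t$ independently, and the learner observes only $\sigma_t=\mathcal S(a_t,z_t)$. For $n\ge1$ the regret, the minimax regret and the minimax regret against stationary stochastic adversaries are $$\mathfrak R_n(\mathscr L,(x_t)_{t=1}^n)=\mathbb E\Big[\sum_{t=1}^n\mathcal V(\pi_t,x_t)\Big]-n\,\mathcal V_\star\Big(\frac1n\sum_{t=1}^n x_t\Big),$$ $$\mathfrak R_n^\star=\inf_{\mathscr L}\sup_{x_1,\dots,x_n\in\mathcal K}\mathfrak R_n(\mathscr L,(x_t)_{t=1}^n),\qquad \mathfrak R_n^{\mathrm{st}}=\inf_{\mathscr L}\sup_{x\in\mathcal K}\mathfrak R_n(\mathscr L,(x,\dots,x)).$$ Let $m$ be the least number of linear functions on $\mathcal K$ (functions $x\mapsto\sum_z x(z)f(z)$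 with $f:\mathcal Z\to\mathbb R$) whose pointwise minimum is $\mathcal V_\star$. For $\mu\in\mathscr P(\mathcal K)$ with mean $\bar\mu=\sum_x\mu(x)x\in\mathcal K$ let $$\Delta(\pi,\mu)=\sum_x\mu(x)\big(\mathcal V(\pi,x)-\mathcal V_\star(x)\big),\qquad \mathrm I(\pi,\mu)=\sum_{a=1}^k\pi(a)\sum_{x:\mu(x)>0}\mathrm{KL}\big(\mathcal S(a,\bar\mu),\mathcal S(a,x)\big),$$ where $\mathrm{KL}$ takes values in $[0,\infty]$ and $0\cdot\infty=0$. For $\lambda>1$ let $$\Psi_\star^\lambda=\sup_{\mu\in\mathscr P_m(\mathcal K)}\ \inf_{\pi\in\Delta_k}\frac{\Delta(\pi,\mu)^\lambda}{\mathrm I(\pi,\mu)}\in[0,\infty]$$ with $0/0=0$, $c/0=\infty$ for $c>0$ and $c/\infty=0$, and let $\lambda_\star=\inf\{\lambda>1:\Psi_\star^\lambda<\infty\}\in[1,\infty]$, where $\inf\emptyset=\infty$ and $1/\infty=0$. **Theorem.** In both the standard and the Rustichini setting, $$\limsup_{n\to\infty}\frac{\log(\mathfrak R_n^\star)}{\log(n)}=1-\frac1{\lambda_\star},$$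 and stationary stochastic adversaries already force this rate: $$\limsup_{n\to\infty}\frac{\log(\mathfrak R_n^{\mathrm{st}})}{\log(n)}=1-\frac1{\lambda_\star}.$$ Here $\log 0$ is read as $0$. This convention is needed only for trivial games: either $\mathfrak R_n^\star=\mathfrak R_n^{\mathrm{st}}=0$ for all $n\ge1$, or $\mathfrak R_n^\star>0$ and $\mathfrak R_n^{\mathrm{st}}>0$ for all $n\ge1$. -/

import Mathlib

open Filter Topology MeasureTheory
open scoped ENNReal

noncomputable section

namespace PartialMonitoring

/-- Finitely supported probability distributions on `X`. -/
abbrev FinDist (X : Type*) := Convexity.StdSimplex ℝ X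

/-- The probability simplex over the `k` actions. -/
abbrev Policy (k : ℕ) := stdSimplex ℝ (Fin k)

/-- A `k`-action partial monitoring game with latent space `Z` and signal set `Sig`; both may be
infinite. -/
structure Game (k : ℕ) (Z Sig : Type*) where
  /-- the loss of an action at a latent state -/
  loss : Fin k → Z → ℝ
  loss_mem : ∀ a z, loss a z ∈ Set.Icc (0 : ℝ) 1
  /-- the signal revealed by an action at a latent state -/
  signal : Fin k → Z → Sig

/-- Which notion of regret is used. -/
inductive Setting where
  | standard : Setting
  | rustichini : Setting

/-- The measure with point masses given by `p`, on the discrete (`⊤`) sigma-algebra. -/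
def toMeasure {X : Type*} (p : FinDist X) : @Measure X ⊤ :=
  letI : MeasurableSpace X := ⊤
  p.weights.sum fun s w => ENNReal.ofReal w • Measure.dirac s

/-- Relative entropy between finitely supported distributions, with values in `[0, ∞]`. -/
def kl {X : Type*} (p q : FinDist X) : ℝ≥0∞ :=
  letI : MeasurableSpace X := ⊤
  InformationTheory.klDiv (toMeasure p) (toMeasure q)

/-- The uniform distribution on `Fin n`. -/
def uniform (n : ℕ) (hn : 0 < n) : FinDist (Fin n) where
  weights := Finsupp.equivFunOnFinite.symm fun _ => (1 / n : ℝ)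
  nonneg := fun _ => by simp
  total := by
    rw [Finsupp.sum_fintype _ _ (fun _ => rfl)]
    have : (n : ℝ) ≠ 0 := by positivity
    simp [this]

/-- The average `(1 / n) ∑ t, x t` of `n` distributions. -/
def averageDist {Z : Type*} {n : ℕ} (hn : 0 < n) (x : Fin n → FinDist Z) : FinDist Z :=
  (uniform n hn).iConvexComb x

/-- A learner: for each round, a map from the history of actions and signals of the previous
rounds to the distribution from which the next action is sampled. -/
abbrev Learner (k : ℕ) (Sig : Type*) := (t : ℕ) → (Fin t → Fin k × Sig) → Policy k

namespace Game

variable {k : ℕ} {Z Sig : Type*} (G : Game k Z Sig)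

/-- The loss, extended linearly to distributions on the latent space. -/
def lossAt (a : Fin k) (x : FinDist Z) : ℝ := x.weights.sum fun z w => w * G.loss a z

/-- The loss, extended linearly in both arguments. -/
def policyLoss (π : Policy k) (x : FinDist Z) : ℝ := ∑ a, π.1 a * G.lossAt a x

/-- The law of the signal of action `a` when the latent state has distribution `x`. -/
def signalLaw (a : Fin k) (x : FinDist Z) : FinDist Sig := x.map (G.signal a)

/-- `x` and `y` have the same signal distribution for every action. -/
def Indist (x y : FinDist Z) : Prop := ∀ a, G.signalLaw a x = G.signalLaw a y

/-- The value `V(π, x)` of a policy against a distribution, in either setting. -/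
def value : Setting → Policy k → FinDist Z → ℝ
  | .standard, π, x => G.policyLoss π x
  | .rustichini, π, x => sSup {v | ∃ y, G.Indist y x ∧ v = G.policyLoss π y}

/-- The baseline value `V⋆(x)`: the best single action in the standard setting, the best
policy in the Rustichini setting. -/
def optValue : Setting → FinDist Z → ℝ
  | .standard, x => ⨅ a : Fin k, G.lossAt a x
  | .rustichini, x => ⨅ π : Policy k, G.value .rustichini π x

/-- The actions and signals of the first `t` rounds when the actions are `a` and the latent states
are `z`. -/
def history {n : ℕ} (a : Fin n → Fin k) (z : Fin n → Z) (t : Fin n) :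
    Fin (t : ℕ) → Fin k × Sig :=
  fun s => (a (s.castLE t.isLt.le), G.signal (a (s.castLE t.isLt.le)) (z (s.castLE t.isLt.le)))

/-- The probability of the actions `a` and latent states `z` when the latent states are independent
with `z t` drawn from `x t`, and `a t` is drawn by the learner given the history. -/
def trajProb {n : ℕ} (L : Learner k Sig) (x : Fin n → FinDist Z)
    (a : Fin n → Fin k) (z : Fin n → Z) : ℝ :=
  ∏ t : Fin n, (L t (G.history a z t)).1 (a t) * (x t).weights (z t)

/-- The expectation of `∑ t, V(π_t, x_t)`, where `π_t` is the conditional law of the action of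
round `t` given the history. -/
def expectedValue (s : Setting) {n : ℕ} (L : Learner k Sig) (x : Fin n → FinDist Z) : ℝ :=
  ∑ a : Fin n → Fin k, ∑ z ∈ Fintype.piFinset fun t => (x t).weights.support,
    G.trajProb L x a z * ∑ t : Fin n, G.value s (L t (G.history a z t)) (x t)

/-- The regret over `n` rounds (zero for `n = 0`). -/
def regret (s : Setting) {n : ℕ} (L : Learner k Sig) (x : Fin n → FinDist Z) : ℝ :=
  if hn : 0 < n then G.expectedValue s L x - n * G.optValue s (averageDist hn x) else 0

/-- The minimax regret over `n` rounds. -/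
def minimaxRegret (s : Setting) (n : ℕ) : ℝ :=
  ⨅ L : Learner k Sig, ⨆ x : Fin n → FinDist Z, G.regret s L x

/-- The minimax regret over `n` rounds when the adversary is restricted to playing the same
distribution in every round. -/
def stochasticMinimaxRegret (s : Setting) (n : ℕ) : ℝ :=
  ⨅ L : Learner k Sig, ⨆ x : FinDist Z, G.regret s L (fun _ : Fin n => x)

/-- The least number of linear functions on distributions whose pointwise minimum is `V⋆`. -/
def numPieces (s : Setting) : ℕ :=
  sInf {m | ∃ f : Fin m → Z → ℝ, ∀ x : FinDist Z,
    IsLeast (Set.range fun i => x.weights.sum fun z w => w * f i z) (G.optValue s x)}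

/-- The information gain `I(π, μ)`. -/
def infoGain (π : Policy k) (μ : FinDist (FinDist Z)) : ℝ≥0∞ :=
  ∑ a, ENNReal.ofReal (π.1 a) *
    ∑ x ∈ μ.weights.support, kl (G.signalLaw a μ.sConvexComb) (G.signalLaw a x)

/-- The expected one-round regret `Δ(π, μ)`. -/
def instRegret (s : Setting) (π : Policy k) (μ : FinDist (FinDist Z)) : ℝ :=
  μ.weights.sum fun x w => w * (G.value s π x - G.optValue s x)

/-- The information ratio `Δ(π, μ) ^ l / I(π, μ)`; in `ℝ≥0∞` one has `0 / 0 = 0`, `c / 0 = ∞` for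
`c ≠ 0`, and `c / ∞ = 0`. -/
def infoRatio (s : Setting) (l : ℝ) (π : Policy k) (μ : FinDist (FinDist Z)) : ℝ≥0∞ :=
  ENNReal.ofReal (G.instRegret s π μ) ^ l / G.infoGain π μ

/-- The minimax information ratio: supremum over priors supported on at most `numPieces` points. -/
def minimaxInfoRatio (s : Setting) (l : ℝ) : ℝ≥0∞ :=
  ⨆ μ : {μ : FinDist (FinDist Z) // μ.weights.support.card ≤ G.numPieces s},
    ⨅ π : Policy k, G.infoRatio s l π μ.1

/-- The critical exponent `λ⋆ ∈ [1, ∞]`, equal to `∞` if there is no admissible exponent. -/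
def critExponent (s : Setting) : EReal :=
  sInf ((fun l : ℝ => (l : EReal)) '' {l : ℝ | 1 < l ∧ G.minimaxInfoRatio s l < ∞})

end Game

end PartialMonitoring

end

/-!
The theorem follows from two non-asymptotic bounds that use only a few properties of the game,
common to both settings: the value `V(π, x)` is continuous and convex in `π` and concave in `x`,
and the baseline `V⋆` is below the value and is the minimum of `numPieces` bounded linear functions
(`exists_pieces`). For Rustichini's regret the last property is linear programming: by duality
(`exists_indist_dualValue_le`) the value is an infimum over the functions on the latent space that
are determined by the signal laws and dominate the loss of `π`, and a polyhedron in an orthant has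
finitely many points that matter (`exists_finite_dominating`).

*Upper bound* (`minimaxRegret_le`). The learners form a compact space, the regret is continuous in
the learner, and two learners can be mixed, so that minimax duality reduces the claim to the
regret averaged over a finitely supported prior on the choices of the adversary
(`minimaxRegret_le_of_bayes`). There the learner plays, in every round, a policy with small
information ratio for the posterior means of `x t` given the optimal piece of `V⋆`. Its regret is
at most `θ` plus a multiple of the information gain (`instRegret_le`), and the information gain is
at most the expected increase of the logarithmic barrier of the posterior
(`exists_policy_step`). The barrier stays logarithmic in the horizon because the optimal piece is
only observed through a noise of level `1 / n`.

*Lower bound* (`exists_stochasticMinimaxRegret_ge`). If the information ratio is unbounded for the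
exponent `l`, there is a prior `μ` under which all policies have a regret of at least `d₀`, and
gain information at most in proportion to their regret (`infoGain_le_of_infoRatio_ge`). A learner
cannot distinguish the points of the support of `μ` from the mean of `μ` before its accumulated
regret is of order `n * d₀` (`exists_regret_ge`); the comparison is made through the Hellinger
affinity of the laws of the history, stopped when the accumulated regret reaches a threshold.

The regret against a stationary adversary is nondecreasing in the horizon, and it vanishes only if
some policy is optimal against every latent distribution, which then has no regret against any
adversary (`regret_dichotomy`). The growth exponents are read off in `limsup_log_div_log_eq`.
-/

noncomputable section

namespace PartialMonitoring

open Convexity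

/-! ### Expectations under finitely supported distributions -/

/-- The expectation `∑ z, x z * f z` of `f` under the finitely supported distribution `x`. -/
def ev {X : Type*} (x : FinDist X) (f : X → ℝ) : ℝ := x.weights.sum fun z w => w * f z

section ev

variable {X Y : Type*}

lemma ev_eq_sum (x : FinDist X) (f : X → ℝ) :
    ev x f = ∑ z ∈ x.weights.support, x.weights z * f z := rfl

lemma ev_eq_sum_of_subset (x : FinDist X) (f : X → ℝ) {S : Finset X}
    (hS : x.weights.support ⊆ S) : ev x f = ∑ z ∈ S, x.weights z * f z :=
  Finsupp.sum_of_support_subset _ hS _ (by simp)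

lemma ev_fintype [Fintype X] (x : FinDist X) (f : X → ℝ) :
    ev x f = ∑ z, x.weights z * f z :=
  ev_eq_sum_of_subset x f (Finset.subset_univ _)

lemma ev_const (x : FinDist X) (c : ℝ) : ev x (fun _ => c) = c := by
  have := x.total
  rw [Finsupp.sum] at this
  rw [ev_eq_sum, ← Finset.sum_mul, this, one_mul]

lemma sum_weights (x : FinDist X) {S : Finset X} (hS : x.weights.support ⊆ S) :
    ∑ z ∈ S, x.weights z = 1 := by
  have := ev_eq_sum_of_subset x (fun _ => (1 : ℝ)) hS
  rw [ev_const] at this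
  simpa using this.symm

lemma ev_add (x : FinDist X) (f g : X → ℝ) : ev x (fun z => f z + g z) = ev x f + ev x g := by
  simp only [ev_eq_sum, mul_add, Finset.sum_add_distrib]

lemma ev_sub (x : FinDist X) (f g : X → ℝ) : ev x (fun z => f z - g z) = ev x f - ev x g := by
  simp only [ev_eq_sum, mul_sub, Finset.sum_sub_distrib]

lemma ev_const_mul (x : FinDist X) (c : ℝ) (f : X → ℝ) :
    ev x (fun z => c * f z) = c * ev x f := by
  simp only [ev_eq_sum, Finset.mul_sum]
  exact Finset.sum_congr rfl fun z _ => by ring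

lemma ev_sum {ι : Type*} (s : Finset ι) (x : FinDist X) (f : ι → X → ℝ) :
    ev x (fun z => ∑ i ∈ s, f i z) = ∑ i ∈ s, ev x (f i) := by
  simp only [ev_eq_sum, Finset.mul_sum]
  exact Finset.sum_comm

lemma ev_mono_on (x : FinDist X) {f g : X → ℝ} (h : ∀ z, x.weights z ≠ 0 → f z ≤ g z) :
    ev x f ≤ ev x g :=
  Finset.sum_le_sum fun z hz =>
    mul_le_mul_of_nonneg_left (h z (Finsupp.mem_support_iff.1 hz)) (x.nonneg z)

lemma ev_mono (x : FinDist X) {f g : X → ℝ} (h : ∀ z, f z ≤ g z) : ev x f ≤ ev x g :=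
  ev_mono_on x fun z _ => h z

lemma ev_nonneg (x : FinDist X) {f : X → ℝ} (h : ∀ z, 0 ≤ f z) : 0 ≤ ev x f :=
  Finset.sum_nonneg fun z _ => mul_nonneg (x.nonneg z) (h z)

lemma ev_le_of_forall_le (x : FinDist X) {f : X → ℝ} {c : ℝ} (h : ∀ z, f z ≤ c) : ev x f ≤ c :=
  (ev_mono x h).trans_eq (ev_const x c)

lemma ev_map (x : FinDist X) (g : X → Y) (f : Y → ℝ) : ev (x.map g) f = ev x (fun z => f (g z)) := by
  rw [ev, StdSimplex.weights_map, Finsupp.sum_mapDomain_index] <;> simp [ev, add_mul]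

lemma ev_sConvexComb (μ : FinDist (FinDist X)) (f : X → ℝ) :
    ev μ.sConvexComb f = ev μ (fun x => ev x f) := by
  rw [ev, StdSimplex.weights_sConvexComb, Finsupp.sum_sum_index (by simp) (by simp [add_mul]),
    ev_eq_sum, Finsupp.sum]
  refine Finset.sum_congr rfl fun x _ => ?_
  rw [Finsupp.sum_smul_index (by simp), ev_eq_sum, Finsupp.sum, Finset.mul_sum]
  exact Finset.sum_congr rfl fun z _ => by simp [mul_assoc]

lemma ev_iConvexComb (p : FinDist Y) (x : Y → FinDist X) (f : X → ℝ) :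
    ev (p.iConvexComb x) f = ev p (fun i => ev (x i) f) := by
  rw [iConvexComb, ev_sConvexComb, ev_map]

open Classical in
lemma weights_eq_ev (x : FinDist X) (z : X) :
    x.weights z = ev x (fun y => if y = z then 1 else 0) := by
  by_cases hz : z ∈ x.weights.support
  · simp [ev_eq_sum, hz]
  · simp [ev_eq_sum, Finsupp.notMem_support_iff.1 hz]

lemma findist_ext {x y : FinDist X} (h : ∀ f : X → ℝ, ev x f = ev y f) : x = y := by
  ext z
  rw [weights_eq_ev, weights_eq_ev, h]

lemma weights_iConvexComb_apply (p : FinDist Y) (x : Y → FinDist X) (z : X) :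
    (p.iConvexComb x).weights z = ev p (fun i => (x i).weights z) := by
  classical
  rw [weights_eq_ev, ev_iConvexComb]
  simp only [← weights_eq_ev]

lemma ev_single (z : X) (f : X → ℝ) : ev (StdSimplex.single z) f = f z := by
  simp [ev]

/-- A finitely supported distribution from a nonnegative function on a finite type with
sum one. -/
def ofFintype [Fintype X] (p : X → ℝ) (hp : ∀ i, 0 ≤ p i) (h1 : ∑ i, p i = 1) : FinDist X where
  weights := Finsupp.equivFunOnFinite.symm p
  nonneg := fun i => hp i
  total := by rw [Finsupp.sum_fintype _ _ (fun _ => rfl)]; simpa using h1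

@[simp] lemma weights_ofFintype [Fintype X] (p : X → ℝ) (hp h1) (i : X) :
    (ofFintype p hp h1).weights i = p i := rfl

lemma ev_averageDist {n : ℕ} (hn : 0 < n) (x : Fin n → FinDist X) (f : X → ℝ) :
    n * ev (averageDist hn x) f = ∑ t, ev (x t) f := by
  rw [averageDist, ev_iConvexComb, ev_fintype, Finset.mul_sum]
  refine Finset.sum_congr rfl fun t _ => ?_
  have : (n : ℝ) ≠ 0 := by positivity
  simp [uniform, this]

lemma averageDist_const {n : ℕ} (hn : 0 < n) (x : FinDist X) :
    averageDist hn (fun _ => x) = x := by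
  simp [averageDist]

end ev

/-! ### Relative entropy of finitely supported distributions -/

section kl

variable {X : Type*}

lemma toMeasure_eq (p : FinDist X) :
    toMeasure p = ∑ s ∈ p.weights.support,
      ENNReal.ofReal (p.weights s) • @Measure.dirac X ⊤ s := rfl

lemma lintegral_toMeasure (p : FinDist X) (f : X → ℝ≥0∞) :
    @lintegral X ⊤ (toMeasure p) f
      = ∑ s ∈ p.weights.support, ENNReal.ofReal (p.weights s) * f s := by
  let _ : MeasurableSpace X := ⊤
  rw [toMeasure_eq, lintegral_finsetSum_measure]
  simp

lemma isProbabilityMeasure_toMeasure (p : FinDist X) :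
    @IsProbabilityMeasure X ⊤ (toMeasure p) := by
  let _ : MeasurableSpace X := ⊤
  refine ⟨?_⟩
  rw [← lintegral_one, lintegral_toMeasure]
  simp only [mul_one]
  rw [← ENNReal.ofReal_sum_of_nonneg fun i _ => p.nonneg i, sum_weights p subset_rfl,
    ENNReal.ofReal_one]

lemma integral_toMeasure (p : FinDist X) (f : X → ℝ) :
    @integral X ℝ _ _ ⊤ (toMeasure p) f = ev p f := by
  let _ : MeasurableSpace X := ⊤
  have hd : ∀ s, Integrable f (ENNReal.ofReal (p.weights s) • Measure.dirac s) := fun s =>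
    (integrable_dirac (by finiteness)).smul_measure (by finiteness)
  rw [toMeasure_eq, integral_finsetSum_measure fun s _ => hd s, ev_eq_sum]
  refine Finset.sum_congr rfl fun s _ => ?_
  rw [integral_smul_measure, integral_dirac, ENNReal.toReal_ofReal (p.nonneg s), smul_eq_mul]

lemma toMeasure_singleton (p : FinDist X) (s : X) :
    toMeasure p {s} = ENNReal.ofReal (p.weights s) := by
  classical
  let _ : MeasurableSpace X := ⊤
  rw [← lintegral_indicator_one (MeasurableSet.singleton s), lintegral_toMeasure]
  by_cases hs : s ∈ p.weights.support
  · rw [Finset.sum_eq_single s] <;> simp +contextual [Set.indicator]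
  · rw [Finset.sum_eq_zero]
    · simp [Finsupp.notMem_support_iff.1 hs]
    · intro y hy
      have : y ≠ s := fun h => hs (h ▸ hy)
      simp [Set.indicator, this]

/-- Relative entropy is finite as soon as the supports are nested, and then is the usual sum. -/
lemma kl_eq_ofReal (p q : FinDist X) (h : ∀ s, q.weights s = 0 → p.weights s = 0) :
    kl p q = ENNReal.ofReal (ev p fun s => Real.log (p.weights s / q.weights s)) := by
  let _ : MeasurableSpace X := ⊤
  have := isProbabilityMeasure_toMeasure p
  have := isProbabilityMeasure_toMeasure q
  set g : X → ℝ≥0∞ := fun s => ENNReal.ofReal (p.weights s / q.weights s) with hg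
  have hgm : Measurable g := measurable_from_top
  have hdens : toMeasure p = (toMeasure q).withDensity g := by
    ext A hA
    rw [withDensity_apply _ hA, ← lintegral_indicator_one hA, ← lintegral_indicator hA,
      lintegral_toMeasure, lintegral_toMeasure]
    have hsub : p.weights.support ⊆ q.weights.support := fun s hs => by
      simp only [Finsupp.mem_support_iff] at hs ⊢
      exact fun h0 => hs (h s h0)
    refine (Finset.sum_subset hsub fun s _ hs => ?_).trans (Finset.sum_congr rfl fun s hs => ?_)
    · simp [Finsupp.notMem_support_iff.1 hs]
    · have hq : 0 < q.weights s :=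
        lt_of_le_of_ne (q.nonneg s) (Ne.symm (Finsupp.mem_support_iff.1 hs))
      by_cases hsA : s ∈ A
      · simp only [Set.indicator_of_mem hsA, hg, Pi.one_apply, mul_one]
        rw [← ENNReal.ofReal_mul (q.nonneg s), mul_div_cancel₀ _ hq.ne']
      · simp [hsA]
  have hac : toMeasure p ≪ toMeasure q := hdens ▸ withDensity_absolutelyContinuous _ _
  have hrn : (toMeasure p).rnDeriv (toMeasure q) =ᵐ[toMeasure q] g := by
    conv_lhs => rw [hdens]
    exact Measure.rnDeriv_withDensity _ hgm
  have hllr : llr (toMeasure p) (toMeasure q) =ᵐ[toMeasure p]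
      fun s => Real.log (p.weights s / q.weights s) := by
    filter_upwards [hac.ae_le hrn] with s hs
    rw [llr, hs, hg]
    simp only
    rw [ENNReal.toReal_ofReal (div_nonneg (p.nonneg s) (q.nonneg s))]
  have hint : Integrable (fun s => Real.log (p.weights s / q.weights s)) (toMeasure p) := by
    rw [toMeasure_eq, integrable_finsetSum_measure]
    exact fun s _ => (integrable_dirac (by finiteness)).smul_measure (by finiteness)
  have hne : InformationTheory.klDiv (toMeasure p) (toMeasure q) ≠ ∞ :=
    InformationTheory.klDiv_ne_top hac ((integrable_congr hllr).2 hint)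
  have htr := InformationTheory.toReal_klDiv_of_measure_eq hac (by simp)
  rw [integral_congr_ae hllr, integral_toMeasure] at htr
  rw [← htr]
  exact (ENNReal.ofReal_toReal hne).symm

lemma support_subset_of_kl_ne_top (p q : FinDist X) (h : kl p q ≠ ∞) (s : X)
    (hs : q.weights s = 0) : p.weights s = 0 := by
  let _ : MeasurableSpace X := ⊤
  have hac : toMeasure p ≪ toMeasure q := (InformationTheory.klDiv_ne_top_iff.1 h).1
  have := hac (s := {s}) (by rw [toMeasure_singleton, hs, ENNReal.ofReal_zero])
  rw [toMeasure_singleton, ENNReal.ofReal_eq_zero] at this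
  exact le_antisymm this (p.nonneg s)

lemma ev_log_div_nonneg (p q : FinDist X) (h : ∀ s, q.weights s = 0 → p.weights s = 0) :
    0 ≤ ev p fun s => Real.log (p.weights s / q.weights s) := by
  classical
  have h1 : ev p (fun s => 1 - q.weights s / p.weights s) ≤
      ev p fun s => Real.log (p.weights s / q.weights s) := by
    refine ev_mono_on p fun s hs => ?_
    have hp : 0 < p.weights s := lt_of_le_of_ne (p.nonneg s) hs.symm
    have hq : 0 < q.weights s := lt_of_le_of_ne (q.nonneg s) fun h0 => hs (h s h0.symm)
    have := Real.one_sub_inv_le_log_of_pos (div_pos hp hq)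
    rwa [inv_div] at this
  refine le_trans ?_ h1
  rw [ev_sub, ev_const, sub_nonneg, ev_eq_sum_of_subset p _
    (Finset.subset_union_left (s₂ := q.weights.support)),
    ← sum_weights q (Finset.subset_union_right (s₁ := p.weights.support))]
  refine Finset.sum_le_sum fun s _ => ?_
  by_cases hs : p.weights s = 0
  · simp [hs]
  · rw [mul_div_cancel₀ _ hs]

/-- The Hellinger affinity is bounded below by the relative entropy. -/
lemma one_sub_kl_le_affinity (p q : FinDist X) (h : kl p q ≠ ∞) {S : Finset X}
    (hS : p.weights.support ⊆ S) :
    1 - (kl p q).toReal / 2 ≤ ∑ s ∈ S, √(p.weights s * q.weights s) := by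
  have hac := support_subset_of_kl_ne_top p q h
  have hkl : (kl p q).toReal = ev p fun s => Real.log (p.weights s / q.weights s) := by
    rw [kl_eq_ofReal p q hac, ENNReal.toReal_ofReal (ev_log_div_nonneg p q hac)]
  have h1 : 1 - (kl p q).toReal / 2
      = ev p fun s => 1 - (1 / 2) * Real.log (p.weights s / q.weights s) := by
    rw [ev_sub, ev_const, ev_const_mul, hkl]; ring
  rw [h1, ev_eq_sum_of_subset p _ hS]
  refine Finset.sum_le_sum fun s _ => ?_
  by_cases hs : p.weights s = 0
  · simp [hs]
  have hp : 0 < p.weights s := lt_of_le_of_ne (p.nonneg s) (Ne.symm hs)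
  have hq : 0 < q.weights s := lt_of_le_of_ne (q.nonneg s) fun h0 => hs (hac s h0.symm)
  have hsq : √(p.weights s * q.weights s) = p.weights s * √(q.weights s / p.weights s) := by
    rw [show p.weights s * q.weights s = p.weights s ^ 2 * (q.weights s / p.weights s) by
      field_simp, Real.sqrt_mul (by positivity), Real.sqrt_sq hp.le]
  rw [hsq]
  refine mul_le_mul_of_nonneg_left ?_ hp.le
  have := Real.log_le_sub_one_of_pos (Real.sqrt_pos.2 (div_pos hq hp))
  rw [Real.log_sqrt (div_pos hq hp).le, Real.log_div hq.ne' hp.ne'] at this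
  rw [Real.log_div hp.ne' hq.ne']
  linarith

end kl

/-! ### Vertices of polyhedra in the nonnegative orthant -/

/-- The intersection of the nonnegative orthant with an affine subspace `A` contains a finite set
which is at least as good as the whole intersection for every nonnegative linear objective. The
set consists of the points that are determined by their support: any other point can be moved
along `A`, without increasing the objective, until its support shrinks. -/
lemma exists_finite_dominating {ι : Type*} [Fintype ι] (A : Set (ι → ℝ))
    (hA : ∀ w ∈ A, ∀ w' ∈ A, ∀ c : ℝ, w + c • (w' - w) ∈ A) :
    ∃ B : Set (ι → ℝ), B.Finite ∧ (∀ b ∈ B, b ∈ A ∧ ∀ i, 0 ≤ b i) ∧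
      ∀ c : ι → ℝ, (∀ i, 0 ≤ c i) → ∀ w ∈ A, (∀ i, 0 ≤ w i) →
        ∃ b ∈ B, ∑ i, c i * b i ≤ ∑ i, c i * w i := by
  classical
  set F : Set (ι → ℝ) := {w | w ∈ A ∧ ∀ i, 0 ≤ w i} with hF
  set supp : (ι → ℝ) → Finset ι := fun w => Finset.univ.filter fun i => w i ≠ 0 with hsupp
  set B : Set (ι → ℝ) := {w | w ∈ F ∧ ∀ w' ∈ F, supp w' = supp w → w' = w} with hB
  refine ⟨B, ?_, fun b hb => hb.1, ?_⟩
  · refine Set.Finite.of_finite_image (f := supp) (Set.toFinite _) ?_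
    intro w hw w' hw' h
    exact hw'.2 w hw.1 h
  intro c hc
  have key : ∀ N : ℕ, ∀ w ∈ F, (supp w).card = N →
      ∃ b ∈ B, ∑ i, c i * b i ≤ ∑ i, c i * w i := by
    intro N
    induction N using Nat.strong_induction_on with
    | _ N ih =>
    intro w hw hcard
    by_cases hwB : w ∈ B
    · exact ⟨w, hwB, le_rfl⟩
    obtain ⟨w', hw', hs, hne⟩ : ∃ w' ∈ F, supp w' = supp w ∧ w' ≠ w := by
      by_contra hcon
      push Not at hcon
      exact hwB ⟨hw, fun w' h1 h2 => hcon w' h1 h2⟩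
    have hzero : ∀ i, w i = 0 → w' i = 0 := fun i hi => by
      have : i ∉ supp w := by simp [hsupp, hi]
      rw [← hs] at this
      simpa [hsupp] using this
    -- a direction along which the objective does not increase and some coordinate decreases
    obtain ⟨d, hdA, hd0, hdc, i₀, hi₀⟩ : ∃ d : ι → ℝ, (∀ r : ℝ, w + r • d ∈ A) ∧
        (∀ i, w i = 0 → d i = 0) ∧ ∑ i, c i * d i ≤ 0 ∧ ∃ i, d i < 0 := by
      have hA1 : ∀ r : ℝ, w + r • (w' - w) ∈ A := hA w hw.1 w' hw'.1
      have hz1 : ∀ i, w i = 0 → (w' - w) i = 0 := fun i hi => by simp [hi, hzero i hi]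
      by_cases h1 : ∑ i, c i * (w' - w) i ≤ 0 ∧ ∃ i, (w' - w) i < 0
      · exact ⟨w' - w, hA1, hz1, h1⟩
      · refine ⟨-(w' - w), fun r => ?_, fun i hi => by simp [hi, hzero i hi], ?_⟩
        · have := hA1 (-r)
          rwa [neg_smul, ← smul_neg] at this
        · have hneg : ∑ i, c i * (-(w' - w)) i = - ∑ i, c i * (w' - w) i := by
            simp only [Pi.neg_apply, mul_neg, Finset.sum_neg_distrib]
          by_cases h2 : ∃ i, (w' - w) i < 0
          · have h3 : ¬ ∑ i, c i * (w' - w) i ≤ 0 := fun h => h1 ⟨h, h2⟩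
            push Not at h3
            refine ⟨by rw [hneg]; linarith, ?_⟩
            by_contra h4
            push Not at h4
            have : ∑ i, c i * (-(w' - w)) i ≥ 0 :=
              Finset.sum_nonneg fun i _ => mul_nonneg (hc i) (h4 i)
            rw [hneg] at this
            linarith
          · push Not at h2
            refine ⟨?_, ?_⟩
            · rw [hneg, neg_nonpos]
              exact Finset.sum_nonneg fun i _ => mul_nonneg (hc i) (h2 i)
            · by_contra h4
              push Not at h4
              refine hne (funext fun i => ?_)
              have ha := h2 i
              have hb := h4 i
              simp only [Pi.neg_apply, Pi.sub_apply] at ha hb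
              linarith
    obtain ⟨j, hj, hmin⟩ := Finset.exists_min_image (Finset.univ.filter fun i => d i < 0)
      (fun i => w i / (-d i)) ⟨i₀, by simp [hi₀]⟩
    simp only [Finset.mem_filter, Finset.mem_univ, true_and] at hj hmin
    set r := w j / (-d j) with hr
    have hr0 : 0 ≤ r := div_nonneg (hw.2 j) (by linarith)
    have hnew : w + r • d ∈ F := by
      refine ⟨hdA r, fun i => ?_⟩
      simp only [Pi.add_apply, Pi.smul_apply, smul_eq_mul]
      by_cases hi : d i < 0
      · have := hmin i hi
        rw [le_div_iff₀ (by linarith)] at this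
        linarith
      · push Not at hi
        have := hw.2 i
        positivity
    have hjw : w j ≠ 0 := fun h => by have := hd0 j h; linarith
    have hss : supp (w + r • d) ⊂ supp w := by
      refine Finset.ssubset_iff_subset_ne.2 ⟨fun i hi => ?_, fun h => ?_⟩
      · simp only [hsupp, Finset.mem_filter, Finset.mem_univ, true_and] at hi ⊢
        intro h0
        exact hi (by simp [h0, hd0 i h0])
      · have : j ∈ supp w := by simp [hsupp, hjw]
        rw [← h] at this
        simp only [hsupp, Finset.mem_filter, Finset.mem_univ, true_and] at this
        apply this
        simp only [Pi.add_apply, Pi.smul_apply, smul_eq_mul, hr]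
        have : d j ≠ 0 := hj.ne
        field_simp
        ring
    obtain ⟨b, hb, hle⟩ := ih _ (hcard ▸ Finset.card_lt_card hss) _ hnew rfl
    refine ⟨b, hb, hle.trans ?_⟩
    have : ∑ i, c i * (w + r • d) i = ∑ i, c i * w i + r * ∑ i, c i * d i := by
      rw [Finset.mul_sum, ← Finset.sum_add_distrib]
      refine Finset.sum_congr rfl fun i _ => ?_
      simp only [Pi.add_apply, Pi.smul_apply, smul_eq_mul]
      ring
    rw [this]
    nlinarith
  exact fun w hwA hw => key _ w ⟨hwA, hw⟩ rfl

namespace Game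

variable {k : ℕ} {Z Sig : Type*} (G : Game k Z Sig)

/-! ### Losses and signals -/

/-- The loss of the policy `π` at the latent state `z`. -/
def polLoss (π : Policy k) (z : Z) : ℝ := ∑ a, π.1 a * G.loss a z

lemma lossAt_eq_ev (a : Fin k) (x : FinDist Z) : G.lossAt a x = ev x (G.loss a) := rfl

lemma policyLoss_eq_ev (π : Policy k) (x : FinDist Z) : G.policyLoss π x = ev x (G.polLoss π) := by
  unfold polLoss policyLoss
  rw [ev_sum]
  simp only [ev_const_mul, lossAt_eq_ev]

lemma lossAt_mem (a : Fin k) (x : FinDist Z) : G.lossAt a x ∈ Set.Icc (0 : ℝ) 1 :=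
  ⟨ev_nonneg x fun z => (G.loss_mem a z).1, ev_le_of_forall_le x fun z => (G.loss_mem a z).2⟩

lemma policy_sum (π : Policy k) : ∑ a, π.1 a = 1 := π.2.2

lemma policy_nonneg (π : Policy k) (a : Fin k) : 0 ≤ π.1 a := π.2.1 a

lemma polLoss_mem (π : Policy k) (z : Z) : G.polLoss π z ∈ Set.Icc (0 : ℝ) 1 := by
  refine ⟨Finset.sum_nonneg fun a _ => mul_nonneg (policy_nonneg π a) (G.loss_mem a z).1, ?_⟩
  rw [← policy_sum π]
  exact Finset.sum_le_sum fun a _ =>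
    mul_le_of_le_one_right (policy_nonneg π a) (G.loss_mem a z).2

lemma policyLoss_mem (π : Policy k) (x : FinDist Z) : G.policyLoss π x ∈ Set.Icc (0 : ℝ) 1 := by
  rw [policyLoss_eq_ev]
  exact ⟨ev_nonneg x fun z => (G.polLoss_mem π z).1,
    ev_le_of_forall_le x fun z => (G.polLoss_mem π z).2⟩

lemma policyLoss_le_add (π π' : Policy k) (x : FinDist Z) :
    G.policyLoss π x ≤ G.policyLoss π' x + ∑ a, |π.1 a - π'.1 a| := by
  unfold policyLoss
  rw [← Finset.sum_add_distrib]
  refine Finset.sum_le_sum fun a _ => ?_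
  have h := G.lossAt_mem a x
  have h1 := le_abs_self (π.1 a - π'.1 a)
  have h2 : (π.1 a - π'.1 a) * G.lossAt a x ≤ |π.1 a - π'.1 a| := by
    refine (mul_le_mul_of_nonneg_right h1 h.1).trans ?_
    exact mul_le_of_le_one_right (abs_nonneg _) h.2
  linarith

lemma signalLaw_iConvexComb {ι : Type*} (a : Fin k) (p : FinDist ι) (x : ι → FinDist Z) :
    G.signalLaw a (p.iConvexComb x) = p.iConvexComb fun i => G.signalLaw a (x i) := by
  refine findist_ext fun f => ?_
  simp only [signalLaw, ev_map, ev_iConvexComb]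

lemma indist_refl (x : FinDist Z) : G.Indist x x := fun _ => rfl

lemma ev_comp_signal_of_indist {x y : FinDist Z} (h : G.Indist x y) (a : Fin k) (f : Sig → ℝ) :
    ev x (fun z => f (G.signal a z)) = ev y (fun z => f (G.signal a z)) := by
  rw [← ev_map x (G.signal a) f, ← ev_map y (G.signal a) f]
  exact congrArg (fun q => ev q f) (h a)

/-! ### The value of a policy -/

lemma bddAbove_values (π : Policy k) (x : FinDist Z) :
    BddAbove {v | ∃ y, G.Indist y x ∧ v = G.policyLoss π y} :=
  ⟨1, by rintro _ ⟨y, -, rfl⟩; exact (G.policyLoss_mem π y).2⟩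

lemma nonempty_values (π : Policy k) (x : FinDist Z) :
    {v | ∃ y, G.Indist y x ∧ v = G.policyLoss π y}.Nonempty :=
  ⟨_, x, G.indist_refl x, rfl⟩

lemma policyLoss_le_value (π : Policy k) {x y : FinDist Z} (h : G.Indist y x) :
    G.policyLoss π y ≤ G.value .rustichini π x :=
  le_csSup (G.bddAbove_values π x) ⟨y, h, rfl⟩

lemma value_rustichini_le {π : Policy k} {x : FinDist Z} {c : ℝ}
    (h : ∀ y, G.Indist y x → G.policyLoss π y ≤ c) : G.value .rustichini π x ≤ c :=
  csSup_le (G.nonempty_values π x) (by rintro _ ⟨y, hy, rfl⟩; exact h y hy)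

variable (s : Setting)

lemma value_mem (π : Policy k) (x : FinDist Z) : G.value s π x ∈ Set.Icc (0 : ℝ) 1 := by
  cases s with
  | standard => exact G.policyLoss_mem π x
  | rustichini =>
    exact ⟨(G.policyLoss_mem π x).1.trans (G.policyLoss_le_value π (G.indist_refl x)),
      G.value_rustichini_le fun y _ => (G.policyLoss_mem π y).2⟩

lemma value_le_add (π π' : Policy k) (x : FinDist Z) :
    G.value s π x ≤ G.value s π' x + ∑ a, |π.1 a - π'.1 a| := by
  cases s with
  | standard => exact G.policyLoss_le_add π π' x
  | rustichini =>
    refine G.value_rustichini_le fun y hy => (G.policyLoss_le_add π π' y).trans ?_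
    have := G.policyLoss_le_value π' hy
    linarith

lemma continuous_value (x : FinDist Z) : Continuous fun π : Policy k => G.value s π x := by
  rw [continuous_iff_continuousAt]
  intro π
  have hc : Continuous fun π' : Policy k => ∑ a, |π'.1 a - π.1 a| := by
    refine continuous_finsetSum _ fun a _ => ?_
    exact (((continuous_apply a).comp continuous_subtype_val).sub continuous_const).abs
  have ht : Tendsto (fun π' : Policy k => ∑ a, |π'.1 a - π.1 a|) (𝓝 π) (𝓝 0) := by
    have := hc.tendsto π
    simpa using this
  rw [ContinuousAt, tendsto_iff_dist_tendsto_zero]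
  refine squeeze_zero (fun _ => dist_nonneg) (fun π' => ?_) ht
  rw [Real.dist_eq, abs_le]
  have h1 := G.value_le_add s π π' x
  have h2 := G.value_le_add s π' π x
  simp only [abs_sub_comm] at h1 h2 ⊢
  constructor <;> linarith

lemma policyLoss_combination {θ₁ θ₂ : ℝ} {π π₁ π₂ : Policy k}
    (h : ∀ a, π.1 a = θ₁ * π₁.1 a + θ₂ * π₂.1 a) (x : FinDist Z) :
    G.policyLoss π x = θ₁ * G.policyLoss π₁ x + θ₂ * G.policyLoss π₂ x := by
  simp only [policyLoss, Finset.mul_sum, ← Finset.sum_add_distrib, h]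
  exact Finset.sum_congr rfl fun a _ => by ring

lemma value_convex {θ₁ θ₂ : ℝ} (h₁ : 0 ≤ θ₁) (h₂ : 0 ≤ θ₂) {π π₁ π₂ : Policy k}
    (h : ∀ a, π.1 a = θ₁ * π₁.1 a + θ₂ * π₂.1 a) (x : FinDist Z) :
    G.value s π x ≤ θ₁ * G.value s π₁ x + θ₂ * G.value s π₂ x := by
  cases s with
  | standard => exact (G.policyLoss_combination h x).le
  | rustichini =>
    refine G.value_rustichini_le fun y hy => ?_
    rw [G.policyLoss_combination h y]
    exact add_le_add (mul_le_mul_of_nonneg_left (G.policyLoss_le_value π₁ hy) h₁)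
      (mul_le_mul_of_nonneg_left (G.policyLoss_le_value π₂ hy) h₂)

/-- The value of a policy is a concave function of the latent distribution. -/
lemma ev_value_le {ι : Type*} (π : Policy k) (p : FinDist ι) (x : ι → FinDist Z) :
    ev p (fun i => G.value s π (x i)) ≤ G.value s π (p.iConvexComb x) := by
  cases s with
  | standard =>
    simp only [value, policyLoss_eq_ev, ev_iConvexComb]
    exact le_rfl
  | rustichini =>
    refine le_of_forall_pos_le_add fun ε hε => ?_
    have : ∀ i, ∃ y, G.Indist y (x i) ∧ G.value .rustichini π (x i) - ε < G.policyLoss π y := by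
      intro i
      obtain ⟨_, ⟨y, hy, rfl⟩, h⟩ :=
        exists_lt_of_lt_csSup (G.nonempty_values π (x i)) (sub_lt_self _ hε)
      exact ⟨y, hy, h⟩
    choose y hy hlt using this
    have hind : G.Indist (p.iConvexComb y) (p.iConvexComb x) := fun a => by
      rw [signalLaw_iConvexComb, signalLaw_iConvexComb]
      exact congrArg _ (funext fun i => hy i a)
    have h1 := G.policyLoss_le_value π hind
    rw [policyLoss_eq_ev, ev_iConvexComb] at h1
    simp only [← policyLoss_eq_ev] at h1
    have h2 : ev p (fun i => G.value .rustichini π (x i) - ε) ≤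
        ev p fun i => G.policyLoss π (y i) := ev_mono p fun i => (hlt i).le
    rw [ev_sub, ev_const] at h2
    linarith

/-! ### The baseline value -/

lemma optValue_nonneg (x : FinDist Z) : 0 ≤ G.optValue s x := by
  cases s with
  | standard => exact Real.iInf_nonneg fun a => (G.lossAt_mem a x).1
  | rustichini => exact Real.iInf_nonneg fun π => (G.value_mem .rustichini π x).1

lemma optValue_standard_le (a : Fin k) (x : FinDist Z) :
    G.optValue .standard x ≤ G.lossAt a x :=
  ciInf_le (Set.finite_range _).bddBelow a

lemma optValue_le_value (π : Policy k) (x : FinDist Z) : G.optValue s x ≤ G.value s π x := by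
  cases s with
  | standard =>
    have : ∑ a, π.1 a * G.optValue .standard x ≤ G.policyLoss π x :=
      Finset.sum_le_sum fun a _ =>
        mul_le_mul_of_nonneg_left (G.optValue_standard_le a x) (policy_nonneg π a)
    rwa [← Finset.sum_mul, policy_sum, one_mul] at this
  | rustichini =>
    exact ciInf_le ⟨0, by rintro _ ⟨π, rfl⟩; exact (G.value_mem .rustichini π x).1⟩ π

/-- `f` is a finite family of linear functions with pointwise minimum the baseline value. -/
def IsPieces {ι : Type*} (f : ι → Z → ℝ) : Prop :=
  ∀ x : FinDist Z, IsLeast (Set.range fun i => ev x (f i)) (G.optValue s x)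

lemma ev_convexCombPair {X : Type*} (a b : ℝ) (ha hb hab) (x y : FinDist X) (f : X → ℝ) :
    ev (convexCombPair a b ha hb hab x y) f = a * ev x f + b * ev y f := by
  rw [ev, StdSimplex.weights_convexCombPair, Finsupp.sum_add_index' (by simp) (by simp [add_mul]),
    Finsupp.sum_smul_index (by simp), Finsupp.sum_smul_index (by simp)]
  simp only [ev, Finsupp.sum, Finset.mul_sum, mul_assoc]

/-- In the standard setting the pieces of a minimal family are bounded: each of them is the unique
minimiser somewhere, and moving from there a little towards `z` bounds it at `z`. -/
lemma exists_pieces_standard (hk : 0 < k) :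
    ∃ f : Fin (G.numPieces .standard) → Z → ℝ, G.IsPieces .standard f ∧ ∀ i z, f i z ≤ 1 := by
  have hne : {m | ∃ f : Fin m → Z → ℝ, G.IsPieces .standard f}.Nonempty := by
    refine ⟨k, G.loss, fun x => ?_⟩
    have : Nonempty (Fin k) := ⟨⟨0, hk⟩⟩
    obtain ⟨a, ha⟩ := exists_eq_ciInf_of_finite (f := fun a => G.lossAt a x)
    refine ⟨⟨a, ha⟩, ?_⟩
    rintro _ ⟨b, rfl⟩
    exact G.optValue_standard_le b x
  obtain ⟨f, hf⟩ : ∃ f : Fin (G.numPieces .standard) → Z → ℝ, G.IsPieces .standard f :=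
    Nat.sInf_mem hne
  have hmin : ∀ m' (g : Fin m' → Z → ℝ), G.IsPieces .standard g → G.numPieces .standard ≤ m' :=
    fun m' g hg => Nat.sInf_le ⟨g, hg⟩
  refine ⟨f, hf, ?_⟩
  revert f hmin
  generalize G.numPieces .standard = m
  intro f hf hmin i z
  obtain ⟨x, hx⟩ : ∃ x, ∀ j, j ≠ i → G.optValue .standard x < ev x (f j) := by
    by_contra hcon
    push Not at hcon
    cases m with
    | zero => exact i.elim0
    | succ m' =>
      have : m' + 1 ≤ m' := hmin m' (fun j => f (i.succAbove j)) fun x => by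
        obtain ⟨j, hj, hle⟩ := hcon x
        obtain ⟨j', rfl⟩ := Fin.exists_succAbove_eq hj
        refine ⟨⟨j', le_antisymm hle ((hf x).2 ⟨_, rfl⟩)⟩, ?_⟩
        rintro _ ⟨l, rfl⟩
        exact (hf x).2 ⟨_, rfl⟩
      omega
  -- for small `ε` the piece `i` is still the minimiser at `(1 - ε) x + ε z`
  have hev : ∀ᶠ ε : ℝ in 𝓝[>] 0, ∀ j, j ≠ i →
      (1 - ε) * G.optValue .standard x + ε < (1 - ε) * ev x (f j) + ε * f j z := by
    rw [eventually_all]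
    intro j
    by_cases hj : j = i
    · simp [hj]
    · have h1 : Tendsto (fun ε : ℝ => (1 - ε) * G.optValue .standard x + ε) (𝓝[>] 0)
          (𝓝 (G.optValue .standard x)) := by
        have : Continuous fun ε : ℝ => (1 - ε) * G.optValue .standard x + ε := by fun_prop
        have := (this.tendsto 0).mono_left (nhdsWithin_le_nhds (s := Set.Ioi 0))
        simpa using this
      have h2 : Tendsto (fun ε : ℝ => (1 - ε) * ev x (f j) + ε * f j z) (𝓝[>] 0)
          (𝓝 (ev x (f j))) := by
        have : Continuous fun ε : ℝ => (1 - ε) * ev x (f j) + ε * f j z := by fun_prop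
        have := (this.tendsto 0).mono_left (nhdsWithin_le_nhds (s := Set.Ioi 0))
        simpa using this
      filter_upwards [h1.eventually_lt h2 (hx j hj)] with ε hε _ using hε
  obtain ⟨ε, hε, hε0, hε1⟩ := (hev.and (Ioo_mem_nhdsGT (zero_lt_one' ℝ))).exists
  set y := convexCombPair (1 - ε) ε (by linarith) hε0.le (by ring) x (StdSimplex.single z) with hy
  have hyf : ∀ g : Z → ℝ, ev y g = (1 - ε) * ev x g + ε * g z := fun g => by
    rw [hy, ev_convexCombPair, ev_single]
  have hopt : G.optValue .standard y ≤ (1 - ε) * G.optValue .standard x + ε := by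
    have : Nonempty (Fin k) := ⟨⟨0, hk⟩⟩
    obtain ⟨a, ha⟩ := exists_eq_ciInf_of_finite (f := fun a => G.lossAt a x)
    have ha' : G.lossAt a x = G.optValue .standard x := ha
    refine (G.optValue_standard_le a y).trans ?_
    rw [← ha', lossAt_eq_ev, lossAt_eq_ev, hyf]
    have := (G.loss_mem a z).2
    nlinarith
  obtain ⟨j, hj⟩ := (hf y).1
  have hji : j = i := by
    by_contra hne
    have h1 := hε j hne
    have h2 : ev y (f j) = G.optValue .standard y := hj
    rw [hyf] at h2
    linarith
  subst hji
  have h2 : ev y (f j) = G.optValue .standard y := hj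
  have h3 : G.optValue .standard x ≤ ev x (f j) := (hf x).2 ⟨_, rfl⟩
  rw [hyf] at h2
  have h4 : (1 - ε) * G.optValue .standard x ≤ (1 - ε) * ev x (f j) :=
    mul_le_mul_of_nonneg_left h3 (by linarith)
  have h5 : ε * f j z ≤ ε * 1 := by linarith
  exact le_of_mul_le_mul_left h5 hε0

/-! ### Linear programming duality for Rustichini's value -/

/-- A function on the latent space is observable if its mean is determined by the signal
laws. -/
def Observable (f : Z → ℝ) : Prop := ∀ x y : FinDist Z, G.Indist x y → ev x f = ev y f

lemma observable_const (c : ℝ) : G.Observable fun _ => c := fun x y _ => by simp only [ev_const]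

variable {G} in
lemma Observable.add {f g : Z → ℝ} (hf : G.Observable f) (hg : G.Observable g) :
    G.Observable fun z => f z + g z := fun x y h => by rw [ev_add, ev_add, hf x y h, hg x y h]

variable {G} in
lemma Observable.const_mul {f : Z → ℝ} (c : ℝ) (hf : G.Observable f) :
    G.Observable fun z => c * f z := fun x y h => by rw [ev_const_mul, ev_const_mul, hf x y h]

/-- The least mean under `x` of an observable function that dominates `c`. -/
def dualValue (x : FinDist Z) (c : Z → ℝ) : ℝ :=
  sInf {r | ∃ f, G.Observable f ∧ (∀ z, c z ≤ f z) ∧ r = ev x f}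

lemma dualValue_le (x : FinDist Z) {c f : Z → ℝ} (hc : ∃ b, ∀ z, b ≤ c z) (hf : G.Observable f)
    (h : ∀ z, c z ≤ f z) : G.dualValue x c ≤ ev x f := by
  obtain ⟨b, hb⟩ := hc
  refine csInf_le ⟨b, ?_⟩ ⟨f, hf, h, rfl⟩
  rintro _ ⟨g, -, hg, rfl⟩
  exact (ev_const x b).symm.le.trans (ev_mono x fun z => (hb z).trans (hg z))

lemma le_dualValue (x : FinDist Z) {c : Z → ℝ} {r : ℝ} (hc : ∃ b, ∀ z, c z ≤ b)
    (h : ∀ f, G.Observable f → (∀ z, c z ≤ f z) → r ≤ ev x f) : r ≤ G.dualValue x c := by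
  obtain ⟨b, hb⟩ := hc
  refine le_csInf ⟨_, fun _ => b, G.observable_const b, hb, rfl⟩ ?_
  rintro _ ⟨f, hf, hcf, rfl⟩
  exact h f hf hcf

/-- Strong duality: the dual value is attained by a distribution with the same signal laws. -/
lemma exists_indist_dualValue_le [Finite Z] (x : FinDist Z) (c : Z → ℝ) :
    ∃ y, G.Indist y x ∧ G.dualValue x c ≤ ev y c := by
  classical
  cases nonempty_fintype Z
  have : Nonempty Z := x.nonempty
  have hlo : ∀ g : Z → ℝ, ∃ b, ∀ z, b ≤ g z := fun g =>
    (Set.finite_range g).bddBelow.imp fun b hb z => hb ⟨z, rfl⟩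
  have hup : ∀ g : Z → ℝ, ∃ b, ∀ z, g z ≤ b := fun g =>
    (Set.finite_range g).bddAbove.imp fun b hb z => hb ⟨z, rfl⟩
  by_cases hc0 : c = 0
  · subst hc0
    refine ⟨x, G.indist_refl x, ?_⟩
    exact G.dualValue_le x (hlo _) (G.observable_const 0) fun z => le_rfl
  set N := G.dualValue x with hN
  have hadd : ∀ f g, N (f + g) ≤ N f + N g := by
    intro f g
    have h1 : ∀ f', G.Observable f' → (∀ z, f z ≤ f' z) → N (f + g) - N g ≤ ev x f' := by
      intro f' hf' hff'
      rw [sub_le_comm]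
      refine G.le_dualValue x (hup g) fun g' hg' hgg' => ?_
      rw [sub_le_iff_le_add', ← ev_add]
      exact G.dualValue_le x (hlo _) (hf'.add hg') fun z => add_le_add (hff' z) (hgg' z)
    have := G.le_dualValue x (hup f) h1
    linarith
  have hhom1 : ∀ r : ℝ, 0 < r → ∀ f : Z → ℝ, r * N f ≤ N (r • f) := by
    intro r hr f
    refine G.le_dualValue x (hup _) fun f' hf' h => ?_
    have h1 : N f ≤ ev x fun z => r⁻¹ * f' z := by
      refine G.dualValue_le x (hlo f) (hf'.const_mul _) fun z => ?_
      have := h z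
      rw [Pi.smul_apply, smul_eq_mul] at this
      rw [inv_mul_eq_div, le_div_iff₀ hr]
      linarith
    rw [ev_const_mul, inv_mul_eq_div, le_div_iff₀ hr] at h1
    linarith
  have hhom : ∀ r : ℝ, 0 < r → ∀ f : Z → ℝ, N (r • f) = r * N f := by
    intro r hr f
    refine le_antisymm ?_ (hhom1 r hr f)
    have := hhom1 r⁻¹ (inv_pos.2 hr) (r • f)
    rw [smul_smul, inv_mul_cancel₀ hr.ne', one_smul, inv_mul_eq_div, div_le_iff₀ hr] at this
    linarith
  have hN0 : 0 ≤ N 0 := by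
    refine G.le_dualValue x (hup _) fun f' _ h => ev_nonneg x h
  obtain ⟨g, hgc, hgN⟩ := exists_extension_of_le_sublinear
    (LinearPMap.mkSpanSingleton (K := ℝ) c (N c) hc0) N hhom hadd (by
      rintro ⟨v, hv⟩
      obtain ⟨r, rfl⟩ := Submodule.mem_span_singleton.1 hv
      rw [LinearPMap.mkSpanSingleton'_apply, smul_eq_mul]
      change r * N c ≤ N (r • c)
      rcases lt_trichotomy r 0 with hr | rfl | hr
      · have h1 := hadd (r • c) ((-r) • c)
        rw [← add_smul, add_neg_cancel, zero_smul, hhom (-r) (by linarith)] at h1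
        linarith
      · simpa using hN0
      · exact hhom1 r hr c)
  have hgN' : ∀ f, G.Observable f → g f ≤ ev x f := fun f hf =>
    (hgN f).trans (G.dualValue_le x (hlo f) hf fun _ => le_rfl)
  have hgobs : ∀ f, G.Observable f → g f = ev x f := by
    intro f hf
    refine le_antisymm (hgN' f hf) ?_
    have h1 := hgN' (fun z => (-1) * f z) (hf.const_mul _)
    rw [ev_const_mul] at h1
    have h2 : (fun z => (-1) * f z) = -f := by ext; simp
    rw [h2, map_neg] at h1
    linarith
  have hgpos : ∀ f : Z → ℝ, (∀ z, 0 ≤ f z) → 0 ≤ g f := by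
    intro f hf
    have h1 : N (-f) ≤ ev x fun _ => 0 :=
      G.dualValue_le x (hlo _) (G.observable_const 0) fun z => by simpa using hf z
    have h2 := hgN (-f)
    rw [ev_const] at h1
    rw [map_neg] at h2
    linarith
  have hgsum : ∀ f : Z → ℝ, g f = ∑ z, g (Pi.single z 1) * f z := by
    intro f
    conv_lhs => rw [← Finset.univ_sum_single f]
    rw [map_sum]
    refine Finset.sum_congr rfl fun z _ => ?_
    have : (Pi.single z (f z) : Z → ℝ) = f z • Pi.single z 1 := by
      rw [← Pi.single_smul, smul_eq_mul, mul_one]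
    rw [this, map_smul, smul_eq_mul, mul_comm]
  let y : FinDist Z := ofFintype (fun z => g (Pi.single z 1))
    (fun z => hgpos _ fun z' => by
      by_cases h : z' = z
      · subst h; simp
      · simp [h])
    (by
      have h1 := hgobs _ (G.observable_const 1)
      rw [hgsum, ev_const] at h1
      simpa using h1)
  have hy : ∀ f, ev y f = g f := fun f => by rw [ev_fintype, hgsum]; rfl
  refine ⟨y, fun a => findist_ext fun f => ?_, ?_⟩
  · simp only [signalLaw, ev_map]
    rw [hy]
    exact hgobs _ fun x' y' h => G.ev_comp_signal_of_indist h a f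
  · rw [hy]
    refine le_of_eq ?_
    have := hgc ⟨c, Submodule.mem_span_singleton_self c⟩
    rw [this]
    have h1 := LinearPMap.mkSpanSingleton_apply ℝ ℝ (σ := RingHom.id ℝ) hc0 (N c)
    exact h1.symm

/-- Rustichini's baseline is a minimum of finitely many linear functions. -/
lemma exists_pieces_rustichini [Finite Z] [Nonempty Z] (hk : 0 < k) :
    ∃ (m : ℕ) (f : Fin m → Z → ℝ), G.IsPieces .rustichini f := by
  classical
  cases nonempty_fintype Z
  -- pairs `(g, p)` with `p` a policy and `g + L(p, ·)` an observable bound for the loss of `p`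
  set A : Set (Z ⊕ Fin k → ℝ) := {w | ∑ a, w (.inr a) = 1 ∧
    G.Observable fun z => w (.inl z) + ∑ a, w (.inr a) * G.loss a z} with hA
  obtain ⟨B, hBfin, hBA, hB⟩ := exists_finite_dominating A (by
    rintro w ⟨hw1, hw2⟩ w' ⟨hw1', hw2'⟩ c
    refine ⟨?_, ?_⟩
    · simp only [Pi.add_apply, Pi.smul_apply, Pi.sub_apply, smul_eq_mul, Finset.sum_add_distrib,
        ← Finset.mul_sum, Finset.sum_sub_distrib, hw1, hw1']
      ring
    · have := (hw2.const_mul (1 - c)).add (hw2'.const_mul c)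
      convert this using 2 with z
      simp only [Pi.add_apply, Pi.smul_apply, Pi.sub_apply, smul_eq_mul, mul_add, Finset.mul_sum]
      have h : ∀ a : Fin k, (w (.inr a) + c * (w' (.inr a) - w (.inr a))) * G.loss a z
          = (1 - c) * (w (.inr a) * G.loss a z) + c * (w' (.inr a) * G.loss a z) :=
        fun a => by ring
      simp only [h, Finset.sum_add_distrib]
      ring)
  have hBne : Nonempty (Fin k) := ⟨⟨0, hk⟩⟩
  set F : (Z ⊕ Fin k → ℝ) → Z → ℝ := fun w z => w (.inl z) + ∑ a, w (.inr a) * G.loss a z with hF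
  -- every policy and observable bound is dominated by one of the finitely many
  have hdom : ∀ (x : FinDist Z) (π : Policy k) (f : Z → ℝ), G.Observable f →
      (∀ z, G.polLoss π z ≤ f z) → ∃ b ∈ B, ev x (F b) ≤ ev x f := by
    intro x π f hf hπ
    have hobj : ∀ w : Z ⊕ Fin k → ℝ,
        ∑ i, Sum.elim (fun z => x.weights z) (fun a => G.lossAt a x) i * w i = ev x (F w) := by
      intro w
      rw [Fintype.sum_sum_type, hF, ev_add, ev_fintype, ev_sum]
      simp only [ev_const_mul, Sum.elim_inl, Sum.elim_inr]
      congr 1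
      exact Finset.sum_congr rfl fun a _ => mul_comm _ _
    set w : Z ⊕ Fin k → ℝ := Sum.elim (fun z => f z - G.polLoss π z) π.1 with hw
    have hFw : F w = f := by
      ext z
      simp [hF, hw, polLoss]
    obtain ⟨b, hb, hle⟩ := hB (Sum.elim (fun z => x.weights z) (fun a => G.lossAt a x))
      (by
        rintro (z | a)
        · exact x.nonneg z
        · exact (G.lossAt_mem a x).1) w
      ⟨policy_sum π, by change G.Observable (F w); rwa [hFw]⟩
      (by
        rintro (z | a)
        · exact sub_nonneg.2 (hπ z)
        · exact policy_nonneg π a)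
    rw [hobj, hobj, hFw] at hle
    exact ⟨b, hb, hle⟩
  have hup : ∀ (x : FinDist Z), ∀ b ∈ B, G.optValue .rustichini x ≤ ev x (F b) := by
    intro x b hb
    obtain ⟨⟨hb1, hb2⟩, hb0⟩ := hBA b hb
    set π : Policy k := ⟨fun a => b (.inr a), fun a => hb0 _, hb1⟩ with hπ
    refine (G.optValue_le_value .rustichini π x).trans (G.value_rustichini_le fun y hy => ?_)
    rw [policyLoss_eq_ev, ← hb2 y x hy]
    refine ev_mono y fun z => ?_
    have := hb0 (.inl z)
    simp only [polLoss, hπ]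
    linarith
  have hlow : ∀ x : FinDist Z, ∃ b ∈ B, ev x (F b) ≤ G.optValue .rustichini x := by
    intro x
    obtain ⟨π₀⟩ : Nonempty (Policy k) := inferInstance
    have hBn : B.Nonempty := by
      obtain ⟨b, hb, -⟩ := hdom x π₀ (fun _ => 1) (G.observable_const 1)
        fun z => (G.polLoss_mem π₀ z).2
      exact ⟨b, hb⟩
    obtain ⟨b, hb, hmin⟩ := Set.exists_min_image B (fun b => ev x (F b)) hBfin hBn
    refine ⟨b, hb, le_ciInf fun π => ?_⟩
    obtain ⟨y, hy, hle⟩ := G.exists_indist_dualValue_le x (G.polLoss π)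
    have h1 : ev x (F b) ≤ G.dualValue x (G.polLoss π) := by
      refine G.le_dualValue x ⟨1, fun z => (G.polLoss_mem π z).2⟩ fun f hf h => ?_
      obtain ⟨b', hb', h'⟩ := hdom x π f hf h
      exact (hmin b' hb').trans h'
    refine (h1.trans hle).trans ?_
    rw [← policyLoss_eq_ev]
    exact G.policyLoss_le_value π hy
  have := hBfin.fintype
  refine ⟨Fintype.card B, fun i => F ((Fintype.equivFin B).symm i), fun x => ⟨?_, ?_⟩⟩
  · obtain ⟨b, hb, hle⟩ := hlow x
    exact ⟨Fintype.equivFin B ⟨b, hb⟩, by simpa using le_antisymm hle (hup x b hb)⟩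
  · rintro _ ⟨i, rfl⟩
    exact hup x _ (Subtype.coe_prop _)

/-- In both settings the baseline is the minimum of `numPieces` bounded linear functions. -/
lemma exists_pieces (hk : 0 < k) [Nonempty Z] (hs : s = .rustichini → Finite Z) :
    ∃ (f : Fin (G.numPieces s) → Z → ℝ) (C : ℝ), G.IsPieces s f ∧ ∀ i z, f i z ≤ C := by
  cases s with
  | standard =>
    obtain ⟨f, hf, h1⟩ := G.exists_pieces_standard hk
    exact ⟨f, 1, hf, h1⟩
  | rustichini =>
    have := hs rfl
    obtain ⟨f, hf⟩ := Nat.sInf_mem (G.exists_pieces_rustichini hk)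
    obtain ⟨C, hC⟩ := (Set.finite_range fun q : Fin _ × Z => f q.1 q.2).bddAbove
    exact ⟨f, C, hf, fun i z => hC ⟨(i, z), rfl⟩⟩

variable {s} in
/-- The baseline value is a concave function of the latent distribution. -/
lemma ev_optValue_le {m : ℕ} {f : Fin m → Z → ℝ} (hf : G.IsPieces s f) {ι : Type*} (p : FinDist ι)
    (x : ι → FinDist Z) : ev p (fun i => G.optValue s (x i)) ≤ G.optValue s (p.iConvexComb x) := by
  obtain ⟨j, hj⟩ := (hf (p.iConvexComb x)).1
  have hj' : ev (p.iConvexComb x) (f j) = G.optValue s (p.iConvexComb x) := hj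
  rw [← hj', ev_iConvexComb]
  exact ev_mono p fun i => (hf (x i)).2 ⟨j, rfl⟩

end Game

/-! ### Sums over histories -/

section paths

variable {Y : Type*}

lemma sum_piFinset_succ {n : ℕ} (s : Fin (n + 1) → Finset Y) (F : (Fin (n + 1) → Y) → ℝ) :
    ∑ h ∈ Fintype.piFinset s, F h = ∑ h ∈ Fintype.piFinset (fun t : Fin n => s t.castSucc),
      ∑ y ∈ s (Fin.last n), F (Fin.snoc h y) := by
  rw [← Finset.sum_product']
  refine Finset.sum_nbij' (fun h => (Fin.init h, h (Fin.last n)))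
    (fun q => Fin.snoc q.1 q.2) ?_ ?_ ?_ ?_ ?_
  · intro h hh
    rw [Fintype.mem_piFinset] at hh
    exact Finset.mem_product.2 ⟨Fintype.mem_piFinset.2 fun t => hh t.castSucc, hh _⟩
  · rintro ⟨h, y⟩ hq
    obtain ⟨h1, h2⟩ := Finset.mem_product.1 hq
    rw [Fintype.mem_piFinset] at h1 ⊢
    intro t
    refine Fin.lastCases ?_ (fun t => ?_) t
    · simpa using h2
    · simpa using h1 t
  · intro h _
    exact Fin.snoc_init_self h
  · rintro ⟨h, y⟩ _
    simp
  · intro h _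
    exact congrArg F (Fin.snoc_init_self h).symm

/-- The product along a history of the weights `K t (history before t) (symbol at t)`. -/
def pathWeight (K : (t : ℕ) → (Fin t → Y) → Y → ℝ) : (t : ℕ) → (Fin t → Y) → ℝ
  | 0, _ => 1
  | t + 1, h => pathWeight K t (Fin.init h) * K t (Fin.init h) (h (Fin.last t))

/-- The sum along a history of the costs `c t (history before t)`. -/
def pathCost (c : (t : ℕ) → (Fin t → Y) → ℝ) : (t : ℕ) → (Fin t → Y) → ℝ
  | 0, _ => 0
  | t + 1, h => pathCost c t (Fin.init h) + c t (Fin.init h)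

/-- The expectation of `F` over histories of length `t` with symbols in `A`, drawn from the
transition weights `K`. -/
def pathExp (K : (t : ℕ) → (Fin t → Y) → Y → ℝ) (A : Finset Y) (t : ℕ)
    (F : (Fin t → Y) → ℝ) : ℝ :=
  ∑ h ∈ Fintype.piFinset (fun _ : Fin t => A), pathWeight K t h * F h

variable (K K' : (t : ℕ) → (Fin t → Y) → Y → ℝ) (A : Finset Y)

@[simp] lemma pathWeight_zero (h : Fin 0 → Y) : pathWeight K 0 h = 1 := rfl

@[simp] lemma pathWeight_snoc (t : ℕ) (h : Fin t → Y) (y : Y) :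
    pathWeight K (t + 1) (Fin.snoc h y) = pathWeight K t h * K t h y := by
  simp [pathWeight]

@[simp] lemma pathCost_snoc (c : (t : ℕ) → (Fin t → Y) → ℝ) (t : ℕ) (h : Fin t → Y) (y : Y) :
    pathCost c (t + 1) (Fin.snoc h y) = pathCost c t h + c t h := by
  simp [pathCost]

lemma pathWeight_nonneg (hK : ∀ t h y, 0 ≤ K t h y) : ∀ t h, 0 ≤ pathWeight K t h
  | 0, _ => zero_le_one
  | t + 1, _ => mul_nonneg (pathWeight_nonneg hK t _) (hK t _ _)

lemma pathWeight_mul : ∀ t h,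
    pathWeight (fun t h y => K t h y * K' t h y) t h = pathWeight K t h * pathWeight K' t h
  | 0, _ => by simp
  | t + 1, h => by
    rw [pathWeight, pathWeight, pathWeight, pathWeight_mul t]
    ring

lemma sqrt_pathWeight (hK : ∀ t h y, 0 ≤ K t h y) : ∀ t h,
    √(pathWeight K t h) = pathWeight (fun t h y => √(K t h y)) t h
  | 0, _ => by simp
  | t + 1, h => by
    rw [pathWeight, pathWeight, Real.sqrt_mul (pathWeight_nonneg K hK t _), sqrt_pathWeight hK t]

lemma pathExp_zero (F : (Fin 0 → Y) → ℝ) : pathExp K A 0 F = F Fin.elim0 := by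
  rw [pathExp, Finset.sum_eq_single Fin.elim0]
  · simp
  · exact fun h _ hne => absurd (Subsingleton.elim _ _) hne
  · intro h
    exact absurd (Fintype.mem_piFinset.2 fun t => t.elim0) h

lemma pathExp_succ (t : ℕ) (F : (Fin (t + 1) → Y) → ℝ) :
    pathExp K A (t + 1) F = pathExp K A t fun h => ∑ y ∈ A, K t h y * F (Fin.snoc h y) := by
  rw [pathExp, sum_piFinset_succ, pathExp]
  refine Finset.sum_congr rfl fun h _ => ?_
  rw [Finset.mul_sum]
  refine Finset.sum_congr rfl fun y _ => ?_
  rw [pathWeight_snoc, mul_assoc]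

lemma pathExp_add (t : ℕ) (F F' : (Fin t → Y) → ℝ) :
    pathExp K A t (fun h => F h + F' h) = pathExp K A t F + pathExp K A t F' := by
  simp only [pathExp, mul_add, Finset.sum_add_distrib]

lemma pathExp_sub (t : ℕ) (F F' : (Fin t → Y) → ℝ) :
    pathExp K A t (fun h => F h - F' h) = pathExp K A t F - pathExp K A t F' := by
  simp only [pathExp, mul_sub, Finset.sum_sub_distrib]

lemma pathExp_const_mul (t : ℕ) (c : ℝ) (F : (Fin t → Y) → ℝ) :
    pathExp K A t (fun h => c * F h) = c * pathExp K A t F := by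
  simp only [pathExp, Finset.mul_sum]
  exact Finset.sum_congr rfl fun h _ => by ring

lemma pathExp_congr (t : ℕ) {F F' : (Fin t → Y) → ℝ}
    (h : ∀ h, pathWeight K t h ≠ 0 → F h = F' h) : pathExp K A t F = pathExp K A t F' := by
  refine Finset.sum_congr rfl fun g _ => ?_
  by_cases hg : pathWeight K t g = 0
  · simp [hg]
  · rw [h g hg]

lemma pathExp_mono (hK : ∀ t h y, 0 ≤ K t h y) (t : ℕ) {F F' : (Fin t → Y) → ℝ}
    (h : ∀ h, F h ≤ F' h) : pathExp K A t F ≤ pathExp K A t F' :=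
  Finset.sum_le_sum fun g _ => mul_le_mul_of_nonneg_left (h g) (pathWeight_nonneg K hK t g)

lemma pathExp_nonneg (hK : ∀ t h y, 0 ≤ K t h y) (t : ℕ) {F : (Fin t → Y) → ℝ}
    (h : ∀ h, 0 ≤ F h) : 0 ≤ pathExp K A t F :=
  Finset.sum_nonneg fun g _ => mul_nonneg (pathWeight_nonneg K hK t g) (h g)

lemma pathExp_init (hK : ∀ t h, ∑ y ∈ A, K t h y = 1) (t : ℕ) (F : (Fin t → Y) → ℝ) :
    pathExp K A (t + 1) (fun h => F (Fin.init h)) = pathExp K A t F := by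
  rw [pathExp_succ]
  refine pathExp_congr _ _ _ fun h _ => ?_
  simp only [Fin.init_snoc, ← Finset.sum_mul, hK, one_mul]

lemma pathExp_const (hK : ∀ t h, ∑ y ∈ A, K t h y = 1) (c : ℝ) :
    ∀ t, pathExp K A t (fun _ => c) = c
  | 0 => pathExp_zero _ _ _
  | t + 1 => (pathExp_init K A hK t fun _ => c).trans (pathExp_const hK c t)

lemma pathExp_pathCost (hK : ∀ t h, ∑ y ∈ A, K t h y = 1) (c : (t : ℕ) → (Fin t → Y) → ℝ) :
    ∀ n, pathExp K A n (pathCost c n) = ∑ t ∈ Finset.range n, pathExp K A t (c t)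
  | 0 => by simp [pathExp_zero, pathCost]
  | n + 1 => by
    rw [Finset.sum_range_succ, ← pathExp_pathCost hK c n, ← pathExp_add,
      ← pathExp_init K A hK n]
    rfl

end paths

namespace Game

variable {k : ℕ} {Z Sig : Type*} (G : Game k Z Sig) (s : Setting)

/-! ### The law of the history -/

/-- The transition weights of the history of actions and signals. -/
def playKernel (L : Learner k Sig) (ξ : ℕ → FinDist Z) (t : ℕ) (h : Fin t → Fin k × Sig)
    (y : Fin k × Sig) : ℝ :=
  (L t h).1 y.1 * (G.signalLaw y.1 (ξ t)).weights y.2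

/-- The finite set `S` of signals carries every signal law of `x`. -/
def Covers (S : Finset Sig) (x : FinDist Z) : Prop :=
  ∀ a, (G.signalLaw a x).weights.support ⊆ S

lemma exists_covers {ι : Type*} [Finite ι] (x : ι → FinDist Z) :
    ∃ S : Finset Sig, ∀ i, G.Covers S (x i) := by
  classical
  cases nonempty_fintype ι
  refine ⟨Finset.univ.biUnion fun i => Finset.univ.biUnion fun a =>
    (G.signalLaw a (x i)).weights.support, fun i a σ hσ => ?_⟩
  simp only [Finset.mem_biUnion, Finset.mem_univ, true_and]
  exact ⟨i, a, hσ⟩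

lemma playKernel_nonneg (L : Learner k Sig) (ξ : ℕ → FinDist Z) (t h y) :
    0 ≤ G.playKernel L ξ t h y :=
  mul_nonneg (policy_nonneg _ _) (StdSimplex.nonneg _ _)

variable {G} in
lemma Covers.sum_playKernel {S : Finset Sig} {ξ : ℕ → FinDist Z} {t : ℕ} (hS : G.Covers S (ξ t))
    (L : Learner k Sig) (h : Fin t → Fin k × Sig) (F : Fin k × Sig → ℝ) :
    ∑ y ∈ Finset.univ ×ˢ S, G.playKernel L ξ t h y * F y
      = ∑ a, (L t h).1 a * ev (ξ t) fun z => F (a, G.signal a z) := by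
  rw [Finset.sum_product]
  refine Finset.sum_congr rfl fun a _ => ?_
  rw [← ev_map (ξ t) (G.signal a) fun σ => F (a, σ),
    ev_eq_sum_of_subset (StdSimplex.map (G.signal a) (ξ t)) _ (hS a),
    Finset.mul_sum]
  exact Finset.sum_congr rfl fun σ _ => mul_assoc _ _ _

variable {G} in
lemma Covers.sum_playKernel_one {S : Finset Sig} {ξ : ℕ → FinDist Z} {t : ℕ}
    (hS : G.Covers S (ξ t)) (L : Learner k Sig) (h : Fin t → Fin k × Sig) :
    ∑ y ∈ Finset.univ ×ˢ S, G.playKernel L ξ t h y = 1 := by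
  have := hS.sum_playKernel L h fun _ => 1
  simpa [ev_const, policy_sum] using this

/-- The actions and signals of all rounds. -/
def fullHistory {n : ℕ} (a : Fin n → Fin k) (z : Fin n → Z) : Fin n → Fin k × Sig :=
  fun t => (a t, G.signal (a t) (z t))

lemma fullHistory_snoc {n : ℕ} (a : Fin n → Fin k) (z : Fin n → Z) (a' : Fin k) (z' : Z) :
    G.fullHistory (Fin.snoc a a' : Fin (n + 1) → Fin k) (Fin.snoc z z' : Fin (n + 1) → Z)
      = Fin.snoc (G.fullHistory a z) (a', G.signal a' z') := by
  ext t : 1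
  refine Fin.lastCases ?_ (fun t => ?_) t
  · simp [fullHistory]
  · simp [fullHistory]

lemma history_castSucc {n : ℕ} (a : Fin n → Fin k) (z : Fin n → Z) (a' : Fin k) (z' : Z)
    (t : Fin n) :
    G.history (Fin.snoc a a' : Fin (n + 1) → Fin k) (Fin.snoc z z' : Fin (n + 1) → Z) t.castSucc
      = G.history a z t := by
  funext r
  have h : Fin.castLE t.castSucc.isLt.le r = (Fin.castLE t.isLt.le r).castSucc := rfl
  simp only [history]
  rw [h, Fin.snoc_castSucc (α := fun _ => Fin k), Fin.snoc_castSucc (α := fun _ => Z)]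

lemma history_last {n : ℕ} (a : Fin n → Fin k) (z : Fin n → Z) (a' : Fin k) (z' : Z) :
    G.history (Fin.snoc a a' : Fin (n + 1) → Fin k) (Fin.snoc z z' : Fin (n + 1) → Z) (Fin.last n)
      = G.fullHistory a z := by
  funext r
  have h : Fin.castLE (Fin.last n).isLt.le r = Fin.castSucc r := rfl
  simp only [history, fullHistory]
  rw [h, Fin.snoc_castSucc (α := fun _ => Fin k), Fin.snoc_castSucc (α := fun _ => Z)]

lemma trajProb_snoc {n : ℕ} (L : Learner k Sig) (ξ : ℕ → FinDist Z) (a : Fin n → Fin k)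
    (z : Fin n → Z) (a' : Fin k) (z' : Z) :
    G.trajProb L (fun t : Fin (n + 1) => ξ t) (Fin.snoc a a' : Fin (n + 1) → Fin k)
      (Fin.snoc z z' : Fin (n + 1) → Z)
      = G.trajProb L (fun t : Fin n => ξ t) a z
        * ((L n (G.fullHistory a z)).1 a' * (ξ n).weights z') := by
  rw [trajProb, Fin.prod_univ_castSucc, trajProb]
  congr 1
  · refine Finset.prod_congr rfl fun t _ => ?_
    rw [history_castSucc, Fin.snoc_castSucc (α := fun _ => Fin k),
      Fin.snoc_castSucc (α := fun _ => Z)]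
    rfl
  · rw [history_last, Fin.snoc_last, Fin.snoc_last]
    rfl

lemma sum_trajectories_succ {n : ℕ} (ξ : ℕ → FinDist Z)
    (F : (Fin (n + 1) → Fin k) → (Fin (n + 1) → Z) → ℝ) :
    ∑ a : Fin (n + 1) → Fin k,
      ∑ z ∈ Fintype.piFinset fun t : Fin (n + 1) => (ξ t).weights.support, F a z
      = ∑ a : Fin n → Fin k, ∑ z ∈ Fintype.piFinset fun t : Fin n => (ξ t).weights.support,
        ∑ a' : Fin k, ∑ z' ∈ (ξ n).weights.support, F (Fin.snoc a a') (Fin.snoc z z') := by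
  rw [← Fintype.piFinset_univ, sum_piFinset_succ, Fintype.piFinset_univ]
  refine Finset.sum_congr rfl fun a _ => ?_
  simp only [sum_piFinset_succ]
  rw [Finset.sum_comm]
  rfl

/-- Summing over latent trajectories gives the law of the history. -/
lemma sum_trajProb_mul {S : Finset Sig} {ξ : ℕ → FinDist Z} (hS : ∀ t, G.Covers S (ξ t))
    (L : Learner k Sig) : ∀ (n : ℕ) (F : (Fin n → Fin k × Sig) → ℝ),
    ∑ a : Fin n → Fin k, ∑ z ∈ Fintype.piFinset fun t : Fin n => (ξ t).weights.support,
      G.trajProb L (fun t : Fin n => ξ t) a z * F (G.fullHistory a z)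
      = pathExp (G.playKernel L ξ) (Finset.univ ×ˢ S) n F
  | 0, F => by
    rw [pathExp_zero]
    simp only [Finset.univ_unique, Finset.sum_singleton]
    rw [Finset.sum_eq_single Fin.elim0]
    · simp only [trajProb, Finset.univ_eq_empty, Finset.prod_empty, one_mul]
      exact congrArg F (Subsingleton.elim _ _)
    · exact fun h _ hne => absurd (Subsingleton.elim _ _) hne
    · intro h
      exact absurd (Fintype.mem_piFinset.2 fun t => t.elim0) h
  | n + 1, F => by
    rw [sum_trajectories_succ, pathExp_succ, ← sum_trajProb_mul hS L n]
    refine Finset.sum_congr rfl fun a _ => Finset.sum_congr rfl fun z _ => ?_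
    simp only [trajProb_snoc, fullHistory_snoc]
    rw [(hS n).sum_playKernel L, Finset.mul_sum]
    refine Finset.sum_congr rfl fun a' _ => ?_
    rw [ev_eq_sum, Finset.mul_sum, Finset.mul_sum]
    exact Finset.sum_congr rfl fun z' _ => by ring

lemma expectedValue_eq {S : Finset Sig} {ξ : ℕ → FinDist Z} (hS : ∀ t, G.Covers S (ξ t))
    (L : Learner k Sig) : ∀ n : ℕ,
    G.expectedValue s L (fun t : Fin n => ξ t) = ∑ t ∈ Finset.range n,
      pathExp (G.playKernel L ξ) (Finset.univ ×ˢ S) t fun h => G.value s (L t h) (ξ t)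
  | 0 => by simp [expectedValue]
  | n + 1 => by
    rw [Finset.sum_range_succ, ← expectedValue_eq hS L n, ← G.sum_trajProb_mul hS L n,
      expectedValue, sum_trajectories_succ, expectedValue, ← Finset.sum_add_distrib]
    refine Finset.sum_congr rfl fun a _ => ?_
    rw [← Finset.sum_add_distrib]
    refine Finset.sum_congr rfl fun z _ => ?_
    rw [← mul_add]
    have h1 : ∀ (a' : Fin k) (z' : Z), ∑ t : Fin (n + 1), G.value s (L t (G.history
        (Fin.snoc a a' : Fin (n + 1) → Fin k) (Fin.snoc z z' : Fin (n + 1) → Z) t)) (ξ t)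
        = ∑ t : Fin n, G.value s (L t (G.history a z t)) (ξ t)
          + G.value s (L n (G.fullHistory a z)) (ξ n) := by
      intro a' z'
      rw [Fin.sum_univ_castSucc]
      congr 1
      · refine Finset.sum_congr rfl fun t _ => ?_
        rw [history_castSucc]
        rfl
      · rw [history_last]
        rfl
    simp only [trajProb_snoc, h1]
    have h2 : ∑ a', ∑ z' ∈ (ξ n).weights.support,
        (L n (G.fullHistory a z)).1 a' * (ξ n).weights z' = 1 := by
      simp only [← Finset.mul_sum, sum_weights (ξ n) subset_rfl, mul_one, policy_sum]
    rw [← one_mul (_ * (_ + _)), ← h2, Finset.sum_mul]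
    refine Finset.sum_congr rfl fun a' _ => ?_
    rw [Finset.sum_mul]
    exact Finset.sum_congr rfl fun z' _ => by ring

/-- Extend the choices of the adversary beyond the horizon. -/
def extend {n : ℕ} (hn : 0 < n) (x : Fin n → FinDist Z) (t : ℕ) : FinDist Z :=
  if h : t < n then x ⟨t, h⟩ else x ⟨0, hn⟩

lemma extend_coe {n : ℕ} (hn : 0 < n) (x : Fin n → FinDist Z) :
    (fun t : Fin n => extend hn x t) = x := by
  funext t
  simp [extend]

lemma exists_covers_extend {ι : Type*} [Finite ι] {n : ℕ} (hn : 0 < n)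
    (x : ι → Fin n → FinDist Z) :
    ∃ S : Finset Sig, ∀ i t, G.Covers S (extend hn (x i) t) := by
  obtain ⟨S, hS⟩ := G.exists_covers fun q : ι × Fin n => x q.1 q.2
  refine ⟨S, fun i t => ?_⟩
  unfold extend
  split_ifs with h
  · exact hS (i, ⟨t, h⟩)
  · exact hS (i, ⟨0, hn⟩)

lemma expectedValue_eq_extend {S : Finset Sig} {n : ℕ} (hn : 0 < n) (x : Fin n → FinDist Z)
    (hS : ∀ t, G.Covers S (extend hn x t)) (L : Learner k Sig) :
    G.expectedValue s L x = ∑ t ∈ Finset.range n,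
      pathExp (G.playKernel L (extend hn x)) (Finset.univ ×ˢ S) t
        fun h => G.value s (L t h) (extend hn x t) := by
  rw [← G.expectedValue_eq s hS L n, extend_coe]

lemma regret_of_pos {n : ℕ} (hn : 0 < n) (L : Learner k Sig) (x : Fin n → FinDist Z) :
    G.regret s L x = G.expectedValue s L x - n * G.optValue s (averageDist hn x) := by
  simp [regret, hn]

lemma expectedValue_mem {n : ℕ} (hn : 0 < n) (L : Learner k Sig) (x : Fin n → FinDist Z) :
    G.expectedValue s L x ∈ Set.Icc (0 : ℝ) n := by
  obtain ⟨S, hS⟩ := G.exists_covers_extend hn fun _ : Unit => x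
  rw [G.expectedValue_eq_extend s hn x (hS ()) L]
  refine ⟨Finset.sum_nonneg fun t _ => pathExp_nonneg _ _ (G.playKernel_nonneg L _) _
    fun h => (G.value_mem s _ _).1, ?_⟩
  calc _ ≤ ∑ t ∈ Finset.range n, (1 : ℝ) := by
        refine Finset.sum_le_sum fun t _ => ?_
        rw [← pathExp_const (G.playKernel L (extend hn x)) (Finset.univ ×ˢ S)
          (fun t h => (hS () t).sum_playKernel_one L h) 1 t]
        exact pathExp_mono _ _ (G.playKernel_nonneg L _) _ fun h => (G.value_mem s _ _).2
    _ = n := by simp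

/-! ### Minimax duality between learners and priors -/

/-- The probability that the learner contributes to a history: the product of the conditional
probabilities of its actions. -/
def actionWeight (L : Learner k Sig) : (t : ℕ) → (Fin t → Fin k × Sig) → ℝ :=
  pathWeight fun t h y => (L t h).1 y.1

/-- The probability that the adversary contributes to a history: the product of the probabilities
of the signals of the chosen actions. -/
def likelihood (ξ : ℕ → FinDist Z) : (t : ℕ) → (Fin t → Fin k × Sig) → ℝ :=
  pathWeight fun t _ y => (G.signalLaw y.1 (ξ t)).weights y.2

lemma pathWeight_playKernel (L : Learner k Sig) (ξ : ℕ → FinDist Z) (t : ℕ)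
    (h : Fin t → Fin k × Sig) :
    pathWeight (G.playKernel L ξ) t h = actionWeight L t h * G.likelihood ξ t h :=
  pathWeight_mul _ _ t h

lemma actionWeight_nonneg (L : Learner k Sig) (t : ℕ) (h : Fin t → Fin k × Sig) :
    0 ≤ actionWeight L t h :=
  pathWeight_nonneg _ (fun _ _ _ => policy_nonneg _ _) t h

lemma likelihood_nonneg (ξ : ℕ → FinDist Z) (t : ℕ) (h : Fin t → Fin k × Sig) :
    0 ≤ G.likelihood ξ t h :=
  pathWeight_nonneg _ (fun _ _ _ => StdSimplex.nonneg _ _) t h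

/-- Convex combinations of learners: following one of two learners, chosen at random in the
beginning, is equivalent to a single learner. -/
lemma exists_mixture (L₁ L₂ : Learner k Sig) {θ₁ θ₂ : ℝ} (h₁ : 0 ≤ θ₁) (h₂ : 0 ≤ θ₂)
    (hθ : θ₁ + θ₂ = 1) : ∃ L : Learner k Sig,
      (∀ t h, actionWeight L t h = θ₁ * actionWeight L₁ t h + θ₂ * actionWeight L₂ t h) ∧
      ∀ t h a, actionWeight L t h * (L t h).1 a = θ₁ * actionWeight L₁ t h * (L₁ t h).1 a
        + θ₂ * actionWeight L₂ t h * (L₂ t h).1 a := by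
  classical
  set D : (t : ℕ) → (Fin t → Fin k × Sig) → ℝ :=
    fun t h => θ₁ * actionWeight L₁ t h + θ₂ * actionWeight L₂ t h with hD
  have hn1 : ∀ t h, 0 ≤ θ₁ * actionWeight L₁ t h :=
    fun t h => mul_nonneg h₁ (actionWeight_nonneg _ _ _)
  have hn2 : ∀ t h, 0 ≤ θ₂ * actionWeight L₂ t h :=
    fun t h => mul_nonneg h₂ (actionWeight_nonneg _ _ _)
  have hD0 : ∀ t h, 0 ≤ D t h := fun t h => add_nonneg (hn1 t h) (hn2 t h)
  let L : Learner k Sig := fun t h => if hz : D t h = 0 then L₁ t h else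
    ⟨fun a => (θ₁ * actionWeight L₁ t h * (L₁ t h).1 a
      + θ₂ * actionWeight L₂ t h * (L₂ t h).1 a) / D t h,
     fun a => div_nonneg (add_nonneg (mul_nonneg (hn1 t h) (policy_nonneg _ _))
      (mul_nonneg (hn2 t h) (policy_nonneg _ _))) (hD0 t h), by
      rw [← Finset.sum_div, Finset.sum_add_distrib, ← Finset.mul_sum, ← Finset.mul_sum,
        policy_sum, policy_sum, mul_one, mul_one]
      exact div_self hz⟩
  have hL : ∀ t h a, D t h * (L t h).1 a = θ₁ * actionWeight L₁ t h * (L₁ t h).1 a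
      + θ₂ * actionWeight L₂ t h * (L₂ t h).1 a := by
    intro t h a
    by_cases hz : D t h = 0
    · have e1 : θ₁ * actionWeight L₁ t h = 0 := by
        have := hn1 t h; have := hn2 t h; simp only [hD] at hz; linarith
      have e2 : θ₂ * actionWeight L₂ t h = 0 := by
        have := hn1 t h; have := hn2 t h; simp only [hD] at hz; linarith
      rw [hz, e1, e2]; ring
    · simp only [L, hz, dite_false]
      field_simp
  have hW : ∀ t h, actionWeight L t h = D t h := by
    intro t
    induction t with
    | zero => intro h; simp [actionWeight, hD, hθ]
    | succ t ih =>
      intro h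
      have e : ∀ L' : Learner k Sig, actionWeight L' (t + 1) h = actionWeight L' t (Fin.init h)
          * (L' t (Fin.init h)).1 (h (Fin.last t)).1 := fun _ => rfl
      rw [e, ih, hL]
      simp only [hD, e]
      ring
  exact ⟨L, hW, fun t h a => by rw [hW]; exact hL t h a⟩

/-- The expected value is convex under mixing of learners. -/
lemma exists_expectedValue_le (L₁ L₂ : Learner k Sig) {θ₁ θ₂ : ℝ} (h₁ : 0 ≤ θ₁) (h₂ : 0 ≤ θ₂)
    (hθ : θ₁ + θ₂ = 1) {n : ℕ} (hn : 0 < n) : ∃ L : Learner k Sig, ∀ x : Fin n → FinDist Z,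
      G.expectedValue s L x ≤ θ₁ * G.expectedValue s L₁ x + θ₂ * G.expectedValue s L₂ x := by
  obtain ⟨L, hW, hL⟩ := exists_mixture L₁ L₂ h₁ h₂ hθ
  refine ⟨L, fun x => ?_⟩
  obtain ⟨S, hS⟩ := G.exists_covers_extend hn fun _ : Unit => x
  simp only [G.expectedValue_eq_extend s hn x (hS ()), Finset.mul_sum, ← Finset.sum_add_distrib]
  refine Finset.sum_le_sum fun t _ => ?_
  simp only [pathExp, Finset.mul_sum, ← Finset.sum_add_distrib, pathWeight_playKernel]
  refine Finset.sum_le_sum fun h _ => ?_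
  set ξ := extend hn x
  have hn1 : 0 ≤ θ₁ * actionWeight L₁ t h := mul_nonneg h₁ (actionWeight_nonneg _ _ _)
  have hn2 : 0 ≤ θ₂ * actionWeight L₂ t h := mul_nonneg h₂ (actionWeight_nonneg _ _ _)
  have key : actionWeight L t h * G.value s (L t h) (ξ t)
      ≤ θ₁ * actionWeight L₁ t h * G.value s (L₁ t h) (ξ t)
        + θ₂ * actionWeight L₂ t h * G.value s (L₂ t h) (ξ t) := by
    rcases (actionWeight_nonneg L t h).eq_or_lt with h0 | hpos
    · rw [← h0, zero_mul]
      exact add_nonneg (mul_nonneg hn1 (G.value_mem s _ _).1)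
        (mul_nonneg hn2 (G.value_mem s _ _).1)
    · have hc : ∀ a, (L t h).1 a
          = θ₁ * actionWeight L₁ t h / actionWeight L t h * (L₁ t h).1 a
            + θ₂ * actionWeight L₂ t h / actionWeight L t h * (L₂ t h).1 a := by
        intro a
        have := hL t h a
        field_simp
        linarith
      have := G.value_convex s (div_nonneg hn1 hpos.le) (div_nonneg hn2 hpos.le) hc (ξ t)
      calc _ ≤ actionWeight L t h * (θ₁ * actionWeight L₁ t h / actionWeight L t h
              * G.value s (L₁ t h) (ξ t) + θ₂ * actionWeight L₂ t h / actionWeight L t h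
              * G.value s (L₂ t h) (ξ t)) := mul_le_mul_of_nonneg_left this hpos.le
        _ = _ := by field_simp
  have := mul_le_mul_of_nonneg_left key (G.likelihood_nonneg ξ t h)
  linarith

lemma continuous_expectedValue {n : ℕ} (x : Fin n → FinDist Z) :
    Continuous fun L : Learner k Sig => G.expectedValue s L x := by
  unfold expectedValue trajProb
  refine continuous_finsetSum _ fun a _ => continuous_finsetSum _ fun z _ => ?_
  have hL : ∀ (t : ℕ) (h : Fin t → Fin k × Sig), Continuous fun L : Learner k Sig => L t h :=
    fun t h => (continuous_apply h).comp (continuous_apply t)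
  refine Continuous.mul (continuous_finsetProd _ fun t _ => Continuous.mul ?_ continuous_const)
    (continuous_finsetSum _ fun t _ => (G.continuous_value s (x t)).comp (hL _ _))
  exact (continuous_apply (a t)).comp (continuous_subtype_val.comp (hL _ _))

lemma continuous_regret {n : ℕ} (hn : 0 < n) (x : Fin n → FinDist Z) :
    Continuous fun L : Learner k Sig => G.regret s L x := by
  simp only [G.regret_of_pos s hn]
  exact (G.continuous_expectedValue s x).sub continuous_const

lemma optValue_le_one (hk : 0 < k) (x : FinDist Z) : G.optValue s x ≤ 1 := by
  have : Nonempty (Fin k) := ⟨⟨0, hk⟩⟩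
  obtain ⟨π⟩ : Nonempty (Policy k) := inferInstance
  exact (G.optValue_le_value s π x).trans (G.value_mem s π x).2

lemma regret_le {n : ℕ} (hn : 0 < n) (L : Learner k Sig) (x : Fin n → FinDist Z) :
    G.regret s L x ≤ n := by
  rw [G.regret_of_pos s hn]
  have h1 := (G.expectedValue_mem s hn L x).2
  have h2 := mul_nonneg (Nat.cast_nonneg (α := ℝ) n) (G.optValue_nonneg s (averageDist hn x))
  linarith

lemma neg_le_regret (hk : 0 < k) {n : ℕ} (hn : 0 < n) (L : Learner k Sig)
    (x : Fin n → FinDist Z) : -n ≤ G.regret s L x := by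
  rw [G.regret_of_pos s hn]
  have h1 := (G.expectedValue_mem s hn L x).1
  have h2 := mul_le_mul_of_nonneg_left (G.optValue_le_one s hk (averageDist hn x))
    (Nat.cast_nonneg (α := ℝ) n)
  linarith

/-- Against finitely many choices of the adversary, Bayesian regret bounds for all priors give a
single learner; this is the separation theorem. -/
lemma exists_learner_finset (hk : 0 < k) {n : ℕ} (hn : 0 < n) {v ε : ℝ} (hε : 0 < ε)
    (h : ∀ (u : Finset (Fin n → FinDist Z)) (p : (Fin n → FinDist Z) → ℝ), (∀ x, 0 ≤ p x) →
      ∑ x ∈ u, p x = 1 → ∃ L : Learner k Sig, ∑ x ∈ u, p x * G.regret s L x ≤ v)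
    (u : Finset (Fin n → FinDist Z)) :
    ∃ L : Learner k Sig, ∀ x ∈ u, G.regret s L x ≤ v + ε := by
  classical
  have : Nonempty (Fin k) := ⟨⟨0, hk⟩⟩
  obtain ⟨L₀⟩ : Nonempty (Learner k Sig) := inferInstance
  set A : Set (u → ℝ) := {b | ∀ i, b i < v + ε} with hA
  set T : Set (u → ℝ) := {b | ∃ L : Learner k Sig, ∀ i : u, G.regret s L i.1 ≤ b i} with hT
  by_cases hdis : Disjoint A T
  swap
  · obtain ⟨b, hbA, L, hL⟩ := Set.not_disjoint_iff.1 hdis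
    exact ⟨L, fun x hx => (hL ⟨x, hx⟩).trans (hbA ⟨x, hx⟩).le⟩
  exfalso
  have hAopen : IsOpen A := by
    have : A = ⋂ i, {b | b i < v + ε} := by ext; simp [hA]
    rw [this]
    exact isOpen_iInter_of_finite fun i => isOpen_lt (continuous_apply i) continuous_const
  have hAconv : Convex ℝ A := by
    intro b hb b' hb' θ₁ θ₂ h₁ h₂ hθ i
    have e1 := hb i
    have e2 := hb' i
    simp only [Pi.add_apply, Pi.smul_apply, smul_eq_mul]
    have : v + ε = θ₁ * (v + ε) + θ₂ * (v + ε) := by rw [← add_mul, hθ, one_mul]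
    rw [this]
    rcases h₁.eq_or_lt with rfl | hpos
    · have : θ₂ = 1 := by linarith
      subst this; linarith
    · exact add_lt_add_of_lt_of_le (mul_lt_mul_of_pos_left e1 hpos)
        (mul_le_mul_of_nonneg_left e2.le h₂)
  have hTconv : Convex ℝ T := by
    rintro b ⟨L₁, hL₁⟩ b' ⟨L₂, hL₂⟩ θ₁ θ₂ h₁ h₂ hθ
    obtain ⟨L, hL⟩ := G.exists_expectedValue_le s L₁ L₂ h₁ h₂ hθ hn
    refine ⟨L, fun i => ?_⟩
    simp only [Pi.add_apply, Pi.smul_apply, smul_eq_mul]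
    have e1 := mul_le_mul_of_nonneg_left (hL₁ i) h₁
    have e2 := mul_le_mul_of_nonneg_left (hL₂ i) h₂
    have e3 := hL i.1
    simp only [G.regret_of_pos s hn] at e1 e2 ⊢
    set c := (n : ℝ) * G.optValue s (averageDist hn i.1)
    have : c = θ₁ * c + θ₂ * c := by rw [← add_mul, hθ, one_mul]
    linarith
  obtain ⟨f, c, hfA, hfT⟩ := geometric_hahn_banach_open hAconv hAopen hTconv hdis
  set w : u → ℝ := fun i => f (Pi.single i 1) with hw
  have hf : ∀ b : u → ℝ, f b = ∑ i, w i * b i := by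
    intro b
    conv_lhs => rw [← Finset.univ_sum_single b]
    rw [map_sum]
    refine Finset.sum_congr rfl fun i _ => ?_
    have : (Pi.single i (b i) : u → ℝ) = b i • Pi.single i 1 := by
      rw [← Pi.single_smul, smul_eq_mul, mul_one]
    rw [this, map_smul, smul_eq_mul, mul_comm]
  have hT0 : (fun _ => (n : ℝ)) ∈ T := ⟨L₀, fun i => G.regret_le s hn L₀ i.1⟩
  have hw0 : ∀ i, 0 ≤ w i := by
    intro i
    by_contra hneg
    push Not at hneg
    set b : u → ℝ := fun _ => (n : ℝ) with hb
    set r : ℝ := (|f b - c| + 1) / (-w i) with hr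
    have hr0 : 0 ≤ r := div_nonneg (by positivity) (by linarith)
    have hmem : b + r • Pi.single i 1 ∈ T := by
      obtain ⟨L, hL⟩ := hT0
      refine ⟨L, fun j => (hL j).trans ?_⟩
      have : 0 ≤ (r • Pi.single i (1 : ℝ) : u → ℝ) j := by
        rw [Pi.smul_apply, smul_eq_mul]
        refine mul_nonneg hr0 ?_
        by_cases hj : j = i
        · subst hj; simp
        · simp [hj]
      simpa using this
    have h1 := hfT _ hmem
    rw [map_add, map_smul, smul_eq_mul] at h1
    have h2 : r * w i = -(|f b - c| + 1) := by
      rw [hr]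
      have : w i ≠ 0 := hneg.ne
      field_simp
    change c ≤ f b + r * w i at h1
    rw [h2] at h1
    have := le_abs_self (f b - c)
    linarith
  set W := ∑ i, w i with hW
  have hWpos : 0 < W := by
    refine lt_of_le_of_ne (Finset.sum_nonneg fun i _ => hw0 i) fun h0 => ?_
    have hz : ∀ i, w i = 0 := fun i =>
      (Finset.sum_eq_zero_iff_of_nonneg fun i _ => hw0 i).1 h0.symm i (Finset.mem_univ i)
    have e1 := hfA (fun _ => v) fun i => by linarith
    have e2 := hfT _ hT0
    rw [hf] at e1 e2
    simp only [hz, zero_mul, Finset.sum_const_zero] at e1 e2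
    linarith
  set q : (Fin n → FinDist Z) → ℝ := fun x => if hx : x ∈ u then w ⟨x, hx⟩ / W else 0 with hq
  have hqu : ∀ i : u, q i.1 = w i / W := fun i => by simp [hq, i.2]
  obtain ⟨L, hL⟩ := h u q
    (fun x => by
      simp only [hq]
      split_ifs
      · exact div_nonneg (hw0 _) hWpos.le
      · exact le_rfl)
    (by
      rw [← Finset.sum_coe_sort]
      simp only [hqu]
      rw [← Finset.sum_div]
      exact div_self hWpos.ne')
  rw [← Finset.sum_coe_sort] at hL
  simp only [hqu] at hL
  have e1 := hfT (fun i => G.regret s L i.1) ⟨L, fun i => le_rfl⟩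
  have e2 := hfA (fun _ => v + ε / 2) fun i => by linarith
  rw [hf] at e1 e2
  rw [← Finset.sum_mul] at e2
  have e3 : ∑ i : u, w i / W * G.regret s L i.1 = (∑ i : u, w i * G.regret s L i.1) / W := by
    rw [Finset.sum_div]
    exact Finset.sum_congr rfl fun i _ => by ring
  rw [e3, div_le_iff₀ hWpos] at hL
  nlinarith

/-- The minimax regret is at most the worst Bayesian regret over finitely supported priors. -/
lemma minimaxRegret_le_of_bayes (hk : 0 < k) [Nonempty Z] {n : ℕ} (hn : 0 < n) {v : ℝ}
    (h : ∀ (u : Finset (Fin n → FinDist Z)) (p : (Fin n → FinDist Z) → ℝ), (∀ x, 0 ≤ p x) →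
      ∑ x ∈ u, p x = 1 → ∃ L : Learner k Sig, ∑ x ∈ u, p x * G.regret s L x ≤ v) :
    G.minimaxRegret s n ≤ v := by
  refine le_of_forall_pos_le_add fun ε hε => ?_
  have hne : Nonempty (FinDist Z) := (inferInstance : Nonempty Z).map StdSimplex.single
  obtain ⟨L, -, hL⟩ := isCompact_univ.inter_iInter_nonempty
    (fun x : Fin n → FinDist Z => {L : Learner k Sig | G.regret s L x ≤ v + ε})
    (fun x => isClosed_le (G.continuous_regret s hn x) continuous_const) (by
      intro u
      obtain ⟨L, hL⟩ := G.exists_learner_finset s hk hn hε h u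
      exact ⟨L, Set.mem_univ _, by simpa using hL⟩)
  refine (ciInf_le ⟨-(n : ℝ), ?_⟩ L).trans (ciSup_le fun x => Set.mem_iInter.1 hL x)
  rintro _ ⟨L', rfl⟩
  obtain ⟨x⟩ : Nonempty (Fin n → FinDist Z) := inferInstance
  exact (G.neg_le_regret s hk hn L' x).trans
    (le_ciSup (f := fun x => G.regret s L' x)
      ⟨n, by rintro _ ⟨y, rfl⟩; exact G.regret_le s hn L' y⟩ x)

/-! ### The upper bound -/

/-- A bound on the information ratio linearises to a bound on the regret: either the regret is
at most `θ`, or its `l`-th power is controlled by the information gain. -/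
lemma instRegret_le {l Ψ J θ : ℝ} {π : Policy k} {μ : FinDist (FinDist Z)} (hl : 1 < l)
    (hΨ : 0 ≤ Ψ) (hJ : 0 ≤ J) (hθ : 0 < θ) (h : G.infoRatio s l π μ ≤ ENNReal.ofReal Ψ)
    (hI : G.infoGain π μ ≤ ENNReal.ofReal J) :
    G.instRegret s π μ ≤ θ + θ ^ (1 - l) * (Ψ * J) := by
  set Δ := G.instRegret s π μ with hΔ
  have hθl : 0 < θ ^ (1 - l) := Real.rpow_pos_of_pos hθ _
  rcases le_or_gt Δ θ with hle | hlt
  · have : 0 ≤ θ ^ (1 - l) * (Ψ * J) := by positivity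
    linarith
  have hΔ0 : 0 < Δ := hθ.trans hlt
  have hpow : ENNReal.ofReal Δ ^ l = ENNReal.ofReal (Δ ^ l) :=
    ENNReal.ofReal_rpow_of_pos hΔ0
  have hΔl : 0 < Δ ^ l := Real.rpow_pos_of_pos hΔ0 _
  rw [infoRatio, ← hΔ, hpow] at h
  have hItop : G.infoGain π μ ≠ ∞ := ne_top_of_le_ne_top ENNReal.ofReal_ne_top hI
  have hI0 : G.infoGain π μ ≠ 0 := by
    intro h0
    rw [h0, ENNReal.div_zero (by simpa using hΔl)] at h
    exact ENNReal.ofReal_ne_top (top_le_iff.1 h)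
  rw [ENNReal.div_le_iff hI0 hItop] at h
  have h2 : ENNReal.ofReal (Δ ^ l) ≤ ENNReal.ofReal (Ψ * J) := by
    rw [ENNReal.ofReal_mul hΨ]
    exact h.trans (mul_le_mul_right hI _)
  rw [ENNReal.ofReal_le_ofReal_iff (by positivity)] at h2
  have h3 : Δ = Δ ^ (1 - l) * Δ ^ l := by
    rw [← Real.rpow_add hΔ0, sub_add_cancel, Real.rpow_one]
  have h4 : Δ ^ (1 - l) ≤ θ ^ (1 - l) :=
    Real.rpow_le_rpow_of_nonpos hθ hlt.le (by linarith)
  calc Δ = Δ ^ (1 - l) * Δ ^ l := h3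
    _ ≤ θ ^ (1 - l) * (Ψ * J) := mul_le_mul h4 h2 hΔl.le hθl.le
    _ ≤ _ := by linarith

/-- The logarithmic barrier of an unnormalised posterior `q`, scaled by its mass. -/
def barrier {m : ℕ} (q : Fin m → ℝ) : ℝ := ∑ i, (∑ j, q j) * -Real.log (q i / ∑ j, q j)

lemma barrier_nonneg {m : ℕ} {q : Fin m → ℝ} (hq : ∀ i, 0 ≤ q i) : 0 ≤ barrier q := by
  have h0 : 0 ≤ ∑ j, q j := Finset.sum_nonneg fun j _ => hq j
  refine Finset.sum_nonneg fun i _ => mul_nonneg h0 (neg_nonneg.2 ?_)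
  refine Real.log_nonpos (div_nonneg (hq i) h0) (div_le_one_of_le₀ ?_ h0)
  exact Finset.single_le_sum (fun j _ => hq j) (Finset.mem_univ i)

lemma barrier_le {m : ℕ} {q : Fin m → ℝ} {η : ℝ} (hη : 0 < η) (hq : ∀ i, 0 ≤ q i)
    (h : ∀ i, η * ∑ j, q j ≤ q i) : barrier q ≤ (∑ j, q j) * (m * -Real.log η) := by
  have h0 : 0 ≤ ∑ j, q j := Finset.sum_nonneg fun j _ => hq j
  calc barrier q ≤ ∑ _i : Fin m, (∑ j, q j) * -Real.log η := by
        refine Finset.sum_le_sum fun i _ => ?_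
        rcases h0.eq_or_lt with h0 | h0
        · simp [← h0]
        refine mul_le_mul_of_nonneg_left (neg_le_neg (Real.log_le_log hη ?_)) h0.le
        rw [le_div_iff₀ h0]
        exact h i
    _ = _ := by simp; ring

variable {s} in
/-- One round of the Bayesian game. The pair `(j, i)` of a choice of the adversary and a piece of
the baseline has unnormalised posterior weight `c j i`. A policy with small information ratio for
the posterior means of the pieces pays for its regret by the increase of the barrier. -/
lemma exists_policy_step {ι : Type*} [Fintype ι] {m : ℕ} (hk : 0 < k) (hm : m ≤ G.numPieces s)
    {f : Fin m → Z → ℝ} (hf : G.IsPieces s f) {l Ψ θ η : ℝ} (hl : 1 < l) (hΨ : 0 ≤ Ψ)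
    (hθ : 0 < θ) (hη : 0 < η) (hinfo : G.minimaxInfoRatio s l < ENNReal.ofReal Ψ)
    (c : ι → Fin m → ℝ) (hc : ∀ j i, 0 ≤ c j i) (hcη : ∀ j i, η * ∑ i', c j i' ≤ c j i)
    (y : ι → FinDist Z) {S : Finset Sig} (hS : ∀ j, G.Covers S (y j)) :
    ∃ π : Policy k, ∑ j, ∑ i, c j i * (G.value s π (y j) - ev (y j) (f i))
      ≤ θ * (∑ j, ∑ i, c j i) + θ ^ (1 - l) * Ψ * ((∑ a, π.1 a * ∑ σ ∈ S, barrier fun i =>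
          ∑ j, c j i * (G.signalLaw a (y j)).weights σ) - barrier fun i => ∑ j, c j i) := by
  classical
  have hkne : Nonempty (Fin k) := ⟨⟨0, hk⟩⟩
  set q : Fin m → ℝ := fun i => ∑ j, c j i with hq
  set W : ℝ := ∑ i, q i with hW
  have hWeq : ∑ j, ∑ i, c j i = W := by rw [hW, Finset.sum_comm]
  have hq0 : ∀ i, 0 ≤ q i := fun i => Finset.sum_nonneg fun j _ => hc j i
  have hW0 : 0 ≤ W := Finset.sum_nonneg fun i _ => hq0 i
  rw [hWeq]
  rcases hW0.eq_or_lt with hWz | hWpos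
  · obtain ⟨π⟩ : Nonempty (Policy k) := inferInstance
    have hcz : ∀ j i, c j i = 0 := by
      intro j i
      have h1 : q i = 0 := (Finset.sum_eq_zero_iff_of_nonneg fun i _ => hq0 i).1 hWz.symm i
        (Finset.mem_univ i)
      exact (Finset.sum_eq_zero_iff_of_nonneg fun j _ => hc j i).1 h1 j (Finset.mem_univ j)
    refine ⟨π, ?_⟩
    simp [hq, hcz, barrier, ← hWz]
  have hqη : ∀ i, η * W ≤ q i := by
    intro i
    rw [← hWeq, Finset.mul_sum]
    exact Finset.sum_le_sum fun j _ => hcη j i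
  have hqpos : ∀ i, 0 < q i := fun i => (mul_pos hη hWpos).trans_le (hqη i)
  -- the posterior means of the pieces, and the posterior
  set comp : Fin m → FinDist Z := fun i => (ofFintype (fun j => c j i / q i)
    (fun j => div_nonneg (hc j i) (hq0 i))
    (by rw [← Finset.sum_div]; exact div_self (hqpos i).ne')).iConvexComb y with hcomp
  set post : FinDist (Fin m) := ofFintype (fun i => q i / W)
    (fun i => div_nonneg (hq0 i) hW0) (by rw [← Finset.sum_div]; exact div_self hWpos.ne') with hpost
  set μ : FinDist (FinDist Z) := post.map comp with hμ
  have hsub : μ.weights.support ⊆ Finset.univ.image comp := by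
    rw [hμ, StdSimplex.weights_map]
    refine Finsupp.mapDomain_support.trans (Finset.image_subset_image (Finset.subset_univ _))
  have hcard : μ.weights.support.card ≤ G.numPieces s := by
    refine (Finset.card_le_card hsub).trans (Finset.card_image_le.trans ?_)
    simpa using hm
  obtain ⟨π, hπ⟩ : ∃ π, G.infoRatio s l π μ < ENNReal.ofReal Ψ := by
    rw [← iInf_lt_iff]
    exact (le_iSup (fun μ : {μ : FinDist (FinDist Z) // μ.weights.support.card ≤ G.numPieces s} =>
      ⨅ π : Policy k, G.infoRatio s l π μ.1) ⟨μ, hcard⟩).trans_lt hinfo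
  refine ⟨π, ?_⟩
  have hev : ∀ i (g : Z → ℝ), q i * ev (comp i) g = ∑ j, c j i * ev (y j) g := by
    intro i g
    rw [hcomp, ev_iConvexComb, ev_fintype, Finset.mul_sum]
    refine Finset.sum_congr rfl fun j _ => ?_
    rw [weights_ofFintype]
    have := (hqpos i).ne'
    field_simp
  have hregret : ∑ j, ∑ i, c j i * (G.value s π (y j) - ev (y j) (f i))
      ≤ W * G.instRegret s π μ := by
    have h1 : G.instRegret s π μ = ev μ fun x => G.value s π x - G.optValue s x := rfl
    rw [h1, hμ, ev_map, ev_fintype, Finset.mul_sum, Finset.sum_comm]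
    refine Finset.sum_le_sum fun i _ => ?_
    have h2 : W * (post.weights i * (G.value s π (comp i) - G.optValue s (comp i)))
        = q i * G.value s π (comp i) - q i * G.optValue s (comp i) := by
      rw [hpost, weights_ofFintype]
      field_simp
    rw [h2]
    simp only [mul_sub, Finset.sum_sub_distrib]
    refine sub_le_sub ?_ ?_
    · have := mul_le_mul_of_nonneg_left (G.ev_value_le s π (ofFintype (fun j => c j i / q i)
        (fun j => div_nonneg (hc j i) (hq0 i))
        (by rw [← Finset.sum_div]; exact div_self (hqpos i).ne')) y) (hq0 i)
      refine le_trans (le_of_eq ?_) this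
      rw [ev_fintype, Finset.mul_sum]
      refine Finset.sum_congr rfl fun j _ => ?_
      rw [weights_ofFintype]
      have := (hqpos i).ne'
      field_simp
    · rw [← hev]
      exact mul_le_mul_of_nonneg_left ((hf (comp i)).2 ⟨i, rfl⟩) (hq0 i)
  -- the unnormalised posterior after action `a` and signal `σ`
  set Q : Fin k → Sig → Fin m → ℝ :=
    fun a σ i => ∑ j, c j i * (G.signalLaw a (y j)).weights σ with hQ
  have hQ0 : ∀ a σ i, 0 ≤ Q a σ i := fun a σ i =>
    Finset.sum_nonneg fun j _ => mul_nonneg (hc j i) (StdSimplex.nonneg _ _)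
  have hQη : ∀ a σ i, η * ∑ i', Q a σ i' ≤ Q a σ i := by
    intro a σ i
    simp only [hQ]
    rw [Finset.sum_comm, Finset.mul_sum]
    refine Finset.sum_le_sum fun j _ => ?_
    rw [← Finset.sum_mul, ← mul_assoc]
    exact mul_le_mul_of_nonneg_right (hcη j i) (StdSimplex.nonneg _ _)
  have hQS : ∀ a i, ∑ σ ∈ S, Q a σ i = q i := by
    intro a i
    simp only [hQ]
    rw [Finset.sum_comm]
    simp only [← Finset.mul_sum, sum_weights _ (hS _ a), mul_one]
    rfl
  have hsigi : ∀ a i σ, (G.signalLaw a (comp i)).weights σ = Q a σ i / q i := by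
    intro a i σ
    rw [hcomp, signalLaw_iConvexComb, weights_iConvexComb_apply, ev_fintype, eq_div_iff (hqpos i).ne',
      Finset.sum_mul]
    refine Finset.sum_congr rfl fun j _ => ?_
    rw [weights_ofFintype]
    have := (hqpos i).ne'
    field_simp
  have hsig : ∀ a σ, (G.signalLaw a μ.sConvexComb).weights σ = (∑ i, Q a σ i) / W := by
    intro a σ
    have : μ.sConvexComb = post.iConvexComb comp := rfl
    rw [this, signalLaw_iConvexComb, weights_iConvexComb_apply, ev_fintype, Finset.sum_div]
    refine Finset.sum_congr rfl fun i _ => ?_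
    rw [hpost, weights_ofFintype, hsigi]
    have := (hqpos i).ne'
    field_simp
  have hac : ∀ a i σ, (G.signalLaw a (comp i)).weights σ = 0 →
      (G.signalLaw a μ.sConvexComb).weights σ = 0 := by
    intro a i σ h0
    rw [hsigi, div_eq_zero_iff] at h0
    have h1 : Q a σ i = 0 := h0.resolve_right (hqpos i).ne'
    have h2 := hQη a σ i
    have h3 : 0 ≤ ∑ i', Q a σ i' := Finset.sum_nonneg fun i' _ => hQ0 a σ i'
    have h4 : ∑ i', Q a σ i' = 0 := by nlinarith
    rw [hsig, h4, zero_div]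
  set KL : Fin k → Fin m → ℝ := fun a i => ev (G.signalLaw a μ.sConvexComb) fun σ =>
    Real.log ((G.signalLaw a μ.sConvexComb).weights σ / (G.signalLaw a (comp i)).weights σ) with hKL
  have hKL0 : ∀ a i, 0 ≤ KL a i := fun a i => ev_log_div_nonneg _ _ (hac a i)
  have hgain : G.infoGain π μ ≤ ENNReal.ofReal (∑ a, π.1 a * ∑ i, KL a i) := by
    rw [infoGain, ENNReal.ofReal_sum_of_nonneg fun a _ =>
      mul_nonneg (policy_nonneg π a) (Finset.sum_nonneg fun i _ => hKL0 a i)]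
    refine Finset.sum_le_sum fun a _ => ?_
    rw [ENNReal.ofReal_mul (policy_nonneg π a),
      ENNReal.ofReal_sum_of_nonneg fun i _ => hKL0 a i]
    refine mul_le_mul_right ?_ _
    refine (Finset.sum_le_sum_of_subset hsub).trans ?_
    refine (Finset.sum_image_le_of_nonneg fun _ _ => zero_le).trans ?_
    refine Finset.sum_le_sum fun i _ => ?_
    rw [kl_eq_ofReal _ _ (hac a i)]
  have hKLbar : ∀ a, W * ∑ i, KL a i = (∑ σ ∈ S, barrier (Q a σ)) - barrier q := by
    intro a
    have h1 : ∀ i, W * KL a i = ∑ σ ∈ S, (∑ i', Q a σ i') * -Real.log (Q a σ i / ∑ i', Q a σ i')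
        - W * -Real.log (q i / W) := by
      intro i
      have hsupp : (G.signalLaw a μ.sConvexComb).weights.support ⊆ S := by
        intro σ hσ
        by_contra hσS
        refine Finsupp.mem_support_iff.1 hσ ?_
        rw [hsig, Finset.sum_eq_zero fun i _ => ?_, zero_div]
        refine Finset.sum_eq_zero fun j _ => ?_
        rw [Finsupp.notMem_support_iff.1 fun h => hσS (hS j a h), mul_zero]
      have hWS : W = ∑ σ ∈ S, ∑ i', Q a σ i' := by
        rw [Finset.sum_comm, hW]
        exact Finset.sum_congr rfl fun i' _ => (hQS a i').symm
      have h2 : W * -Real.log (q i / W) = ∑ σ ∈ S, (∑ i', Q a σ i') * -Real.log (q i / W) := by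
        rw [← Finset.sum_mul, ← hWS]
      rw [h2, ← Finset.sum_sub_distrib, hKL]
      simp only
      rw [ev_eq_sum_of_subset _ _ hsupp, Finset.mul_sum]
      refine Finset.sum_congr rfl fun σ _ => ?_
      rw [hsig, hsigi]
      have h3 : 0 ≤ ∑ i', Q a σ i' := Finset.sum_nonneg fun i' _ => hQ0 a σ i'
      rcases h3.eq_or_lt with h3 | h3
      · simp [← h3]
      have h4 : 0 < Q a σ i := (mul_pos hη h3).trans_le (hQη a σ i)
      have h5 := hqpos i
      rw [Real.log_div (by positivity) (by positivity), Real.log_div h3.ne' hWpos.ne',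
        Real.log_div h4.ne' h5.ne', Real.log_div h4.ne' h3.ne', Real.log_div h5.ne' hWpos.ne']
      field_simp
      ring
    rw [Finset.mul_sum, Finset.sum_congr rfl fun i _ => h1 i, Finset.sum_sub_distrib]
    congr 1
    rw [Finset.sum_comm]
    rfl
  have hJ0 : 0 ≤ ∑ a, π.1 a * ∑ i, KL a i := Finset.sum_nonneg fun a _ =>
    mul_nonneg (policy_nonneg π a) (Finset.sum_nonneg fun i _ => hKL0 a i)
  have hfin := G.instRegret_le s hl hΨ hJ0 hθ hπ.le hgain
  have hbar : W * ∑ a, π.1 a * ∑ i, KL a i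
      = (∑ a, π.1 a * ∑ σ ∈ S, barrier (Q a σ)) - barrier q := by
    calc W * ∑ a, π.1 a * ∑ i, KL a i
        = ∑ a, π.1 a * ((∑ σ ∈ S, barrier (Q a σ)) - barrier q) := by
          rw [Finset.mul_sum]
          exact Finset.sum_congr rfl fun a _ => by rw [← hKLbar]; ring
      _ = _ := by
          simp only [mul_sub, Finset.sum_sub_distrib, ← Finset.sum_mul, policy_sum, one_mul]
  calc _ ≤ W * G.instRegret s π μ := hregret
    _ ≤ W * (θ + θ ^ (1 - l) * (Ψ * ∑ a, π.1 a * ∑ i, KL a i)) :=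
        mul_le_mul_of_nonneg_left hfin hW0
    _ = θ * W + θ ^ (1 - l) * Ψ * (W * ∑ a, π.1 a * ∑ i, KL a i) := by ring
    _ = _ := by rw [hbar]

lemma pathExp_actionWeight_mul (L : Learner k Sig) (ξ : ℕ → FinDist Z)
    (A : Finset (Fin k × Sig)) (t : ℕ) (F : (Fin t → Fin k × Sig) → ℝ) :
    pathExp (fun t h y => (L t h).1 y.1) A t (fun h => G.likelihood ξ t h * F h)
      = pathExp (G.playKernel L ξ) A t F := by
  refine Finset.sum_congr rfl fun h _ => ?_
  rw [pathWeight_playKernel, actionWeight]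
  ring

lemma likelihood_snoc (ξ : ℕ → FinDist Z) (t : ℕ) (h : Fin t → Fin k × Sig) (y : Fin k × Sig) :
    G.likelihood ξ (t + 1) (Fin.snoc h y)
      = G.likelihood ξ t h * (G.signalLaw y.1 (ξ t)).weights y.2 :=
  pathWeight_snoc _ _ _ _

variable {G s} in
lemma IsPieces.card_pos [Nonempty Z] {m : ℕ} {f : Fin m → Z → ℝ} (hf : G.IsPieces s f) :
    0 < m := by
  obtain ⟨z⟩ := ‹Nonempty Z›
  obtain ⟨i, -⟩ := (hf (StdSimplex.single z)).1
  exact i.pos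

variable {s} in
/-- The learner which follows the policies of `exists_policy_step` has small Bayesian regret. The
optimal piece is observed through noise of level `1 / n`, which keeps the posterior weight of each
piece above `1 / (n m)` and hence the barrier logarithmic, at the price of a bounded regret. -/
lemma exists_learner_bayes (hk : 0 < k) [Nonempty Z] {m : ℕ} (hm : m ≤ G.numPieces s)
    {f : Fin m → Z → ℝ} (hf : G.IsPieces s f) {C : ℝ} (hC : ∀ i z, f i z ≤ C) {l Ψ θ : ℝ} (hl : 1 < l) (hΨ : 0 ≤ Ψ)
    (hθ : 0 < θ) (hinfo : G.minimaxInfoRatio s l < ENNReal.ofReal Ψ) {n : ℕ} (hn : 0 < n)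
    (u : Finset (Fin n → FinDist Z)) (p : (Fin n → FinDist Z) → ℝ) (hp : ∀ x, 0 ≤ p x)
    (hp1 : ∑ x ∈ u, p x = 1) :
    ∃ L : Learner k Sig, ∑ x ∈ u, p x * G.regret s L x ≤ n * θ + θ ^ (1 - l) * Ψ *
      (m * Real.log (n * m)) + C := by
  classical
  have hm0 := hf.card_pos
  have hnR : (0 : ℝ) < n := by exact_mod_cast hn
  have hn1 : (1 : ℝ) ≤ n := by exact_mod_cast hn
  have hmR : (0 : ℝ) < m := by exact_mod_cast hm0
  choose A hA using fun x : Fin n → FinDist Z => (hf (averageDist hn x)).1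
  -- the law of the noisy observation of the optimal piece
  set δ : ℝ := 1 / n with hδ
  have hδ0 : 0 < δ := by positivity
  have hδ1 : δ ≤ 1 := by rw [hδ, div_le_one hnR]; exact hn1
  set η : ℝ := δ / m with hη
  have hη0 : 0 < η := by positivity
  set r : (Fin n → FinDist Z) → Fin m → ℝ :=
    fun x i => (1 - δ) * (if i = A x then 1 else 0) + η with hr
  have hrη : ∀ x i, η ≤ r x i := by
    intro x i
    simp only [hr]
    have : 0 ≤ (1 - δ) * (if i = A x then (1 : ℝ) else 0) := by
      refine mul_nonneg (by linarith) ?_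
      split_ifs <;> norm_num
    linarith
  have hr0 : ∀ x i, 0 ≤ r x i := fun x i => hη0.le.trans (hrη x i)
  have hr1 : ∀ x, ∑ i, r x i = 1 := by
    intro x
    simp only [hr, Finset.sum_add_distrib, ← Finset.mul_sum]
    simp only [Finset.sum_ite_eq', Finset.mem_univ, if_true, Finset.sum_const, Finset.card_univ,
      Fintype.card_fin, nsmul_eq_mul, hη]
    field_simp
    ring
  obtain ⟨S, hS⟩ := G.exists_covers_extend hn fun x : u => x.1
  set c : (t : ℕ) → (Fin t → Fin k × Sig) → u → Fin m → ℝ :=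
    fun t h x i => p x.1 * r x.1 i * G.likelihood (extend hn x.1) t h with hc
  have hc0 : ∀ t h x i, 0 ≤ c t h x i := fun t h x i =>
    mul_nonneg (mul_nonneg (hp _) (hr0 _ _)) (G.likelihood_nonneg _ _ _)
  have hcsum : ∀ t h x, ∑ i, c t h x i = p x.1 * G.likelihood (extend hn x.1) t h := by
    intro t h x
    simp only [hc]
    rw [← Finset.sum_mul, ← Finset.mul_sum, hr1, mul_one]
  have hcη : ∀ t h x i, η * ∑ i', c t h x i' ≤ c t h x i := by
    intro t h x i
    rw [hcsum]
    have := mul_le_mul_of_nonneg_right (hrη x.1 i)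
      (mul_nonneg (hp x.1) (G.likelihood_nonneg (extend hn x.1) t h))
    simp only [hc]
    linarith
  choose L hL using fun t h => G.exists_policy_step hk hm hf hl hΨ hθ hη0 hinfo
    (c t h) (hc0 t h) (hcη t h) (fun x : u => extend hn x.1 t) (fun x => hS x t)
  refine ⟨L, ?_⟩
  set P : (t : ℕ) → (Fin t → Fin k × Sig) → Fin k × Sig → ℝ := fun t h y => (L t h).1 y.1 with hP
  have hP0 : ∀ t h y, 0 ≤ P t h y := fun t h y => policy_nonneg _ _
  set B : Finset (Fin k × Sig) := Finset.univ ×ˢ S with hB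
  set φ : (t : ℕ) → (Fin t → Fin k × Sig) → ℝ := fun t h => barrier fun i => ∑ x, c t h x i with hφ
  set κ : ℝ := θ ^ (1 - l) * Ψ with hκ
  have hκ0 : 0 ≤ κ := mul_nonneg (Real.rpow_nonneg hθ.le _) hΨ
  have hmass : ∀ t, pathExp P B t (fun h => ∑ x, ∑ i, c t h x i) = 1 := by
    intro t
    simp only [hcsum]
    have h1 : pathExp P B t (fun h => ∑ x : u, p x.1 * G.likelihood (extend hn x.1) t h)
        = ∑ x : u, p x.1 * pathExp (G.playKernel L (extend hn x.1)) B t fun _ => 1 := by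
      have h2 : ∀ x : u, pathExp (G.playKernel L (extend hn x.1)) B t (fun _ => 1)
          = pathExp P B t fun h => G.likelihood (extend hn x.1) t h * 1 :=
        fun x => (G.pathExp_actionWeight_mul L _ B t fun _ => 1).symm
      simp only [h2]
      simp only [pathExp, Finset.mul_sum]
      rw [Finset.sum_comm]
      exact Finset.sum_congr rfl fun x _ => Finset.sum_congr rfl fun h _ => by ring
    rw [h1]
    conv_rhs => rw [← hp1, ← Finset.sum_coe_sort u]
    refine Finset.sum_congr rfl fun x _ => ?_
    rw [pathExp_const _ _ (fun t h => (hS x t).sum_playKernel_one L h), mul_one]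
  have hnext : ∀ t h, ∑ a, (L t h).1 a * ∑ σ ∈ S, barrier (fun i =>
      ∑ x, c t h x i * (G.signalLaw a (extend hn x.1 t)).weights σ)
      = ∑ y ∈ B, P t h y * φ (t + 1) (Fin.snoc h y) := by
    intro t h
    rw [hB, Finset.sum_product]
    refine Finset.sum_congr rfl fun a _ => ?_
    rw [Finset.mul_sum]
    refine Finset.sum_congr rfl fun σ _ => ?_
    simp only [hφ, hc, likelihood_snoc, hP, mul_assoc]
  have hstep : ∀ t, pathExp P B t (fun h => ∑ x, ∑ i, c t h x i *
      (G.value s (L t h) (extend hn x.1 t) - ev (extend hn x.1 t) (f i)))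
      ≤ θ + κ * (pathExp P B (t + 1) (φ (t + 1)) - pathExp P B t (φ t)) := by
    intro t
    refine (pathExp_mono P B hP0 t (hL t)).trans (le_of_eq ?_)
    simp only [hnext]
    rw [pathExp_add, pathExp_const_mul, pathExp_const_mul, pathExp_sub, hmass, pathExp_succ,
      mul_one]
  have hsum := Finset.sum_le_sum fun t (_ : t ∈ Finset.range n) => hstep t
  rw [Finset.sum_add_distrib, ← Finset.mul_sum, Finset.sum_range_sub
    (fun t => pathExp P B t (φ t))] at hsum
  have hφ0 : 0 ≤ pathExp P B 0 (φ 0) := pathExp_nonneg P B hP0 _ fun h =>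
    barrier_nonneg fun i => Finset.sum_nonneg fun x _ => hc0 _ _ _ _
  have hφn : pathExp P B n (φ n) ≤ m * Real.log (n * m) := by
    have h1 : ∀ h, φ n h ≤ (m * -Real.log η) * ∑ x, ∑ i, c n h x i := by
      intro h
      rw [mul_comm, Finset.sum_comm]
      refine barrier_le hη0 (fun i => Finset.sum_nonneg fun x _ => hc0 _ _ _ _) fun i => ?_
      rw [Finset.sum_comm, Finset.mul_sum]
      exact Finset.sum_le_sum fun x _ => hcη n h x i
    refine (pathExp_mono P B hP0 n h1).trans (le_of_eq ?_)
    rw [pathExp_const_mul, hmass, mul_one, ← Real.log_inv, hη, hδ]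
    congr 2
    field_simp
  have hleft : ∑ t ∈ Finset.range n, pathExp P B t (fun h => ∑ x, ∑ i, c t h x i *
      (G.value s (L t h) (extend hn x.1 t) - ev (extend hn x.1 t) (f i)))
      = ∑ x : u, p x.1 * (G.expectedValue s L x.1
        - ∑ i, r x.1 i * (n * ev (averageDist hn x.1) (f i))) := by
    have h1 : ∀ t, pathExp P B t (fun h => ∑ x, ∑ i, c t h x i *
        (G.value s (L t h) (extend hn x.1 t) - ev (extend hn x.1 t) (f i)))
        = ∑ x : u, p x.1 * (pathExp (G.playKernel L (extend hn x.1)) B t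
            (fun h => G.value s (L t h) (extend hn x.1 t))
            - ∑ i, r x.1 i * ev (extend hn x.1 t) (f i)) := by
      intro t
      have h2 : ∀ h (x : u), ∑ i, c t h x i *
          (G.value s (L t h) (extend hn x.1 t) - ev (extend hn x.1 t) (f i))
          = p x.1 * (G.likelihood (extend hn x.1) t h * (G.value s (L t h) (extend hn x.1 t)
            - ∑ i, r x.1 i * ev (extend hn x.1 t) (f i))) := by
        intro h x
        simp only [mul_sub, Finset.sum_sub_distrib, ← Finset.sum_mul]
        rw [hcsum]
        simp only [Finset.mul_sum, hc]
        rw [mul_assoc]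
        congr 1
        exact Finset.sum_congr rfl fun i _ => by ring
      simp only [h2]
      have h3 : pathExp P B t (fun h => ∑ x : u, p x.1 * (G.likelihood (extend hn x.1) t h *
          (G.value s (L t h) (extend hn x.1 t) - ∑ i, r x.1 i * ev (extend hn x.1 t) (f i))))
          = ∑ x : u, p x.1 * pathExp P B t (fun h => G.likelihood (extend hn x.1) t h *
          (G.value s (L t h) (extend hn x.1 t) - ∑ i, r x.1 i * ev (extend hn x.1 t) (f i))) := by
        simp only [pathExp, Finset.mul_sum]
        rw [Finset.sum_comm]
        exact Finset.sum_congr rfl fun x _ => Finset.sum_congr rfl fun h _ => by ring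
      rw [h3]
      refine Finset.sum_congr rfl fun x _ => ?_
      rw [G.pathExp_actionWeight_mul, pathExp_sub,
        pathExp_const _ _ (fun t h => (hS x t).sum_playKernel_one L h)]
    simp only [h1]
    rw [Finset.sum_comm]
    refine Finset.sum_congr rfl fun x _ => ?_
    rw [← Finset.mul_sum, Finset.sum_sub_distrib,
      G.expectedValue_eq_extend s hn x.1 (hS x) L, Finset.sum_comm]
    congr 2
    refine Finset.sum_congr rfl fun i _ => ?_
    rw [← Finset.mul_sum, ev_averageDist, Finset.sum_range]
    congr 1
    refine Finset.sum_congr rfl fun t _ => ?_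
    rw [← congrFun (extend_coe hn x.1) t]
  rw [hleft] at hsum
  have hcomp : ∀ x : u, ∑ i, r x.1 i * (n * ev (averageDist hn x.1) (f i))
      ≤ n * G.optValue s (averageDist hn x.1) + C := by
    intro x
    have hA' : ev (averageDist hn x.1) (f (A x.1)) = G.optValue s (averageDist hn x.1) := hA x.1
    have h1 : ∑ i, r x.1 i * (n * ev (averageDist hn x.1) (f i))
        = (1 - δ) * (n * G.optValue s (averageDist hn x.1))
          + ∑ i, η * (n * ev (averageDist hn x.1) (f i)) := by
      simp only [hr, add_mul, Finset.sum_add_distrib]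
      congr 1
      rw [← hA', Finset.sum_eq_single (A x.1)]
      · simp
      · intro i _ hi
        simp [hi]
      · simp
    have h2 : ∑ i, η * (n * ev (averageDist hn x.1) (f i)) ≤ C := by
      calc _ ≤ ∑ _i : Fin m, η * (n * C) := by
            refine Finset.sum_le_sum fun i _ => ?_
            refine mul_le_mul_of_nonneg_left ?_ hη0.le
            exact mul_le_mul_of_nonneg_left (ev_le_of_forall_le _ (hC i)) hnR.le
        _ = C := by
            simp only [Finset.sum_const, Finset.card_univ, Fintype.card_fin, nsmul_eq_mul, hη, hδ]
            field_simp
    have h3 := mul_nonneg hδ0.le (mul_nonneg hnR.le (G.optValue_nonneg s (averageDist hn x.1)))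
    rw [h1]
    linarith
  have hfinal : ∑ x ∈ u, p x * G.regret s L x ≤ ∑ x : u, p x.1 * (G.expectedValue s L x.1
      - ∑ i, r x.1 i * (n * ev (averageDist hn x.1) (f i))) + C := by
    have h1 : C = ∑ x : u, p x.1 * C := by
      rw [← Finset.sum_mul, Finset.sum_coe_sort u, hp1, one_mul]
    rw [h1, ← Finset.sum_add_distrib, ← Finset.sum_coe_sort u]
    refine Finset.sum_le_sum fun x _ => ?_
    rw [← mul_add]
    refine mul_le_mul_of_nonneg_left ?_ (hp x.1)
    rw [G.regret_of_pos s hn]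
    have := hcomp x
    linarith
  have hκφ : κ * (pathExp P B n (φ n) - pathExp P B 0 (φ 0)) ≤ κ * (m * Real.log (n * m)) :=
    mul_le_mul_of_nonneg_left (by linarith) hκ0
  have hθn : ∑ _t ∈ Finset.range n, θ = n * θ := by simp
  rw [hθn] at hsum
  linarith

/-- The minimax regret is controlled by the minimax information ratio. -/
lemma minimaxRegret_le (hk : 0 < k) [Nonempty Z] {m : ℕ} (hm : m ≤ G.numPieces s)
    {f : Fin m → Z → ℝ} (hf : G.IsPieces s f) {C : ℝ} (hC : ∀ i z, f i z ≤ C) {l Ψ θ : ℝ} (hl : 1 < l) (hΨ : 0 ≤ Ψ)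
    (hθ : 0 < θ) (hinfo : G.minimaxInfoRatio s l < ENNReal.ofReal Ψ) {n : ℕ} (hn : 0 < n) :
    G.minimaxRegret s n ≤ n * θ + θ ^ (1 - l) * Ψ *
      (m * Real.log (n * m)) + C :=
  G.minimaxRegret_le_of_bayes s hk hn fun u p hp hp1 =>
    G.exists_learner_bayes hk hm hf hC hl hΨ hθ hinfo hn u p hp hp1

end Game

/-! ### The lower bound -/

/-- Two distributions with Hellinger affinity at least `1 - r ^ 2` give similar means to
bounded functions. -/
lemma sum_mul_sub_le_of_affinity {ι : Type*} (H : Finset ι) (P Q X : ι → ℝ) {r b : ℝ}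
    (hr : 0 < r) (hb : 0 ≤ b) (hP : ∀ i, 0 ≤ P i) (hQ : ∀ i, 0 ≤ Q i) (hP1 : ∑ i ∈ H, P i = 1)
    (hQ1 : ∑ i ∈ H, Q i = 1) (hX0 : ∀ i, 0 ≤ X i) (hXb : ∀ i, X i ≤ b)
    (haff : 1 - r ^ 2 ≤ ∑ i ∈ H, √(P i * Q i)) :
    ∑ i ∈ H, P i * X i - ∑ i ∈ H, Q i * X i ≤ 3 * b * r := by
  -- `|P - Q| = |√P - √Q| (√P + √Q)`, and the product is split by the weighted AM-GM inequality
  have hpt : ∀ i, P i * X i - Q i * X i ≤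
      b * ((P i + Q i - 2 * √(P i * Q i)) / (2 * r) + r * (P i + Q i)) := by
    intro i
    have hp := Real.sq_sqrt (hP i)
    have hq := Real.sq_sqrt (hQ i)
    set a := √(P i)
    set c := √(Q i)
    have hs : √(P i * Q i) = a * c := Real.sqrt_mul (hP i) _
    rw [hs, ← hp, ← hq]
    have h2 : (a ^ 2 + c ^ 2 - 2 * (a * c)) / (2 * r) = (a - c) ^ 2 / (2 * r) := by ring
    rw [h2]
    have h3 : |a ^ 2 - c ^ 2| ≤ (a - c) ^ 2 / (2 * r) + r * (a ^ 2 + c ^ 2) := by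
      have h4 : |a ^ 2 - c ^ 2| = |a - c| * |a + c| := by rw [← abs_mul]; congr 1; ring
      have h5 : 0 ≤ (|a - c| / r - |a + c|) ^ 2 * r := by positivity
      have h6 : (|a - c| / r - |a + c|) ^ 2 * r
          = |a - c| ^ 2 / r - 2 * (|a - c| * |a + c|) + r * |a + c| ^ 2 := by
        field_simp
        ring
      rw [h6, sq_abs, sq_abs] at h5
      have h7 : (a - c) ^ 2 / (2 * r) = (a - c) ^ 2 / r / 2 := by
        rw [div_div, mul_comm]
      rw [h4, h7]
      nlinarith [mul_nonneg hr.le (sq_nonneg (a - c))]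
    calc a ^ 2 * X i - c ^ 2 * X i = (a ^ 2 - c ^ 2) * X i := by ring
      _ ≤ |a ^ 2 - c ^ 2| * X i := mul_le_mul_of_nonneg_right (le_abs_self _) (hX0 i)
      _ ≤ |a ^ 2 - c ^ 2| * b := mul_le_mul_of_nonneg_left (hXb i) (abs_nonneg _)
      _ ≤ _ := by rw [mul_comm]; exact mul_le_mul_of_nonneg_left h3 hb
  rw [← Finset.sum_sub_distrib]
  refine (Finset.sum_le_sum fun i _ => hpt i).trans ?_
  rw [← Finset.mul_sum, Finset.sum_add_distrib, ← Finset.sum_div, ← Finset.mul_sum,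
    Finset.sum_sub_distrib, Finset.sum_add_distrib, hP1, hQ1, ← Finset.mul_sum]
  have h1 : (1 + 1 - 2 * ∑ i ∈ H, √(P i * Q i)) / (2 * r) ≤ r := by
    rw [div_le_iff₀ (by positivity)]
    nlinarith
  have : 3 * b * r = b * (r + r * (1 + 1)) := by ring
  rw [this]
  exact mul_le_mul_of_nonneg_left (by linarith) hb

namespace Game

variable {k : ℕ} {Z Sig : Type*} (G : Game k Z Sig) (s : Setting)

lemma instRegret_eq_ev (π : Policy k) (μ : FinDist (FinDist Z)) :
    G.instRegret s π μ = ev μ fun x => G.value s π x - G.optValue s x := rfl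

lemma gap_mem (π : Policy k) (x : FinDist Z) :
    G.value s π x - G.optValue s x ∈ Set.Icc (0 : ℝ) 1 :=
  ⟨sub_nonneg.2 (G.optValue_le_value s π x), by
    have h1 := (G.value_mem s π x).2
    have h2 := G.optValue_nonneg s x
    linarith⟩

lemma instRegret_mem (π : Policy k) (μ : FinDist (FinDist Z)) :
    G.instRegret s π μ ∈ Set.Icc (0 : ℝ) 1 :=
  ⟨ev_nonneg μ fun x => (G.gap_mem s π x).1, ev_le_of_forall_le μ fun x => (G.gap_mem s π x).2⟩

/-- If every policy has finite information gain, then the affinity between the signals under the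
mean of `μ` and under a point of its support is bounded below by the information gain. -/
lemma one_sub_infoGain_le {μ : FinDist (FinDist Z)} (hI : ∀ π, G.infoGain π μ ≠ ∞)
    {x : FinDist Z} (hx : x ∈ μ.weights.support) {S : Finset Sig}
    (hS : G.Covers S μ.sConvexComb) (π : Policy k) :
    1 - (G.infoGain π μ).toReal / 2 ≤ ∑ a, π.1 a * ∑ σ ∈ S,
      √((G.signalLaw a μ.sConvexComb).weights σ * (G.signalLaw a x).weights σ) := by
  classical
  have hfin : ∀ a, ∑ x ∈ μ.weights.support, kl (G.signalLaw a μ.sConvexComb) (G.signalLaw a x)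
      ≠ ∞ := by
    intro a h
    refine hI ⟨Pi.single a 1, single_mem_stdSimplex ℝ a⟩ ?_
    rw [infoGain, ENNReal.sum_eq_top]
    refine ⟨a, Finset.mem_univ a, ?_⟩
    rw [h]
    simp
  have hkl : ∀ a, kl (G.signalLaw a μ.sConvexComb) (G.signalLaw a x) ≠ ∞ := fun a h =>
    hfin a (ENNReal.sum_eq_top.2 ⟨x, hx, h⟩)
  have h1 : ∑ a, π.1 a * (kl (G.signalLaw a μ.sConvexComb) (G.signalLaw a x)).toReal
      ≤ (G.infoGain π μ).toReal := by
    rw [infoGain, ENNReal.toReal_sum fun a _ => ENNReal.mul_ne_top ENNReal.ofReal_ne_top (hfin a)]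
    refine Finset.sum_le_sum fun a _ => ?_
    rw [ENNReal.toReal_mul, ENNReal.toReal_ofReal (policy_nonneg π a)]
    refine mul_le_mul_of_nonneg_left ?_ (policy_nonneg π a)
    exact ENNReal.toReal_mono (hfin a) (Finset.single_le_sum
      (f := fun x => kl (G.signalLaw a μ.sConvexComb) (G.signalLaw a x))
      (fun _ _ => zero_le) hx)
  calc 1 - (G.infoGain π μ).toReal / 2
      ≤ 1 - (∑ a, π.1 a * (kl (G.signalLaw a μ.sConvexComb) (G.signalLaw a x)).toReal) / 2 := by
        linarith
    _ = ∑ a, π.1 a * (1 - (kl (G.signalLaw a μ.sConvexComb) (G.signalLaw a x)).toReal / 2) := by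
        simp only [mul_sub, Finset.sum_sub_distrib, mul_one, policy_sum, Finset.sum_div,
          mul_div_assoc]
    _ ≤ _ := Finset.sum_le_sum fun a _ => mul_le_mul_of_nonneg_left
        (one_sub_kl_le_affinity _ _ (hkl a) (hS a)) (policy_nonneg π a)

/-- In every round the regret against a stationary adversary increases by the expected gap. -/
lemma regret_const_eq {S : Finset Sig} {x : FinDist Z} (hS : G.Covers S x) {n : ℕ} (hn : 0 < n)
    (L : Learner k Sig) :
    G.regret s L (fun _ : Fin n => x) = ∑ t ∈ Finset.range n,
      pathExp (G.playKernel L fun _ => x) (Finset.univ ×ˢ S) t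
        fun h => G.value s (L t h) x - G.optValue s x := by
  rw [G.regret_of_pos s hn, averageDist_const]
  have h1 := G.expectedValue_eq s (ξ := fun _ => x) (fun _ => hS) L n
  rw [h1]
  have h2 : ∀ t, pathExp (G.playKernel L fun _ => x) (Finset.univ ×ˢ S) t
      (fun h => G.value s (L t h) x - G.optValue s x)
      = pathExp (G.playKernel L fun _ => x) (Finset.univ ×ˢ S) t
        (fun h => G.value s (L t h) x) - G.optValue s x := by
    intro t
    rw [pathExp_sub, pathExp_const _ _ fun t h =>
      Covers.sum_playKernel_one (ξ := fun _ => x) hS L h]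
  simp only [h2, Finset.sum_sub_distrib, Finset.sum_const, Finset.card_range, nsmul_eq_mul]

/-- Costs accumulated until they exceed the threshold `T` are between `T` and `T + 1`, provided
that each cost is at most one and that they eventually exceed the threshold. -/
lemma stoppedCost_bounds {Y : Type*} {d : (t : ℕ) → (Fin t → Y) → ℝ} {T : ℝ} (hT : 0 < T)
    (hd0 : ∀ t h, 0 ≤ d t h) (hd1 : ∀ t h, d t h ≤ 1) : ∀ t h,
    pathCost (fun t h => if pathCost d t h < T then d t h else 0) t h ≤ T + 1 ∧
      (T ≤ pathCost d t h →
        T ≤ pathCost (fun t h => if pathCost d t h < T then d t h else 0) t h) := by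
  set e : (t : ℕ) → (Fin t → Y) → ℝ := fun t h => if pathCost d t h < T then d t h else 0 with he
  have key : ∀ t h, (pathCost e t h = pathCost d t h ∧ pathCost d t h < T + 1) ∨
      (T ≤ pathCost e t h ∧ pathCost e t h ≤ T + 1 ∧ T ≤ pathCost d t h) := by
    intro t
    induction t with
    | zero => intro h; left; exact ⟨rfl, by change (0 : ℝ) < T + 1; linarith⟩
    | succ t ih =>
      intro h
      have e1 : pathCost e (t + 1) h = pathCost e t (Fin.init h) + e t (Fin.init h) := rfl
      have e2 : pathCost d (t + 1) h = pathCost d t (Fin.init h) + d t (Fin.init h) := rfl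
      have hd0' := hd0 t (Fin.init h)
      have hd1' := hd1 t (Fin.init h)
      rw [e1, e2]
      by_cases hlt : pathCost d t (Fin.init h) < T
      · have e3 : e t (Fin.init h) = d t (Fin.init h) := by simp [he, hlt]
        rw [e3]
        rcases ih (Fin.init h) with ⟨h1, h2⟩ | ⟨h1, h2, h3⟩
        · left; constructor <;> linarith
        · linarith
      · have e3 : e t (Fin.init h) = 0 := by simp [he, hlt]
        rw [e3]
        push Not at hlt
        right
        rcases ih (Fin.init h) with ⟨h1, h2⟩ | ⟨h1, h2, h3⟩
        · refine ⟨?_, ?_, ?_⟩ <;> linarith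
        · refine ⟨?_, ?_, ?_⟩ <;> linarith
  intro t h
  rcases key t h with ⟨h1, h2⟩ | ⟨h1, h2, h3⟩
  · exact ⟨by linarith, fun _ => by linarith⟩
  · exact ⟨h2, fun _ => h1⟩

lemma pathCost_nonneg {Y : Type*} {d : (t : ℕ) → (Fin t → Y) → ℝ} (hd : ∀ t h, 0 ≤ d t h) :
    ∀ t h, 0 ≤ pathCost d t h
  | 0, _ => le_rfl
  | t + 1, _ => add_nonneg (pathCost_nonneg hd t _) (hd t _)

lemma pathCost_mono {Y : Type*} {d d' : (t : ℕ) → (Fin t → Y) → ℝ} (hd : ∀ t h, d t h ≤ d' t h) :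
    ∀ t h, pathCost d t h ≤ pathCost d' t h
  | 0, _ => le_rfl
  | t + 1, _ => add_le_add (pathCost_mono hd t _) (hd t _)

lemma pathCost_const_mul {Y : Type*} (c : ℝ) (d : (t : ℕ) → (Fin t → Y) → ℝ) :
    ∀ t h, pathCost (fun t h => c * d t h) t h = c * pathCost d t h
  | 0, _ => (mul_zero c).symm
  | t + 1, h => by rw [pathCost, pathCost, pathCost_const_mul c d t, mul_add]

lemma pathCost_sum {Y ι : Type*} (u : Finset ι) (d : ι → (t : ℕ) → (Fin t → Y) → ℝ) :
    ∀ t h, pathCost (fun t h => ∑ i ∈ u, d i t h) t h = ∑ i ∈ u, pathCost (d i) t h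
  | 0, _ => by simp [pathCost]
  | t + 1, h => by simp only [pathCost, pathCost_sum u d t, Finset.sum_add_distrib]

lemma le_pathCost {Y : Type*} {d : (t : ℕ) → (Fin t → Y) → ℝ} {c : ℝ} (hd : ∀ t h, c ≤ d t h) :
    ∀ t h, t * c ≤ pathCost d t h
  | 0, _ => by simp [pathCost]
  | t + 1, h => by
    have h1 := le_pathCost hd t (Fin.init h)
    have h2 := hd t (Fin.init h)
    rw [pathCost]
    push_cast
    linarith

/-- If all policies gain little information relative to their regret, then no learner can tell the
points of the support of `μ` from its mean before it has suffered a regret of order `n * d₀`.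

The comparison is stopped when the accumulated one-round regret under `μ` exceeds a threshold `T`.
Up to then little information has been gained, so the laws of the stopped histories under the mean
and under a point `x` of the support are close. As the stopped regrets, weighted by `μ`, sum to a
number in `[T, T + 1]`, the contribution of each `x` is bounded, and the comparison loses only a
fraction of `T`. -/
lemma exists_regret_ge {μ : FinDist (FinDist Z)} {M : ℕ} (hM : 0 < M)
    (hcard : μ.weights.support.card ≤ M) {d₀ N : ℝ} (hd₀ : 0 < d₀) (hN : 0 < N)
    (hI : ∀ π, G.infoGain π μ ≠ ∞) (hd : ∀ π, d₀ ≤ G.instRegret s π μ)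
    (hId : ∀ π, (G.infoGain π μ).toReal ≤ G.instRegret s π μ / (N * d₀)) {n : ℕ} (hn : 0 < n)
    (hnN : (n : ℝ) ≤ N) {r T : ℝ} (hr : r = 1 / (12 * M)) (hT : T = r ^ 2 * n * d₀)
    (hT1 : 1 ≤ T) (L : Learner k Sig) :
    ∃ x, T / 2 ≤ G.regret s L (fun _ : Fin n => x) := by
  classical
  have hMR : (1 : ℝ) ≤ M := by exact_mod_cast hM
  have hr0 : 0 < r := by rw [hr]; positivity
  have hr1 : r ≤ 1 := by
    rw [hr, div_le_one (by positivity)]; linarith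
  have hrsq : r ^ 2 ≤ 1 := pow_le_one₀ hr0.le hr1
  have hT0 : 0 < T := by linarith
  set xb := μ.sConvexComb with hxb
  set U := μ.weights.support with hU
  obtain ⟨S, hS⟩ := G.exists_covers fun o : Option U => o.elim xb (fun x => x.1)
  have hSb : G.Covers S xb := hS none
  have hSx : ∀ x ∈ U, G.Covers S x := fun x hx => hS (some ⟨x, hx⟩)
  set A : Finset (Fin k × Sig) := Finset.univ ×ˢ S with hA
  -- one-round regrets, the stopping rule and the stopped costs
  set gap : FinDist Z → (t : ℕ) → (Fin t → Fin k × Sig) → ℝ :=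
    fun x t h => G.value s (L t h) x - G.optValue s x with hgap
  set d : (t : ℕ) → (Fin t → Fin k × Sig) → ℝ := fun t h => G.instRegret s (L t h) μ with hdd
  have hd0 : ∀ t h, 0 ≤ d t h := fun t h => (G.instRegret_mem s _ _).1
  have hgap0 : ∀ x t h, 0 ≤ gap x t h := fun x t h => (G.gap_mem s _ _).1
  have hdgap : ∀ t h, d t h = ∑ x ∈ U, μ.weights x * gap x t h := fun t h => rfl
  set e : (t : ℕ) → (Fin t → Fin k × Sig) → ℝ :=
    fun t h => if pathCost d t h < T then d t h else 0 with he
  set eX : FinDist Z → (t : ℕ) → (Fin t → Fin k × Sig) → ℝ :=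
    fun x t h => if pathCost d t h < T then gap x t h else 0 with heX
  set eI : (t : ℕ) → (Fin t → Fin k × Sig) → ℝ :=
    fun t h => if pathCost d t h < T then (G.infoGain (L t h) μ).toReal / 2 else 0 with heI
  have heX0 : ∀ x t h, 0 ≤ eX x t h := by
    intro x t h
    simp only [heX]
    split_ifs
    · exact hgap0 x t h
    · exact le_rfl
  have heI0 : ∀ t h, 0 ≤ eI t h := by
    intro t h
    simp only [heI]
    split_ifs
    · positivity
    · exact le_rfl
  have hbounds := stoppedCost_bounds hT0 hd0 (fun t h => (G.instRegret_mem s _ _).2)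
  have hYup : ∀ t h, pathCost e t h ≤ 2 * T := fun t h => by
    have := (hbounds t h).1
    linarith
  have hYlow : ∀ h, T ≤ pathCost e n h := by
    intro h
    refine (hbounds n h).2 (le_trans ?_ (le_pathCost (fun t h => hd (L t h)) n h))
    rw [hT]
    have : 0 ≤ (n : ℝ) * d₀ := by positivity
    nlinarith
  have hYX : ∀ t h, pathCost e t h = ∑ x ∈ U, μ.weights x * pathCost (eX x) t h := by
    intro t h
    simp only [← pathCost_const_mul]
    rw [← pathCost_sum]
    congr 1
    funext t h
    simp only [he, heX]
    split_ifs
    · exact hdgap t h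
    · simp
  have hInfo : ∀ t h, pathCost eI t h ≤ r ^ 2 := by
    intro t h
    have h1 : ∀ t h, eI t h ≤ (1 / (2 * (N * d₀))) * e t h := by
      intro t h
      simp only [heI, he]
      split_ifs
      · have := hId (L t h)
        have h2 : 1 / (2 * (N * d₀)) * d t h = d t h / (N * d₀) / 2 := by field_simp
        rw [h2]
        linarith
      · simp
    refine (pathCost_mono h1 t h).trans ?_
    rw [pathCost_const_mul]
    have h2 : 1 / (2 * (N * d₀)) * pathCost e t h ≤ 1 / (2 * (N * d₀)) * (2 * T) :=
      mul_le_mul_of_nonneg_left (hYup t h) (by positivity)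
    refine h2.trans ?_
    have h3 : 1 / (2 * (N * d₀)) * (2 * T) = r ^ 2 * (n / N) := by
      rw [hT]; field_simp
    rw [h3]
    have h4 : (n : ℝ) / N ≤ 1 := (div_le_one hN).2 hnN
    nlinarith [sq_nonneg r]
  -- the law under the mean, and the law under `x` that switches to the mean after stopping
  set K : FinDist Z → (t : ℕ) → (Fin t → Fin k × Sig) → Fin k × Sig → ℝ :=
    fun x => G.playKernel L fun _ => x with hK
  set Ks : FinDist Z → (t : ℕ) → (Fin t → Fin k × Sig) → Fin k × Sig → ℝ :=
    fun x t h y => if pathCost d t h < T then K x t h y else K xb t h y with hKs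
  have hK0 : ∀ x t h y, 0 ≤ K x t h y := fun x => G.playKernel_nonneg L _
  have hKs0 : ∀ x t h y, 0 ≤ Ks x t h y := by
    intro x t h y
    simp only [hKs]
    split_ifs <;> exact hK0 _ _ _ _
  have hKb1 : ∀ t h, ∑ y ∈ A, K xb t h y = 1 := fun t h =>
    Covers.sum_playKernel_one (ξ := fun _ => xb) hSb L h
  have hKx1 : ∀ x ∈ U, ∀ t h, ∑ y ∈ A, K x t h y = 1 := fun x hx t h =>
    Covers.sum_playKernel_one (ξ := fun _ => x) (hSx x hx) L h
  have hKs1 : ∀ x ∈ U, ∀ t h, ∑ y ∈ A, Ks x t h y = 1 := by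
    intro x hx t h
    simp only [hKs]
    split_ifs
    · exact hKx1 x hx t h
    · exact hKb1 t h
  have hagree : ∀ x t h, pathCost d t h < T → pathWeight (Ks x) t h = pathWeight (K x) t h := by
    intro x t
    induction t with
    | zero => intro h _; rfl
    | succ t ih =>
      intro h hlt
      have e2 : pathCost d (t + 1) h = pathCost d t (Fin.init h) + d t (Fin.init h) := rfl
      have hlt' : pathCost d t (Fin.init h) < T := by
        have := hd0 t (Fin.init h)
        linarith
      rw [pathWeight, pathWeight, ih _ hlt']
      simp only [hKs, hlt', if_true]
  -- the stopped regret is at most the regret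
  have hstopped : ∀ x ∈ U, pathExp (Ks x) A n (pathCost (eX x) n)
      ≤ G.regret s L (fun _ : Fin n => x) := by
    intro x hx
    rw [pathExp_pathCost (Ks x) A (hKs1 x hx), G.regret_const_eq s (hSx x hx) hn L]
    refine Finset.sum_le_sum fun t _ => Finset.sum_le_sum fun h _ => ?_
    by_cases hlt : pathCost d t h < T
    · rw [hagree x t h hlt]
      simp only [heX, hlt, if_true]
      exact le_rfl
    · simp only [heX, hlt, if_false, mul_zero]
      exact mul_nonneg (pathWeight_nonneg _ (hK0 x) t h) (hgap0 x t h)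
  -- the affinity between the two laws
  have haff : ∀ x ∈ U, 1 - r ^ 2 ≤ ∑ h ∈ Fintype.piFinset (fun _ : Fin n => A),
      √(pathWeight (K xb) n h * pathWeight (Ks x) n h) := by
    intro x hx
    set R : (t : ℕ) → (Fin t → Fin k × Sig) → Fin k × Sig → ℝ :=
      fun t h y => √(K xb t h y * Ks x t h y) with hR
    have hR0 : ∀ t h y, 0 ≤ R t h y := fun t h y => Real.sqrt_nonneg _
    have hone : ∀ t h, 1 - eI t h ≤ ∑ y ∈ A, R t h y := by
      intro t h
      by_cases hlt : pathCost d t h < T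
      · simp only [heI, hR, hKs, hlt, if_true]
        refine (G.one_sub_infoGain_le hI hx hSb (L t h)).trans (le_of_eq ?_)
        rw [hA, Finset.sum_product]
        refine Finset.sum_congr rfl fun a _ => ?_
        rw [Finset.mul_sum]
        refine Finset.sum_congr rfl fun σ _ => ?_
        simp only [hK, playKernel]
        have hp := policy_nonneg (L t h) a
        rw [mul_mul_mul_comm, Real.sqrt_mul (mul_nonneg hp hp), Real.sqrt_mul_self hp]
      · simp only [heI, hR, hKs, hlt, if_false, sub_zero]
        rw [← hKb1 t h]
        exact Finset.sum_le_sum fun y _ => (Real.sqrt_mul_self (hK0 _ _ _ _)).ge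
    -- the affinity, weighted by the remaining information budget, does not decrease
    have hmono : ∀ t, 1 - r ^ 2 ≤ pathExp R A t fun h => 1 - r ^ 2 + pathCost eI t h := by
      intro t
      induction t with
      | zero => rw [pathExp_zero]; simp [pathCost]
      | succ t ih =>
        refine ih.trans ?_
        rw [pathExp_succ]
        refine pathExp_mono R A hR0 t fun h => ?_
        simp only [pathCost_snoc, ← Finset.sum_mul]
        set w := 1 - r ^ 2 + pathCost eI t h with hw
        have hw0 : 0 ≤ w := by
          have := pathCost_nonneg heI0 t h
          linarith
        have h0 := heI0 t h
        by_cases hA0 : A.Nonempty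
        · obtain ⟨y, -⟩ := hA0
          have h1 : w + eI t h ≤ 1 := by
            have h2 := hInfo (t + 1) (Fin.snoc h y)
            rw [pathCost_snoc] at h2
            linarith
          have h3 : (1 - eI t h) * (w + eI t h) ≤ (∑ y ∈ A, R t h y) * (w + eI t h) :=
            mul_le_mul_of_nonneg_right (hone t h) (by linarith)
          have h4 : 1 - r ^ 2 + (pathCost eI t h + eI t h) = w + eI t h := by rw [hw]; ring
          rw [h4]
          nlinarith
        · exfalso
          have h5 := hKb1 t h
          rw [Finset.not_nonempty_iff_eq_empty.1 hA0] at h5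
          simp at h5
    refine (hmono n).trans (Finset.sum_le_sum fun h _ => ?_)
    have h1 : √(pathWeight (K xb) n h * pathWeight (Ks x) n h) = pathWeight R n h := by
      rw [← pathWeight_mul, sqrt_pathWeight _ fun t h y => mul_nonneg (hK0 _ _ _ _) (hKs0 _ _ _ _)]
    rw [h1]
    refine mul_le_of_le_one_right (pathWeight_nonneg R hR0 n h) ?_
    have := hInfo n h
    linarith
  have hcompare : ∀ x ∈ U, pathExp (K xb) A n (fun h => μ.weights x * pathCost (eX x) n h)
      - μ.weights x * G.regret s L (fun _ : Fin n => x) ≤ 3 * (2 * T) * r := by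
    intro x hx
    have hs := mul_le_mul_of_nonneg_left (hstopped x hx) (μ.nonneg x)
    rw [← pathExp_const_mul] at hs
    have h1 : pathExp (K xb) A n (fun h => μ.weights x * pathCost (eX x) n h)
        - pathExp (Ks x) A n (fun h => μ.weights x * pathCost (eX x) n h) ≤ 3 * (2 * T) * r := by
      refine sum_mul_sub_le_of_affinity _ _ _ _ hr0 (by positivity)
        (pathWeight_nonneg _ (hK0 xb) n) (pathWeight_nonneg _ (hKs0 x) n) ?_ ?_ ?_ ?_ (haff x hx)
      · simpa [pathExp] using pathExp_const (K xb) A hKb1 1 n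
      · simpa [pathExp] using pathExp_const (Ks x) A (hKs1 x hx) 1 n
      · exact fun h => mul_nonneg (μ.nonneg x) (pathCost_nonneg (heX0 x) n h)
      · intro h
        refine le_trans ?_ (hYup n h)
        rw [hYX]
        exact Finset.single_le_sum (f := fun x => μ.weights x * pathCost (eX x) n h)
          (fun x _ => mul_nonneg (μ.nonneg x) (pathCost_nonneg (heX0 x) n h)) hx
    linarith
  have hsum := Finset.sum_le_sum hcompare
  rw [Finset.sum_sub_distrib, Finset.sum_const, nsmul_eq_mul] at hsum
  have hEY : T ≤ ∑ x ∈ U, pathExp (K xb) A n (fun h => μ.weights x * pathCost (eX x) n h) := by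
    have h1 : ∑ x ∈ U, pathExp (K xb) A n (fun h => μ.weights x * pathCost (eX x) n h)
        = pathExp (K xb) A n (pathCost e n) := by
      simp only [pathExp]
      rw [Finset.sum_comm]
      refine Finset.sum_congr rfl fun h _ => ?_
      rw [← Finset.mul_sum, hYX]
    rw [h1, ← pathExp_const (K xb) A hKb1 T n]
    exact pathExp_mono _ _ (hK0 xb) n hYlow
  have hloss : (U.card : ℝ) * (3 * (2 * T) * r) ≤ T / 2 := by
    have h1 : (U.card : ℝ) ≤ M := by exact_mod_cast hcard
    have h2 : (M : ℝ) * (3 * (2 * T) * r) = T / 2 := by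
      rw [hr]; field_simp; ring
    rw [← h2]
    exact mul_le_mul_of_nonneg_right h1 (by positivity)
  by_contra hcon
  push Not at hcon
  have h3 : ∑ x ∈ U, μ.weights x * G.regret s L (fun _ : Fin n => x)
      < ∑ x ∈ U, μ.weights x * (T / 2) := by
    refine Finset.sum_lt_sum_of_nonempty μ.support_weights_nonempty fun x hx => ?_
    refine mul_lt_mul_of_pos_left (hcon x) ?_
    exact lt_of_le_of_ne (μ.nonneg x) (Ne.symm (Finsupp.mem_support_iff.1 hx))
  rw [← Finset.sum_mul, sum_weights μ subset_rfl, one_mul] at h3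
  linarith

lemma continuous_instRegret (μ : FinDist (FinDist Z)) :
    Continuous fun π : Policy k => G.instRegret s π μ := by
  simp only [instRegret_eq_ev, ev_eq_sum]
  exact continuous_finsetSum _ fun x _ =>
    continuous_const.mul ((G.continuous_value s x).sub continuous_const)

/-- Mixing a policy `π` with the policy `π₀` of least regret shows that a lower bound `R` on the
information ratio of all policies bounds the information gain of `π` linearly by its regret. -/
lemma infoGain_le_of_infoRatio_ge (hk : 0 < k) {μ : FinDist (FinDist Z)} {l R : ℝ} (hl : 1 < l)
    (hR : 0 < R) (h : ∀ π, ENNReal.ofReal R ≤ G.infoRatio s l π μ) :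
    (∀ π, G.infoGain π μ ≠ ∞) ∧ ∃ d₀, 0 < d₀ ∧ d₀ ≤ 1 ∧ ∀ π, d₀ ≤ G.instRegret s π μ ∧
      (G.infoGain π μ).toReal ≤ G.instRegret s π μ / (R / (2 * d₀) ^ l * d₀) := by
  have hl0 : 0 < l := by linarith
  have hI : ∀ π, G.infoGain π μ ≠ ∞ := by
    intro π hπ
    have := h π
    rw [infoRatio, hπ, ENNReal.div_top] at this
    simp only [nonpos_iff_eq_zero, ENNReal.ofReal_eq_zero] at this
    linarith
  have hpos : ∀ π, 0 < G.instRegret s π μ := by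
    intro π
    by_contra hneg
    push Not at hneg
    have := h π
    rw [infoRatio, ENNReal.ofReal_of_nonpos hneg, ENNReal.zero_rpow_of_pos hl0,
      ENNReal.zero_div] at this
    simp only [nonpos_iff_eq_zero, ENNReal.ofReal_eq_zero] at this
    linarith
  have hreal : ∀ π, R * (G.infoGain π μ).toReal ≤ G.instRegret s π μ ^ l := by
    intro π
    have h1 := h π
    rw [infoRatio, ENNReal.ofReal_rpow_of_pos (hpos π)] at h1
    have h2 := ENNReal.mul_le_of_le_div h1
    have h3 := ENNReal.toReal_mono ENNReal.ofReal_ne_top h2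
    rwa [ENNReal.toReal_mul, ENNReal.toReal_ofReal hR.le,
      ENNReal.toReal_ofReal (Real.rpow_nonneg (hpos π).le _)] at h3
  have hkne : Nonempty (Fin k) := ⟨⟨0, hk⟩⟩
  obtain ⟨π₀, -, hmin⟩ := isCompact_univ.exists_isMinOn (Set.univ_nonempty (α := Policy k))
    (G.continuous_instRegret s μ).continuousOn
  have hmin' : ∀ π, G.instRegret s π₀ μ ≤ G.instRegret s π μ := fun π => hmin (Set.mem_univ π)
  refine ⟨hI, G.instRegret s π₀ μ, hpos π₀, (G.instRegret_mem s π₀ μ).2, fun π =>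
    ⟨hmin' π, ?_⟩⟩
  set d₀ := G.instRegret s π₀ μ with hd₀
  set d := G.instRegret s π μ with hd
  have hd₀pos : 0 < d₀ := hpos π₀
  have hdpos : 0 < d := hpos π
  set q := d₀ / d with hq
  have hq0 : 0 < q := div_pos hd₀pos hdpos
  have hq1 : q ≤ 1 := (div_le_one hdpos).2 (hmin' π)
  let πq : Policy k := ⟨(1 - q) • π₀.1 + q • π.1,
    convex_stdSimplex ℝ (Fin k) π₀.2 π.2 (by linarith) hq0.le (by ring)⟩
  have hπq : ∀ a, πq.1 a = (1 - q) * π₀.1 a + q * π.1 a := fun a => rfl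
  have hreg : G.instRegret s πq μ ≤ 2 * d₀ := by
    have h1 : G.instRegret s πq μ ≤ (1 - q) * d₀ + q * d := by
      rw [hd₀, hd, instRegret_eq_ev, instRegret_eq_ev, instRegret_eq_ev, ← ev_const_mul,
        ← ev_const_mul, ← ev_add]
      refine ev_mono μ fun x => ?_
      have := G.value_convex s (by linarith) hq0.le hπq x
      linarith
    have h2 : q * d = d₀ := div_mul_cancel₀ _ hdpos.ne'
    rw [h2] at h1
    nlinarith
  have hgain : q * (G.infoGain π μ).toReal ≤ (G.infoGain πq μ).toReal := by
    have h1 : ENNReal.ofReal q * G.infoGain π μ ≤ G.infoGain πq μ := by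
      rw [infoGain, infoGain, Finset.mul_sum]
      refine Finset.sum_le_sum fun a _ => ?_
      rw [← mul_assoc, ← ENNReal.ofReal_mul hq0.le]
      refine mul_le_mul_left (ENNReal.ofReal_le_ofReal ?_) _
      rw [hπq]
      have := mul_nonneg (sub_nonneg.2 hq1) (policy_nonneg π₀ a)
      linarith
    have h2 := ENNReal.toReal_mono (hI πq) h1
    rwa [ENNReal.toReal_mul, ENNReal.toReal_ofReal hq0.le] at h2
  have h3 : R * (q * (G.infoGain π μ).toReal) ≤ (2 * d₀) ^ l :=
    ((mul_le_mul_of_nonneg_left hgain hR.le).trans (hreal πq)).trans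
      (Real.rpow_le_rpow (hpos πq).le hreg hl0.le)
  have hpow : 0 < (2 * d₀) ^ l := Real.rpow_pos_of_pos (by linarith) _
  have h4 : d / (R / (2 * d₀) ^ l * d₀) = (2 * d₀) ^ l / (R * q) := by
    rw [hq]; field_simp
  rw [h4, le_div_iff₀ (by positivity)]
  linarith

lemma le_stochasticMinimaxRegret (hk : 0 < k) {n : ℕ} (hn : 0 < n) {v : ℝ}
    (h : ∀ L : Learner k Sig, ∃ x, v ≤ G.regret s L (fun _ : Fin n => x)) :
    v ≤ G.stochasticMinimaxRegret s n := by
  have hkne : Nonempty (Fin k) := ⟨⟨0, hk⟩⟩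
  refine le_ciInf fun L => ?_
  obtain ⟨x, hx⟩ := h L
  exact hx.trans (le_ciSup (f := fun x => G.regret s L (fun _ : Fin n => x))
    ⟨n, by rintro _ ⟨y, rfl⟩; exact G.regret_le s hn L _⟩ x)

/-- If the information ratio with exponent `l` is unbounded, then stationary adversaries force
regret of order `n ^ (1 - 1 / l)` for arbitrarily large horizons. -/
lemma exists_stochasticMinimaxRegret_ge (hk : 0 < k) (hM : 0 < G.numPieces s) {l : ℝ}
    (hl : 1 < l) (hinfo : G.minimaxInfoRatio s l = ∞) :
    ∃ c > 0, ∀ n₀ : ℕ, ∃ n ≥ n₀, 0 < n ∧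
      c * (n : ℝ) ^ (1 - 1 / l) ≤ G.stochasticMinimaxRegret s n := by
  have hl0 : 0 < l := by linarith
  have hMR : (1 : ℝ) ≤ G.numPieces s := by exact_mod_cast hM
  set r : ℝ := 1 / (12 * G.numPieces s) with hr
  have hr0 : 0 < r := by positivity
  set B : ℝ := 2 ^ l with hB
  have hB1 : 1 ≤ B := Real.one_le_rpow (by norm_num) hl0.le
  refine ⟨r ^ 2 / 4, by positivity, fun n₀ => ?_⟩
  -- the information ratio has to exceed `R`; the choices make `n` and `T` below large
  set R : ℝ := 2 * B * (n₀ + 1) + 2 * B / r ^ 2 with hR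
  have hRpos : 0 < R := by positivity
  have hR1 : 2 * B * (n₀ + 1) ≤ R := by
    have : 0 ≤ 2 * B / r ^ 2 := by positivity
    linarith
  have hR2 : 2 * B / r ^ 2 ≤ R := by
    have : (0 : ℝ) ≤ 2 * B * (n₀ + 1) := by positivity
    linarith
  obtain ⟨μ, hμ⟩ : ∃ μ : {μ : FinDist (FinDist Z) // μ.weights.support.card ≤ G.numPieces s},
      ENNReal.ofReal R < ⨅ π : Policy k, G.infoRatio s l π μ.1 := by
    rw [← lt_iSup_iff]
    change ENNReal.ofReal R < G.minimaxInfoRatio s l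
    rw [hinfo]
    exact ENNReal.ofReal_lt_top
  obtain ⟨hI, d₀, hd₀, hd₀1, hd⟩ := G.infoGain_le_of_infoRatio_ge s hk hl hRpos
    fun π => hμ.le.trans (iInf_le _ π)
  have h2d : (2 * d₀) ^ l = B * d₀ ^ l := Real.mul_rpow (by norm_num) hd₀.le
  have hdl : 0 < d₀ ^ l := Real.rpow_pos_of_pos hd₀ _
  have hdl1 : d₀ ^ l ≤ 1 := Real.rpow_le_one hd₀.le hd₀1 hl0.le
  have hdl2 : d₀ ^ l ≤ d₀ := by
    have := Real.rpow_le_rpow_of_exponent_ge hd₀ hd₀1 hl.le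
    rwa [Real.rpow_one] at this
  set N : ℝ := R / (2 * d₀) ^ l with hN
  have hNd : N * (B * d₀ ^ l) = R := by
    rw [hN, h2d]
    field_simp
  have hBd : 0 < B * d₀ ^ l := by positivity
  have hNpos : 0 < N := by rw [hN, h2d]; positivity
  have hNge : 2 * ((n₀ : ℝ) + 1) ≤ N := by
    have h1 : B * d₀ ^ l ≤ B := by nlinarith
    have h2 : N * (B * d₀ ^ l) ≤ N * B := mul_le_mul_of_nonneg_left h1 hNpos.le
    have h3 : 2 * ((n₀ : ℝ) + 1) * B ≤ N * B := by linarith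
    exact le_of_mul_le_mul_right h3 (by linarith)
  set n : ℕ := ⌊N⌋₊ with hn
  have hnN : (n : ℝ) ≤ N := Nat.floor_le hNpos.le
  have hNn : N < n + 1 := Nat.lt_floor_add_one N
  have hn₀ : n₀ + 1 ≤ n := by
    rw [hn, Nat.le_floor_iff hNpos.le]
    push_cast
    have : (0 : ℝ) ≤ n₀ := Nat.cast_nonneg _
    linarith
  have hnpos : 0 < n := by omega
  have hn1 : (1 : ℝ) ≤ n := by exact_mod_cast hnpos
  have hNn2 : N ≤ 2 * n := by linarith
  set T : ℝ := r ^ 2 * n * d₀ with hT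
  have hr2 : 0 < r ^ 2 := by positivity
  have hT1 : 1 ≤ T := by
    have h1 : R ≤ 2 * n * (B * d₀) := by
      rw [← hNd]
      exact mul_le_mul hNn2 (mul_le_mul_of_nonneg_left hdl2 (by linarith)) hBd.le (by positivity)
    have h2 : 2 * B ≤ 2 * n * (B * d₀) * r ^ 2 := by
      rw [div_le_iff₀ hr2] at hR2
      exact hR2.trans (mul_le_mul_of_nonneg_right h1 hr2.le)
    have h3 : 2 * B * 1 ≤ 2 * B * T := by
      rw [hT]; linarith
    exact le_of_mul_le_mul_left h3 (by linarith)
  refine ⟨n, by omega, hnpos, ?_⟩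
  have hlow : T / 2 ≤ G.stochasticMinimaxRegret s n :=
    G.le_stochasticMinimaxRegret s hk hnpos fun L =>
      G.exists_regret_ge s hM μ.2 hd₀ hNpos hI (fun π => (hd π).1) (fun π => (hd π).2) hnpos hnN
        hr hT hT1 L
  refine le_trans ?_ hlow
  -- `(2 d₀) ^ l = R / N ≥ 1 / n`
  have h2d₀ : (n : ℝ) ^ (-(1 / l)) ≤ 2 * d₀ := by
    have h1 : (n : ℝ)⁻¹ ≤ (2 * d₀) ^ l := by
      have hR3 : 2 ≤ R := by
        have : (0 : ℝ) ≤ n₀ := Nat.cast_nonneg _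
        nlinarith
      rw [h2d, inv_eq_one_div, div_le_iff₀ (by linarith)]
      have h2 : R ≤ 2 * n * (B * d₀ ^ l) := by
        rw [← hNd]
        exact mul_le_mul_of_nonneg_right hNn2 hBd.le
      nlinarith
    have h3 := Real.rpow_le_rpow (by positivity) h1 (by positivity : 0 ≤ 1 / l)
    rw [← Real.rpow_mul (by positivity), mul_one_div_cancel hl0.ne', Real.rpow_one] at h3
    rwa [Real.rpow_neg (by positivity), ← Real.inv_rpow (by positivity)]
  have hsplit : (n : ℝ) ^ (1 - 1 / l) = n * (n : ℝ) ^ (-(1 / l)) := by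
    rw [sub_eq_add_neg, Real.rpow_add (by linarith), Real.rpow_one]
  rw [hsplit, hT]
  have h5 := mul_le_mul_of_nonneg_left h2d₀ (by positivity : 0 ≤ r ^ 2 / 4 * n)
  linarith

/-! ### Trivial games -/

lemma stochasticMinimaxRegret_le (hk : 0 < k) [Nonempty Z] {n : ℕ} (hn : 0 < n) :
    G.stochasticMinimaxRegret s n ≤ G.minimaxRegret s n := by
  have hkne : Nonempty (Fin k) := ⟨⟨0, hk⟩⟩
  have hne : Nonempty (FinDist Z) := (inferInstance : Nonempty Z).map StdSimplex.single
  obtain ⟨x⟩ := id hne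
  refine ciInf_mono ⟨-(n : ℝ), ?_⟩ fun L => ciSup_le fun x =>
    le_ciSup (f := fun x : Fin n → FinDist Z => G.regret s L x)
      ⟨n, by rintro _ ⟨y, rfl⟩; exact G.regret_le s hn L y⟩ fun _ => x
  rintro _ ⟨L, rfl⟩
  exact (G.neg_le_regret s hk hn L _).trans
    (le_ciSup (f := fun x => G.regret s L (fun _ : Fin n => x))
      ⟨n, by rintro _ ⟨y, rfl⟩; exact G.regret_le s hn L _⟩ x)

lemma regret_const_nonneg {n : ℕ} (hn : 0 < n) (L : Learner k Sig) (x : FinDist Z) :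
    0 ≤ G.regret s L (fun _ : Fin n => x) := by
  obtain ⟨S, hS⟩ := G.exists_covers fun _ : Unit => x
  rw [G.regret_const_eq s (hS ()) hn L]
  exact Finset.sum_nonneg fun t _ => pathExp_nonneg _ _ (G.playKernel_nonneg L _) _
    fun h => (G.gap_mem s _ x).1

lemma regret_one_le {n : ℕ} (hn : 0 < n) (L : Learner k Sig) (x : FinDist Z) :
    G.regret s L (fun _ : Fin 1 => x) ≤ G.regret s L (fun _ : Fin n => x) := by
  obtain ⟨S, hS⟩ := G.exists_covers fun _ : Unit => x
  rw [G.regret_const_eq s (hS ()) hn L, G.regret_const_eq s (hS ()) one_pos L]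
  exact Finset.sum_le_sum_of_subset_of_nonneg (Finset.range_mono hn) fun t _ _ =>
    pathExp_nonneg _ _ (G.playKernel_nonneg L _) _ fun h => (G.gap_mem s _ x).1

lemma stochasticMinimaxRegret_nonneg {n : ℕ} (hn : 0 < n) :
    0 ≤ G.stochasticMinimaxRegret s n :=
  Real.iInf_nonneg fun L => Real.iSup_nonneg fun x => G.regret_const_nonneg s hn L x

lemma stochasticMinimaxRegret_one_le (hk : 0 < k) [Nonempty Z] {n : ℕ} (hn : 0 < n) :
    G.stochasticMinimaxRegret s 1 ≤ G.stochasticMinimaxRegret s n := by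
  have hkne : Nonempty (Fin k) := ⟨⟨0, hk⟩⟩
  have hne : Nonempty (FinDist Z) := (inferInstance : Nonempty Z).map StdSimplex.single
  refine ciInf_mono ⟨0, ?_⟩ fun L => ciSup_mono
    ⟨n, by rintro _ ⟨y, rfl⟩; exact G.regret_le s hn L _⟩ fun x => G.regret_one_le s hn L x
  rintro _ ⟨L, rfl⟩
  exact Real.iSup_nonneg fun x => G.regret_const_nonneg s one_pos L x

/-- If one round against a stationary adversary can be played without regret, then by compactness
there is a policy that is optimal against all latent distributions. -/
lemma exists_optimal_policy (hk : 0 < k) [Nonempty Z] (h : G.stochasticMinimaxRegret s 1 = 0) :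
    ∃ π : Policy k, ∀ x, G.value s π x ≤ G.optValue s x := by
  have hkne : Nonempty (Fin k) := ⟨⟨0, hk⟩⟩
  have hone : ∀ (L : Learner k Sig) (x : FinDist Z),
      G.regret s L (fun _ : Fin 1 => x) = G.value s (L 0 Fin.elim0) x - G.optValue s x := by
    intro L x
    obtain ⟨S, hS⟩ := G.exists_covers fun _ : Unit => x
    rw [G.regret_const_eq s (hS ()) one_pos L, Finset.sum_range_one, pathExp_zero]
  have hex : ∀ ε > 0, ∃ π : Policy k, ∀ x, G.value s π x ≤ G.optValue s x + ε := by
    intro ε hε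
    obtain ⟨L, hL⟩ := exists_lt_of_ciInf_lt (h.trans_lt hε)
    refine ⟨L 0 Fin.elim0, fun x => ?_⟩
    have h1 := le_ciSup (f := fun x => G.regret s L (fun _ : Fin 1 => x))
      ⟨(1 : ℕ), by rintro _ ⟨y, rfl⟩; exact G.regret_le s one_pos L _⟩ x
    rw [hone] at h1
    linarith
  obtain ⟨π, -, hπ⟩ := isCompact_univ.inter_iInter_nonempty
    (fun q : FinDist Z × Set.Ioi (0 : ℝ) =>
      {π : Policy k | G.value s π q.1 ≤ G.optValue s q.1 + q.2.1})
    (fun q => isClosed_le (G.continuous_value s q.1) continuous_const) (by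
      intro u
      obtain ⟨ε, hε, hεu⟩ : ∃ ε > 0, ∀ q ∈ u, ε ≤ q.2.1 := by
        rcases u.eq_empty_or_nonempty with rfl | hu
        · exact ⟨1, one_pos, by simp⟩
        · obtain ⟨q, hq, hmin⟩ := u.exists_min_image (fun q => q.2.1) hu
          exact ⟨q.2.1, q.2.2, hmin⟩
      obtain ⟨π, hπ⟩ := hex ε hε
      refine ⟨π, Set.mem_univ _, ?_⟩
      simp only [Set.mem_iInter]
      intro q hq
      have h1 := hπ q.1
      have h2 := hεu q hq
      change G.value s π q.1 ≤ G.optValue s q.1 + q.2.1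
      linarith)
  refine ⟨π, fun x => le_of_forall_pos_le_add fun ε hε => ?_⟩
  exact Set.mem_iInter.1 hπ (x, ⟨ε, hε⟩)

lemma minimaxRegret_nonpos (hk : 0 < k) [Nonempty Z] {m : ℕ} {f : Fin m → Z → ℝ}
    (hf : G.IsPieces s f) (h : G.stochasticMinimaxRegret s 1 = 0) {n : ℕ} (hn : 0 < n) :
    G.minimaxRegret s n ≤ 0 := by
  have hne : Nonempty (FinDist Z) := (inferInstance : Nonempty Z).map StdSimplex.single
  obtain ⟨π, hπ⟩ := G.exists_optimal_policy s hk h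
  refine G.minimaxRegret_le_of_bayes s hk hn fun u p hp _ => ⟨fun _ _ => π, ?_⟩
  refine Finset.sum_nonpos fun x _ => mul_nonpos_of_nonneg_of_nonpos (hp x) ?_
  obtain ⟨S, hS⟩ := G.exists_covers_extend hn fun _ : Unit => x
  have h1 : G.expectedValue s (fun _ _ => π : Learner k Sig) x = ∑ t, G.value s π (x t) := by
    rw [G.expectedValue_eq_extend s hn x (hS ())]
    simp only [pathExp_const _ _ fun t h => (hS () t).sum_playKernel_one (fun _ _ => π) h]
    rw [Finset.sum_range]
    exact Finset.sum_congr rfl fun t _ => by rw [← congrFun (extend_coe hn x) t]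
  have h2 : ∑ t, G.optValue s (x t) ≤ n * G.optValue s (averageDist hn x) := by
    have h3 := G.ev_optValue_le hf (uniform n hn) x
    have hnR : (0 : ℝ) < n := by exact_mod_cast hn
    have h4 := mul_le_mul_of_nonneg_left h3 hnR.le
    refine le_trans (le_of_eq ?_) h4
    rw [ev_fintype, Finset.mul_sum]
    refine Finset.sum_congr rfl fun t _ => ?_
    simp [uniform, hnR.ne']
  rw [G.regret_of_pos s hn, h1]
  have h5 : ∑ t, G.value s π (x t) ≤ ∑ t, G.optValue s (x t) :=
    Finset.sum_le_sum fun t _ => hπ (x t)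
  linarith

/-- Either both minimax regrets vanish for all horizons, or they are positive for all
horizons. -/
lemma regret_dichotomy (hk : 0 < k) [Nonempty Z] {m : ℕ} {f : Fin m → Z → ℝ}
    (hf : G.IsPieces s f) :
    (∀ n : ℕ, 0 < n → G.minimaxRegret s n = 0 ∧ G.stochasticMinimaxRegret s n = 0) ∨
      (∀ n : ℕ, 0 < n → 0 < G.minimaxRegret s n ∧ 0 < G.stochasticMinimaxRegret s n) := by
  rcases (G.stochasticMinimaxRegret_nonneg s one_pos).eq_or_lt with h0 | hpos
  · left
    intro n hn
    have h1 := G.minimaxRegret_nonpos s hk hf h0.symm hn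
    have h2 := G.stochasticMinimaxRegret_le s hk hn
    have h3 := G.stochasticMinimaxRegret_nonneg s hn
    constructor <;> linarith
  · right
    intro n hn
    have h1 := hpos.trans_le (G.stochasticMinimaxRegret_one_le s hk hn)
    exact ⟨h1.trans_le (G.stochasticMinimaxRegret_le s hk hn), h1⟩

end Game

/-! ### Growth exponents -/

lemma tendsto_log_affine_log_div_log {C D : ℝ} (hC : 1 ≤ C) (hD : 0 ≤ D) :
    Tendsto (fun n : ℕ => Real.log (C + D * Real.log n) / Real.log n) atTop (𝓝 0) := by
  have hlog : Tendsto (fun n : ℕ => Real.log n) atTop atTop :=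
    Real.tendsto_log_atTop.comp tendsto_natCast_atTop_atTop
  have h1 : Tendsto (fun x : ℝ => Real.log x / x) atTop (𝓝 0) :=
    Real.isLittleO_log_id_atTop.tendsto_div_nhds_zero
  have h2 : Tendsto (fun x : ℝ => (Real.log (C + D) + Real.log x) / x) atTop (𝓝 0) := by
    have h3 : Tendsto (fun x : ℝ => Real.log (C + D) / x) atTop (𝓝 0) :=
      tendsto_const_nhds.div_atTop tendsto_id
    have := h3.add h1
    rw [add_zero] at this
    exact this.congr fun x => (add_div _ _ _).symm
  refine squeeze_zero' ?_ ?_ (h2.comp hlog)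
  · filter_upwards [hlog.eventually_ge_atTop 1] with n hn
    refine div_nonneg (Real.log_nonneg ?_) (by linarith)
    nlinarith
  · filter_upwards [hlog.eventually_ge_atTop 1] with n hn
    simp only [Function.comp]
    refine div_le_div_of_nonneg_right ?_ (by linarith)
    rw [← Real.log_mul (by linarith) (by linarith)]
    refine Real.log_le_log (by nlinarith) (by nlinarith)

/-- The growth exponent of a sequence which is bounded by `n ^ (1 - 1 / l)` up to logarithmic
factors for the exponents `l ∈ Λ`, but not for other exponents. -/
lemma limsup_log_div_log_eq {u : ℕ → ℝ} {Λ : Set ℝ} (hΛ : ∀ l ∈ Λ, 1 < l)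
    (hupper : ∀ l ∈ Λ, ∃ C D : ℝ, 1 ≤ C ∧ 0 ≤ D ∧ ∀ n : ℕ, 0 < n →
      u n ≤ (n : ℝ) ^ (1 - 1 / l) * (C + D * Real.log n))
    (hle : ∀ n : ℕ, 0 < n → u n ≤ n)
    (hlower : ∀ l, 1 < l → l ∉ Λ → ∃ c > 0, ∀ n₀ : ℕ, ∃ n ≥ n₀, 0 < n ∧
      c * (n : ℝ) ^ (1 - 1 / l) ≤ u n)
    (hpos : (∀ n : ℕ, 0 < n → u n = 0) ∨ ∃ c > 0, ∀ n : ℕ, 0 < n → c ≤ u n) :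
    limsup (fun n : ℕ => ((Real.log (u n) / Real.log n : ℝ) : EReal)) atTop
      = 1 - 1 / sInf ((fun l : ℝ => (l : EReal)) '' Λ) := by
  have hlog : Tendsto (fun n : ℕ => Real.log n) atTop atTop :=
    Real.tendsto_log_atTop.comp tendsto_natCast_atTop_atTop
  have hu0 : ∀ n : ℕ, 0 < n → 0 ≤ u n := by
    rcases hpos with h | ⟨c, hc, h⟩
    · exact fun n hn => (h n hn).ge
    · exact fun n hn => hc.le.trans (h n hn)
  set ρ : ℕ → EReal := fun n => ((Real.log (u n) / Real.log n : ℝ) : EReal) with hρ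
  -- reductions of bounds on the upper limit to bounds by convergent sequences
  have hge : ∀ (w : ℕ → ℝ) (y : ℝ), Tendsto w atTop (𝓝 y) →
      (∃ᶠ n in atTop, w n ≤ Real.log (u n) / Real.log n) → (y : EReal) ≤ limsup ρ atTop := by
    intro w y hw hfreq
    rw [← EReal.ge_of_forall_gt_iff_ge]
    intro z hz
    rw [EReal.coe_lt_coe_iff] at hz
    refine le_limsup_of_frequently_le ?_
    refine (hfreq.and_eventually (hw.eventually_const_le hz)).mono fun n hn => ?_
    exact EReal.coe_le_coe_iff.2 (hn.2.trans hn.1)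
  have hle' : ∀ (w : ℕ → ℝ) (y : ℝ), Tendsto w atTop (𝓝 y) →
      (∀ᶠ n in atTop, Real.log (u n) / Real.log n ≤ w n) → limsup ρ atTop ≤ (y : EReal) := by
    intro w y hw hev
    have hw' : Tendsto (fun n => (w n : EReal)) atTop (𝓝 (y : EReal)) :=
      (continuous_coe_real_ereal.tendsto y).comp hw
    rw [← hw'.limsup_eq]
    exact limsup_le_limsup (hev.mono fun n hn => EReal.coe_le_coe_iff.2 hn)
  have hdiv0 : ∀ c : ℝ, Tendsto (fun n : ℕ => c / Real.log n) atTop (𝓝 0) := fun c =>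
    tendsto_const_nhds.div_atTop hlog
  have hzero : (0 : EReal) ≤ limsup ρ atTop := by
    rcases hpos with h | ⟨c, hc, h⟩
    · refine hge (fun _ => 0) 0 tendsto_const_nhds (Eventually.frequently ?_)
      filter_upwards [eventually_gt_atTop 0] with n hn
      rw [h n hn]
      simp
    · refine hge (fun n => Real.log c / Real.log n) 0 (hdiv0 _) (Eventually.frequently ?_)
      filter_upwards [eventually_gt_atTop 0, hlog.eventually_ge_atTop 0] with n hn hn0
      exact div_le_div_of_nonneg_right (Real.log_le_log hc (h n hn)) hn0
  have hone : limsup ρ atTop ≤ ((1 : ℝ) : EReal) := by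
    refine hle' (fun _ => 1) 1 tendsto_const_nhds ?_
    filter_upwards [eventually_gt_atTop 0, hlog.eventually_gt_atTop 0] with n hn hn0
    rw [div_le_one hn0]
    rcases (hu0 n hn).eq_or_lt with h0 | h0
    · rw [← h0, Real.log_zero]; exact hn0.le
    · exact Real.log_le_log h0 (hle n hn)
  have hup : ∀ l ∈ Λ, limsup ρ atTop ≤ ((1 - 1 / l : ℝ) : EReal) := by
    intro l hl
    obtain ⟨C, D, hC, hD, hb⟩ := hupper l hl
    have ht := (tendsto_log_affine_log_div_log hC hD).const_add (1 - 1 / l)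
    rw [add_zero] at ht
    refine hle' _ _ ht ?_
    filter_upwards [eventually_gt_atTop 0, hlog.eventually_gt_atTop 0] with n hn hn0
    have hnR : (0 : ℝ) < n := by exact_mod_cast hn
    have hCD : 1 ≤ C + D * Real.log n := by
      have := mul_nonneg hD hn0.le
      linarith
    have hl1 := hΛ l hl
    have hexp : 0 ≤ 1 - 1 / l := by
      rw [sub_nonneg, div_le_one (by linarith)]; linarith
    rw [div_le_iff₀ hn0, add_mul, div_mul_cancel₀ _ hn0.ne']
    rcases (hu0 n hn).eq_or_lt with h0 | h0
    · rw [← h0, Real.log_zero]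
      exact add_nonneg (mul_nonneg hexp hn0.le) (Real.log_nonneg hCD)
    · rw [← Real.log_rpow hnR, ← Real.log_mul (Real.rpow_pos_of_pos hnR _).ne' (by linarith)]
      exact Real.log_le_log h0 (hb n hn)
  have hlow : ∀ y : ℝ, 0 < y → y < 1 → 1 / (1 - y) ∉ Λ → (y : EReal) ≤ limsup ρ atTop := by
    intro y hy0 hy1 hy
    have h1 : 1 < 1 / (1 - y) := by
      rw [lt_div_iff₀ (by linarith)]; linarith
    obtain ⟨c, hc, hfreq⟩ := hlower _ h1 hy
    have h2 : 1 - 1 / (1 / (1 - y)) = y := by rw [one_div_one_div]; ring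
    rw [h2] at hfreq
    have ht := (hdiv0 (Real.log c)).const_add y
    rw [add_zero] at ht
    refine hge _ y ht (frequently_atTop.2 fun n₀ => ?_)
    obtain ⟨n, hn, -, hb⟩ := hfreq (max n₀ 2)
    refine ⟨n, (le_max_left _ _).trans hn, ?_⟩
    have hn2 : 2 ≤ n := (le_max_right _ _).trans hn
    have hnR : (1 : ℝ) < n := by exact_mod_cast hn2
    have hn0 : 0 < Real.log n := Real.log_pos hnR
    have hnp : 0 < (n : ℝ) ^ y := Real.rpow_pos_of_pos (by linarith) _
    rw [le_div_iff₀ hn0, add_mul, div_mul_cancel₀ _ hn0.ne', ← Real.log_rpow (by linarith),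
      add_comm, ← Real.log_mul hc.ne' hnp.ne']
    exact Real.log_le_log (by positivity) hb
  rcases Λ.eq_empty_or_nonempty with hE | hne
  · have h1 : (1 : EReal) - 1 / sInf ((fun l : ℝ => (l : EReal)) '' Λ) = ((1 : ℝ) : EReal) := by
      rw [hE, Set.image_empty, sInf_empty, EReal.div_top, sub_zero]
      rfl
    rw [h1]
    refine le_antisymm hone ?_
    rw [← EReal.ge_of_forall_gt_iff_ge]
    intro y hy
    rw [EReal.coe_lt_coe_iff] at hy
    rcases le_or_gt y 0 with hy0 | hy0
    · exact (EReal.coe_le_coe_iff.2 hy0).trans hzero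
    · exact hlow y hy0 hy (by simp [hE])
  · have hbdd : BddBelow Λ := ⟨1, fun l hl => (hΛ l hl).le⟩
    set l₀ := sInf Λ with hl₀
    have hl₀1 : 1 ≤ l₀ := le_csInf hne fun l hl => (hΛ l hl).le
    have hinf : sInf ((fun l : ℝ => (l : EReal)) '' Λ) = (l₀ : EReal) := by
      refine IsGLB.sInf_eq ⟨?_, fun b hb => ?_⟩
      · rintro _ ⟨l, hl, rfl⟩
        exact EReal.coe_le_coe_iff.2 (csInf_le hbdd hl)
      · rw [← EReal.le_of_forall_lt_iff_le]
        intro z hz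
        rw [EReal.coe_lt_coe_iff] at hz
        obtain ⟨l, hl, hlz⟩ := exists_lt_of_csInf_lt hne hz
        exact (hb ⟨l, hl, rfl⟩).trans (EReal.coe_le_coe_iff.2 hlz.le)
    have hrhs : (1 : EReal) - 1 / (l₀ : EReal) = ((1 - 1 / l₀ : ℝ) : EReal) := by
      rw [EReal.coe_sub, EReal.coe_div, EReal.coe_one]
    rw [hinf, hrhs]
    refine le_antisymm ?_ ?_
    · rw [← EReal.le_of_forall_lt_iff_le]
      intro z hz
      rw [EReal.coe_lt_coe_iff] at hz
      obtain ⟨l, hl, hlz⟩ := exists_lt_of_csInf_lt hne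
        (show l₀ < l₀ + (z - (1 - 1 / l₀)) by linarith)
      refine (hup l hl).trans (EReal.coe_le_coe_iff.2 ?_)
      have h1 : l₀ ≤ l := csInf_le hbdd hl
      have h2 : 1 / l₀ - 1 / l ≤ l - l₀ := by
        rw [div_sub_div _ _ (by linarith) (by linarith), div_le_iff₀ (by nlinarith)]
        nlinarith [mul_nonneg (sub_nonneg.2 h1) (by nlinarith : 0 ≤ l₀ * l - 1)]
      linarith
    · rw [← EReal.ge_of_forall_gt_iff_ge]
      intro y hy
      rw [EReal.coe_lt_coe_iff] at hy
      rcases le_or_gt y 0 with hy0 | hy0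
      · exact (EReal.coe_le_coe_iff.2 hy0).trans hzero
      have hl₀0 : 0 < 1 / l₀ := by positivity
      refine hlow y hy0 (by linarith) fun hmem => ?_
      have h1 : l₀ ≤ 1 / (1 - y) := csInf_le hbdd hmem
      rw [le_div_iff₀ (by linarith)] at h1
      have h2 : l₀ * (1 / l₀) = 1 := mul_one_div_cancel (by linarith)
      nlinarith

namespace Game

variable {k : ℕ} {Z Sig : Type*} (G : Game k Z Sig) (s : Setting)

lemma minimaxRegret_le_horizon (hk : 0 < k) [Nonempty Z] {n : ℕ} (hn : 0 < n) :
    G.minimaxRegret s n ≤ n := by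
  have hkne : Nonempty (Fin k) := ⟨⟨0, hk⟩⟩
  obtain ⟨L⟩ : Nonempty (Learner k Sig) := inferInstance
  exact G.minimaxRegret_le_of_bayes s hk hn fun u p hp hp1 => ⟨L, by
    calc ∑ x ∈ u, p x * G.regret s L x ≤ ∑ x ∈ u, p x * n :=
          Finset.sum_le_sum fun x _ => mul_le_mul_of_nonneg_left (G.regret_le s hn L x) (hp x)
      _ = n := by rw [← Finset.sum_mul, hp1, one_mul]⟩

/-- A finite minimax information ratio bounds the growth of the minimax regret. -/
lemma exists_minimaxRegret_le (hk : 0 < k) [Nonempty Z] (hs : s = .rustichini → Finite Z) {l : ℝ}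
    (hl : 1 < l) (hinfo : G.minimaxInfoRatio s l < ∞) :
    ∃ C D : ℝ, 1 ≤ C ∧ 0 ≤ D ∧ ∀ n : ℕ, 0 < n →
      G.minimaxRegret s n ≤ (n : ℝ) ^ (1 - 1 / l) * (C + D * Real.log n) := by
  obtain ⟨f, C₀, hf, hC₀⟩ := G.exists_pieces s hk hs
  set m := G.numPieces s with hm
  have hm0 : 0 < m := hf.card_pos
  have hmR : (1 : ℝ) ≤ m := by exact_mod_cast hm0
  obtain ⟨Ψ, hΨ0, hΨ⟩ : ∃ Ψ : ℝ, 0 ≤ Ψ ∧ G.minimaxInfoRatio s l < ENNReal.ofReal Ψ := by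
    obtain ⟨b, hb⟩ := ENNReal.lt_iff_exists_nnreal_btwn.1 hinfo
    exact ⟨b, b.2, by simpa using hb.1⟩
  have hlm : 0 ≤ Real.log m := Real.log_nonneg hmR
  have hl0 : 0 < l := by linarith
  have hexp : 0 ≤ 1 - 1 / l := by
    rw [sub_nonneg, div_le_one hl0]; exact hl.le
  refine ⟨1 + |C₀| + Ψ * m * Real.log m, Ψ * m, ?_, by positivity, fun n hn => ?_⟩
  · have : 0 ≤ Ψ * m * Real.log m := by positivity
    have := abs_nonneg C₀
    linarith
  have hnR : (0 : ℝ) < n := by exact_mod_cast hn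
  have hn1 : (1 : ℝ) ≤ n := by exact_mod_cast hn
  -- the threshold balancing the two terms of the bound
  have h := G.minimaxRegret_le s hk le_rfl hf hC₀ hl hΨ0
    (Real.rpow_pos_of_pos hnR (-(1 / l))) hΨ hn
  have e1 : (n : ℝ) * (n : ℝ) ^ (-(1 / l)) = (n : ℝ) ^ (1 - 1 / l) := by
    rw [sub_eq_add_neg, Real.rpow_add hnR, Real.rpow_one]
  have e2 : ((n : ℝ) ^ (-(1 / l))) ^ (1 - l) = (n : ℝ) ^ (1 - 1 / l) := by
    rw [← Real.rpow_mul hnR.le]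
    congr 1
    field_simp
    ring
  rw [e1, e2, ← hm, Real.log_mul hnR.ne' (by linarith)] at h
  have hp1 : 1 ≤ (n : ℝ) ^ (1 - 1 / l) := Real.one_le_rpow hn1 hexp
  have h3 : C₀ ≤ (n : ℝ) ^ (1 - 1 / l) * |C₀| := by
    have := le_abs_self C₀
    nlinarith [abs_nonneg C₀]
  linarith

end Game

end PartialMonitoring

end

theorem theorem1 {k : ℕ} {Z Sig : Type*} (hk : 0 < k) [Nonempty Z]
    (G : PartialMonitoring.Game k Z Sig) (s : PartialMonitoring.Setting)
    (hs : s = PartialMonitoring.Setting.rustichini → Finite Z) :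
    -- either the minimax regret vanishes identically, or it never does
    ((∀ n : ℕ, 0 < n → G.minimaxRegret s n = 0 ∧ G.stochasticMinimaxRegret s n = 0) ∨
      (∀ n : ℕ, 0 < n → 0 < G.minimaxRegret s n ∧ 0 < G.stochasticMinimaxRegret s n)) ∧
    -- the growth exponent of the minimax regret (`Real.log 0 = 0`)
    limsup (fun n : ℕ => ((Real.log (G.minimaxRegret s n) / Real.log n : ℝ) : EReal)) atTop
      = 1 - 1 / G.critExponent s ∧
    -- the same growth exponent is forced by stationary stochastic adversaries alone
    limsup (fun n : ℕ => ((Real.log (G.stochasticMinimaxRegret s n) / Real.log n : ℝ) : EReal))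
      atTop = 1 - 1 / G.critExponent s := by
  obtain ⟨f, C, hf, -⟩ := G.exists_pieces s hk hs
  have hdich := G.regret_dichotomy s hk hf
  have hst : ∀ n : ℕ, 0 < n → G.stochasticMinimaxRegret s n ≤ G.minimaxRegret s n :=
    fun n hn => G.stochasticMinimaxRegret_le s hk hn
  have hupper := fun (l : ℝ) (hl : l ∈ {l : ℝ | 1 < l ∧ G.minimaxInfoRatio s l < ∞}) =>
    G.exists_minimaxRegret_le s hk hs hl.1 hl.2
  have hlower : ∀ l, 1 < l → l ∉ {l : ℝ | 1 < l ∧ G.minimaxInfoRatio s l < ∞} →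
      ∃ c > 0, ∀ n₀ : ℕ, ∃ n ≥ n₀, 0 < n ∧
        c * (n : ℝ) ^ (1 - 1 / l) ≤ G.stochasticMinimaxRegret s n := by
    intro l hl hnot
    refine G.exists_stochasticMinimaxRegret_ge s hk hf.card_pos hl ?_
    by_contra hne
    exact hnot ⟨hl, lt_top_iff_ne_top.2 hne⟩
  refine ⟨hdich, ?_, ?_⟩
  · refine PartialMonitoring.limsup_log_div_log_eq (fun l hl => hl.1) hupper
      (fun n hn => G.minimaxRegret_le_horizon s hk hn) (fun l hl hnot => ?_) ?_
    · obtain ⟨c, hc, h⟩ := hlower l hl hnot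
      refine ⟨c, hc, fun n₀ => ?_⟩
      obtain ⟨n, hn, hn0, hb⟩ := h n₀
      exact ⟨n, hn, hn0, hb.trans (hst n hn0)⟩
    · refine hdich.imp (fun h n hn => (h n hn).1) fun h => ⟨_, (h 1 one_pos).2, fun n hn => ?_⟩
      exact (G.stochasticMinimaxRegret_one_le s hk hn).trans (hst n hn)
  · refine PartialMonitoring.limsup_log_div_log_eq (fun l hl => hl.1) (fun l hl => ?_)
      (fun n hn => (hst n hn).trans (G.minimaxRegret_le_horizon s hk hn)) hlower ?_
    · obtain ⟨C, D, hC, hD, h⟩ := hupper l hl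
      exact ⟨C, D, hC, hD, fun n hn => (hst n hn).trans (h n hn)⟩
    · exact hdich.imp (fun h n hn => (h n hn).2) fun h =>
        ⟨_, (h 1 one_pos).2, fun n hn => G.stochasticMinimaxRegret_one_le s hk hn⟩
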